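/- Let $\mu,\upsilon>-1$ and $0<\rho\le 1$. On $J=(0,1)$ put $$\varkappa^{\mu,\upsilon,\rho}(t)=\rho(1-t)^{\rho(\mu+1)-1}\bigl(1-(1-t)^\rho\bigr)^{\upsilon},\qquad \tilde\varkappa^{\mu,\upsilon,\rho}(t)=\rho^{-1}(1-t)^{\rho\mu+1}\bigl(1-(1-t)^\rho\bigr)^{\upsilon+1},$$ $\|g\|_{0,w}=\bigl(\int_0^1 g^2w\,dt\bigr)^{1/2}$, and $\mathcal D_\rho g(t)=\rho^{-1}(1-t)^{1-\rho}g'(t)$, with $\mathcal D_\rho^{k}$ its $k$-fold iterate (so $\mathcal D_1=\partial_t$). For an integer $s\ge 1$ let $B^{s,1}_{\mu,\upsilon}(J)$ be the space of functions $g$ (identified with their continuous representatives on $(0,1)$) that have generalized derivatives $\partial_t^k g\in L^2_{\varkappa^{\mu+k,\upsilon+k,1}}(J)$ for $0\le k\le s$, that is, $\partial_t^kg$ is locally absolutely continuous on $(0,1)$ for $k<s$. For $N\ge 1$ let $t_0,\dots,t_N$ be the zeros in $(0,1)$ of $t\mapsto P^{\mu,\upsilon}_{N+1}(1-2(1-t)^\rho)$,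 where $P^{\mu,\upsilon}_{n}$ is the classical Jacobi polynomial of degree $n$ on $[-1,1]$ (weight $(1-x)^\mu(1+x)^\upsilon$), and let $$J_{N,\rho}^{\mu,\upsilon}f(t)=\sum_{j=0}^N f(t_j)\prod_{\substack{i=0\\ i\ne j}}^{N}\frac{(1-t)^\rho-(1-t_i)^\rho}{(1-t_j)^\rho-(1-t_i)^\rho}$$ be the Zaky--Jacobi--Gauss interpolation operator. For a real function $f$ write $F(t)=f\bigl(1-(1-t)^{1/\rho}\bigr)$. (i) There is a constant $c>0$, depending only on $\mu,\upsilon,\rho$, such that for all integers $N\ge 1$, $s\ge 1$ and $0\le\jmath\le s\le N+1$ and all $f$ with $F\in B^{s,1}_{\mu,\upsilon}(J)$, $$\bigl\|\mathcal D_\rho^{\jmath}(f-J_{N,\rho}^{\mu,\upsilon}f)\bigr\|_{0,\varkappa^{\mu+\jmath,\upsilon+\jmath,\rho}}\le c\sqrt{\frac{(N-s+1)!}{N!}}\;N^{\jmath-(s+1)/2}\,\bigl\|\partial_t^sF\bigr\|_{0,\varkappa^{\mu+s,\upsilon+s,1}}.$$ (ii) For every fixed integer $s\ge 1$ there is a constant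 $c>0$, independent of $N$ and $f$, such that for all integers $N\ge 1$ with $s\le N+1$ and all $f$ with $F\in B^{s,1}_{\mu,\upsilon}(J)$, $$\bigl\|\mathcal D_\rho^{\jmath}(f-J_{N,\rho}^{\mu,\upsilon}f)\bigr\|_{0,\varkappa^{\mu+\jmath,\upsilon+\jmath,\rho}}\le c\,N^{\jmath-s}\,\bigl\|\partial_t^sF\bigr\|_{0,\varkappa^{\mu+s,\upsilon+s,1}}\qquad(0\le\jmath\le s);$$ in particular $$\bigl\|f-J_{N,\rho}^{\mu,\upsilon}f\bigr\|_{0,\varkappa^{\mu,\upsilon,\rho}}\le c\,N^{-s}\,\bigl\|\partial_t^sF\bigr\|_{0,\varkappa^{\mu+s,\upsilon+s,1}},\qquad \bigl\|\partial_t(f-J_{N,\rho}^{\mu,\upsilon}f)\bigr\|_{0,\tilde\varkappa^{\mu,\upsilon,\rho}}\le c\,N^{1-s}\,\bigl\|\partial_t^sF\bigr\|_{0,\varkappa^{\mu+s,\upsilon+s,1}}.$$ -/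

import Mathlib

open MeasureTheory

noncomputable section

namespace BackwardJacobi

/-- The classical Jacobi polynomial of degree `n` on `[-1, 1]` with parameters `α, β`
(orthogonal for the weight `(1 - x) ^ α * (1 + x) ^ β`), in the usual normalization:
`∑ k, (n + α + β + 1)_k (α + k + 1)_(n - k) / (k! (n - k)!) * ((x - 1) / 2) ^ k`,
where `(a)_k` is the rising factorial. -/
def jacobi (n : ℕ) (α β : ℝ) : Polynomial ℝ :=
  ∑ k ∈ Finset.range (n + 1),
    Polynomial.C ((ascPochhammer ℝ k).eval (n + α + β + 1) *
        (ascPochhammer ℝ (n - k)).eval (α + k + 1) /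
        (k.factorial * (n - k).factorial : ℝ)) *
      (Polynomial.C (1 / 2) * (Polynomial.X - 1)) ^ k

/-- The backward endpoint map. -/
def zmap (ρ t : ℝ) : ℝ := 1 - (1 - t) ^ ρ

/-- The fractional backward orthogonal function `t ↦ P_r^{μ,υ}(1 - 2 (1 - t) ^ ρ)`. -/
def backJacobi (r : ℕ) (μ υ ρ t : ℝ) : ℝ :=
  (jacobi r μ υ).eval (1 - 2 * (1 - t) ^ ρ)

/-- The backward transformed derivative `(1 - t) ^ (1 - ρ) / ρ * f'(t)`. -/
def backDeriv (ρ : ℝ) (f : ℝ → ℝ) : ℝ → ℝ :=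
  fun t => (1 - t) ^ (1 - ρ) / ρ * deriv f t

/-- The weight `ρ (1 - t) ^ (ρ (μ + 1) - 1) (1 - (1 - t) ^ ρ) ^ υ`. -/
def weight (μ υ ρ t : ℝ) : ℝ :=
  ρ * (1 - t) ^ (ρ * (μ + 1) - 1) * (1 - (1 - t) ^ ρ) ^ υ

/-- The weight `ρ⁻¹ (1 - t) ^ (ρ μ + 1) (1 - (1 - t) ^ ρ) ^ (υ + 1)`. -/
def weightTilde (μ υ ρ t : ℝ) : ℝ :=
  ρ⁻¹ * (1 - t) ^ (ρ * μ + 1) * (1 - (1 - t) ^ ρ) ^ (υ + 1)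

/-- The measure `w(t) dt` on the unit interval. -/
def wMeasure (w : ℝ → ℝ) : Measure ℝ :=
  (volume.restrict (Set.Ioo (0 : ℝ) 1)).withDensity fun t => ENNReal.ofReal (w t)

/-- The weighted norm `(∫₀¹ g(t)² w(t) dt) ^ (1/2)`, with value `∞` if the integral diverges. -/
def wNorm (w g : ℝ → ℝ) : ENNReal := eLpNorm g 2 (wMeasure w)

/-- The space `B_{μ,υ}^{s,ρ}` on the unit interval: the transformed derivatives of order `k ≤ s`
exist in the sense of (weighted) Sobolev spaces and lie in the corresponding weighted `L²` spaces.
In one dimension, and for the continuous representative, the existence of the generalized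
derivatives up to order `s` means that those of order `k < s` are locally absolutely continuous
in the open interval; the derivative of order `s` is then defined almost everywhere. -/
structure MemB (μ υ ρ : ℝ) (s : ℕ) (f : ℝ → ℝ) : Prop where
  locallyAC : ∀ k < s, ∀ a b : ℝ, 0 < a → a < b → b < 1 →
    AbsolutelyContinuousOnInterval ((backDeriv ρ)^[k] f) a b
  memLp : ∀ k ≤ s, MemLp ((backDeriv ρ)^[k] f) 2 (wMeasure (weight (μ + k) (υ + k) ρ))

open Classical in
/-- The Gauss nodes `t_0, …, t_N`: the zeros of `backJacobi (N + 1) μ υ ρ` in `(0, 1)`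
(see `mem_nodes`), obtained by solving `x = 1 - 2 (1 - t) ^ ρ` for the zeros `x` in `(-1, 1)` of
the Jacobi polynomial of degree `N + 1`. -/
def nodes (N : ℕ) (μ υ ρ : ℝ) : Finset ℝ :=
  ((jacobi (N + 1) μ υ).roots.toFinset.filter fun x => x ∈ Set.Ioo (-1 : ℝ) 1).image
    fun x => 1 - ((1 - x) / 2) ^ (1 / ρ)

theorem jacobi_ne_zero (n : ℕ) {α : ℝ} (β : ℝ) (hα : -1 < α) : jacobi n α β ≠ 0 := by
  intro h
  have h1 : (jacobi n α β).eval 1 = 0 := by rw [h]; simp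
  rw [jacobi, Polynomial.eval_finsetSum, Finset.sum_eq_single 0] at h1
  · have := ascPochhammer_pos n (α + 1) (by linarith)
    have h2 : (n.factorial : ℝ) ≠ 0 := by positivity
    simp [this.ne', h2] at h1
  · intro k _ hk
    simp [hk]
  · simp

theorem mem_nodes {N : ℕ} {μ υ ρ : ℝ} (hμ : -1 < μ) (hρ : 0 < ρ) (t : ℝ) :
    t ∈ nodes N μ υ ρ ↔ t ∈ Set.Ioo (0 : ℝ) 1 ∧ backJacobi (N + 1) μ υ ρ t = 0 := by
  classical
  have hne := jacobi_ne_zero (N + 1) υ hμ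
  simp only [nodes, Finset.mem_filter, Finset.mem_image, Multiset.mem_toFinset,
    Polynomial.mem_roots hne, Polynomial.IsRoot.def, backJacobi]
  constructor
  · rintro ⟨x, ⟨hx, hx1, hx2⟩, rfl⟩
    have h0 : 0 < (1 - x) / 2 := by linarith
    have h1 : (1 - x) / 2 < 1 := by linarith
    have h2 : 0 < ((1 - x) / 2) ^ (1 / ρ) := Real.rpow_pos_of_pos h0 _
    have h3 : ((1 - x) / 2) ^ (1 / ρ) < 1 := Real.rpow_lt_one h0.le h1 (by positivity)
    refine ⟨⟨by linarith, by linarith⟩, ?_⟩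
    rw [sub_sub_cancel, ← Real.rpow_mul h0.le, one_div_mul_cancel hρ.ne', Real.rpow_one]
    have h4 : 1 - 2 * ((1 - x) / 2) = x := by ring
    rw [h4]
    exact hx
  · rintro ⟨⟨ht0, ht1⟩, h⟩
    have h0 : 0 < 1 - t := by linarith
    have h1 : 0 < (1 - t) ^ ρ := Real.rpow_pos_of_pos h0 _
    have h2 : (1 - t) ^ ρ < 1 := Real.rpow_lt_one h0.le (by linarith) hρ
    refine ⟨_, ⟨h, by linarith, by linarith⟩, ?_⟩
    have h3 : (1 - (1 - 2 * (1 - t) ^ ρ)) / 2 = (1 - t) ^ ρ := by ring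
    rw [h3, ← Real.rpow_mul h0.le, mul_one_div_cancel hρ.ne', Real.rpow_one]
    ring

open Classical in
/-- The Lagrange basis function attached to the node `τ`: the product over the other nodes `σ`
of `(z(t) - z(σ)) / (z(τ) - z(σ))`, where `z(t) = 1 - (1 - t) ^ ρ`. -/
def lagrangeFun (N : ℕ) (μ υ ρ τ t : ℝ) : ℝ :=
  ∏ σ ∈ (nodes N μ υ ρ).erase τ, (zmap ρ t - zmap ρ σ) / (zmap ρ τ - zmap ρ σ)

/-- The Gauss interpolation operator `J_{N,ρ}^{μ,υ}`. -/
def interp (N : ℕ) (μ υ ρ : ℝ) (f : ℝ → ℝ) (t : ℝ) : ℝ :=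
  ∑ τ ∈ nodes N μ υ ρ, f τ * lagrangeFun N μ υ ρ τ t

/-- The function `t ↦ f (1 - (1 - t) ^ (1 / ρ))`. -/
def transform (ρ : ℝ) (f : ℝ → ℝ) (t : ℝ) : ℝ := f (1 - (1 - t) ^ (1 / ρ))

end BackwardJacobi

end

/-! ### Jacobi weights and measures on the unit interval. -/

namespace BackwardJacobi
open Set Filter Topology

/-! The substitution `z = 1 - (1 - t) ^ ρ` carries `f` to `F`, the transformed derivative to `d/dz`,
the weights to Jacobi weights on `(0, 1)`, and the operator to Lagrange interpolation at the zeros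
of the shifted Jacobi polynomial of degree `N + 1` (`wNorm_comp_zmap`, `iterate_backDeriv_eqOn`,
`interp_eq`). Only interpolation in the variable `z` remains.

Let `p` be the weighted orthogonal projection of `F` onto degree at most `N`, and `L` the
interpolation operator. Since `L p = p`, the error is `(F - p) - L (F - p)`. The derivatives of `F -
p` stay orthogonal to low degrees for the raised weights, so the weighted Poincaré inequality
`LocAC.poincare`, iterated down from order `s`, bounds the first term in every intermediate norm
(`WSob.integral_dsub_le`); the product of the eigenvalues yields the quotient of factorials.

The second term `q = L (F - p)` is a polynomial. The inverse inequality reduces its derivatives to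
its own norm, with a constant independent of the order because the order is at most `N + 1`. Gauss
quadrature is exact for `q ^ 2`, so that norm is the quadrature sum of `(F - p) ^ 2`. The heart of
the proof is its stability, `exists_sum_jomega_mul_sq_le`: the sum for `v ^ 2` is at most `‖v‖ ^ 2 +
(C / N) ‖v‖ ‖v'‖`. The factor `1 / N` pays for the derivative.

For stability, integrate by parts against `Φ = jphi`, the distribution function of the quadrature
minus that of the weight. The Chebyshev–Markov–Stieltjes inequalities (`jphi_node`) bound `|Φ x|` by
the weight of a zero-free interval next to `x`. Picone's identity for the Jacobi equation makes such
intervals short, and an endpoint estimate keeps zeros away from `0` and `1`; together they give `|Φ|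
≤ (C / N) w √(x (1 - x))` off the nodes (`exists_abs_jphi_le`), which is what Cauchy–Schwarz needs.

Part (ii) follows from (i) by an elementary bound on the quotient of factorials for fixed `s`. -/

/-- The Jacobi weight `(1 - z) ^ μ * z ^ υ` on the unit interval. -/
noncomputable def jw (μ υ z : ℝ) : ℝ := (1 - z) ^ μ * z ^ υ

/-- The measure with density `jw μ υ` on the unit interval. -/
noncomputable def jm (μ υ : ℝ) : Measure ℝ := wMeasure (jw μ υ)

theorem weight_one (μ υ : ℝ) : weight μ υ 1 = jw μ υ := by
  funext t
  simp [weight, jw]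

theorem jw_nonneg {μ υ z : ℝ} (hz : z ∈ Ioo (0 : ℝ) 1) : 0 ≤ jw μ υ z :=
  mul_nonneg (Real.rpow_nonneg (by linarith [hz.2]) _) (Real.rpow_nonneg hz.1.le _)

theorem jw_pos {μ υ z : ℝ} (hz : z ∈ Ioo (0 : ℝ) 1) : 0 < jw μ υ z :=
  mul_pos (Real.rpow_pos_of_pos (by linarith [hz.2]) _) (Real.rpow_pos_of_pos hz.1 _)

theorem measurable_jw (μ υ : ℝ) : Measurable (jw μ υ) := by
  unfold jw
  fun_prop

theorem jw_succ {μ υ z : ℝ} (hz : z ∈ Ioo (0 : ℝ) 1) :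
    jw (μ + 1) (υ + 1) z = z * (1 - z) * jw μ υ z := by
  have h1 : 0 < 1 - z := by linarith [hz.2]
  rw [jw, jw, Real.rpow_add_one h1.ne', Real.rpow_add_one hz.1.ne']
  ring

theorem jw_reflect (μ υ z : ℝ) : jw υ μ (1 - z) = jw μ υ z := by
  rw [jw, jw, sub_sub_cancel, mul_comm]

theorem continuousOn_jw (μ υ : ℝ) : ContinuousOn (jw μ υ) (Ioo 0 1) := by
  unfold jw
  refine ContinuousOn.mul ?_ ?_
  · exact (continuousOn_const.sub continuousOn_id).rpow_const
      fun x hx => Or.inl (sub_pos.2 hx.2).ne'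
  · exact continuousOn_id.rpow_const fun x hx => Or.inl hx.1.ne'

theorem hasDerivAt_jw_succ {μ υ z : ℝ} (hz : z ∈ Ioo (0 : ℝ) 1) :
    HasDerivAt (jw (μ + 1) (υ + 1)) (((υ + 1) - (μ + υ + 2) * z) * jw μ υ z) z := by
  have h1 : 0 < 1 - z := by linarith [hz.2]
  have h2 := ((hasDerivAt_id z).const_sub 1).rpow_const (p := μ + 1) (Or.inl h1.ne')
  have h3 := (hasDerivAt_id z).rpow_const (p := υ + 1) (Or.inl hz.1.ne')
  refine (h2.mul h3).congr_deriv ?_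
  simp only [id, add_sub_cancel_right, jw]
  rw [Real.rpow_add_one h1.ne', Real.rpow_add_one hz.1.ne']
  ring

theorem contDiffOn_jw (μ υ : ℝ) {a b : ℝ} (ha : 0 < a) (hb : b < 1) :
    ContDiffOn ℝ 1 (jw μ υ) (Icc a b) := by
  unfold jw
  refine ContDiffOn.mul ?_ ?_
  · exact (contDiffOn_const.sub contDiffOn_id).rpow_const_of_ne
      fun x hx => by simp only [id]; linarith [hx.2]
  · exact contDiffOn_id.rpow_const_of_ne fun x hx => by simp only [id]; linarith [hx.1]

/-- The weight is the modulus of the integrand of the complex Beta integral, which converges for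
these parameters. -/
theorem intervalIntegrable_jw {μ υ : ℝ} (hμ : -1 < μ) (hυ : -1 < υ) :
    IntervalIntegrable (jw μ υ) volume 0 1 := by
  have h := (Complex.betaIntegral_convergent (u := (υ + 1 : ℝ)) (v := (μ + 1 : ℝ))
    (by simp; linarith) (by simp; linarith)).norm
  rw [intervalIntegrable_iff_integrableOn_Ioo_of_le zero_le_one] at h ⊢
  refine h.congr_fun (fun x hx => ?_) measurableSet_Ioo
  have h1 : 0 < 1 - x := by linarith [hx.2]
  have e : (1 - (x : ℂ)) = ((1 - x : ℝ) : ℂ) := by push_cast; ring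
  simp only [norm_mul]
  rw [e, Complex.norm_cpow_eq_rpow_re_of_pos hx.1, Complex.norm_cpow_eq_rpow_re_of_pos h1]
  simp [jw, mul_comm]

theorem integrableOn_jw {μ υ : ℝ} (hμ : -1 < μ) (hυ : -1 < υ) :
    IntegrableOn (jw μ υ) (Ioo 0 1) :=
  (intervalIntegrable_iff_integrableOn_Ioo_of_le zero_le_one).1 (intervalIntegrable_jw hμ hυ)

theorem isFiniteMeasure_jm {μ υ : ℝ} (hμ : -1 < μ) (hυ : -1 < υ) : IsFiniteMeasure (jm μ υ) :=
  isFiniteMeasure_withDensity_ofReal (integrableOn_jw hμ hυ).2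

/-- The weight is positive on the interval, so all the Jacobi measures have the same null sets.
Almost-everywhere statements therefore pass freely between parameters. -/
theorem ae_jm {μ υ : ℝ} {p : ℝ → Prop} :
    (∀ᵐ z ∂jm μ υ, p z) ↔ ∀ᵐ z, z ∈ Ioo (0 : ℝ) 1 → p z := by
  rw [jm, wMeasure, ae_withDensity_iff (measurable_jw μ υ).ennreal_ofReal,
    ae_restrict_iff' measurableSet_Ioo]
  refine eventually_congr (Eventually.of_forall fun z => ?_)
  refine forall_congr' fun hz => ?_
  simp [jw_pos hz]

theorem ae_jm_of_forall {μ υ : ℝ} {p : ℝ → Prop} (h : ∀ z ∈ Ioo (0 : ℝ) 1, p z) :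
    ∀ᵐ z ∂jm μ υ, p z := ae_jm.2 (Eventually.of_forall h)

theorem integral_jm (μ υ : ℝ) (f : ℝ → ℝ) :
    ∫ z, f z ∂jm μ υ = ∫ z in Ioo 0 1, jw μ υ z * f z := by
  rw [jm, wMeasure, integral_withDensity_eq_integral_toReal_smul
    (measurable_jw μ υ).ennreal_ofReal (by simp)]
  refine setIntegral_congr_fun measurableSet_Ioo fun z hz => ?_
  simp [ENNReal.toReal_ofReal (jw_nonneg hz)]

theorem integrable_jm {μ υ : ℝ} {f : ℝ → ℝ} :
    Integrable f (jm μ υ) ↔ IntegrableOn (fun z => jw μ υ z * f z) (Ioo 0 1) := by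
  rw [jm, wMeasure, integrable_withDensity_iff_integrable_smul'
    (measurable_jw μ υ).ennreal_ofReal (by simp)]
  refine integrable_congr ?_
  filter_upwards [ae_restrict_mem measurableSet_Ioo] with z hz
  simp [ENNReal.toReal_ofReal (jw_nonneg hz)]

theorem integrable_jm_succ {μ υ : ℝ} {f : ℝ → ℝ} (hf : Integrable f (jm μ υ)) :
    Integrable f (jm (μ + 1) (υ + 1)) := by
  rw [integrable_jm] at hf ⊢
  have h : IntegrableOn (fun z => (z * (1 - z)) * (jw μ υ z * f z)) (Ioo 0 1) := by
    refine Integrable.bdd_mul (c := 1) hf (by fun_prop) ?_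
    filter_upwards [ae_restrict_mem measurableSet_Ioo] with z hz
    rw [Real.norm_eq_abs, abs_of_nonneg (mul_nonneg hz.1.le (by linarith [hz.2]))]
    nlinarith [hz.1, hz.2]
  refine h.congr_fun (fun z hz => ?_) measurableSet_Ioo
  simp only [jw_succ hz]
  ring

theorem memLp_jm_succ {μ υ : ℝ} {f : ℝ → ℝ} (hf : MemLp f 2 (jm μ υ)) :
    MemLp f 2 (jm (μ + 1) (υ + 1)) := by
  have hm : AEStronglyMeasurable f (jm (μ + 1) (υ + 1)) := by
    refine hf.1.mono_ac fun s hs => ?_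
    have : ∀ᵐ z ∂jm μ υ, z ∉ s := compl_mem_ae_iff.2 hs
    have := ae_jm (μ := μ + 1) (υ := υ + 1).2 (ae_jm.1 this)
    exact compl_mem_ae_iff.1 this
  rw [memLp_two_iff_integrable_sq hm]
  exact integrable_jm_succ ((memLp_two_iff_integrable_sq hf.1).1 hf)

theorem memLp_polynomial {μ υ : ℝ} (hμ : -1 < μ) (hυ : -1 < υ) (p : Polynomial ℝ)
    (r : ENNReal) : MemLp (fun z => p.eval z) r (jm μ υ) := by
  have := isFiniteMeasure_jm hμ hυ
  obtain ⟨C, hC⟩ := isCompact_Icc.exists_bound_of_continuousOn (s := Icc (0 : ℝ) 1)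
    p.continuous.continuousOn
  exact MemLp.of_bound p.continuous.aestronglyMeasurable C
    (ae_jm_of_forall fun z hz => hC z ⟨hz.1.le, hz.2.le⟩)

theorem integrable_mul_polynomial {μ υ : ℝ} {f : ℝ → ℝ} (hf : Integrable f (jm μ υ))
    (p : Polynomial ℝ) : Integrable (fun z => f z * p.eval z) (jm μ υ) := by
  obtain ⟨C, hC⟩ := isCompact_Icc.exists_bound_of_continuousOn (s := Icc (0 : ℝ) 1)
    p.continuous.continuousOn
  exact hf.mul_bdd p.continuous.aestronglyMeasurable
    (ae_jm_of_forall fun z hz => hC z ⟨hz.1.le, hz.2.le⟩)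

theorem integrable_polynomial {μ υ : ℝ} (hμ : -1 < μ) (hυ : -1 < υ) (p : Polynomial ℝ) :
    Integrable (fun z => p.eval z) (jm μ υ) :=
  memLp_one_iff_integrable.1 (memLp_polynomial hμ hυ p 1)

/-- The Cauchy–Schwarz inequality for real square-integrable functions. -/
theorem integral_mul_le_sqrt {α : Type*} [MeasurableSpace α] {m : Measure α} {f g : α → ℝ}
    (hf : MemLp f 2 m) (hg : MemLp g 2 m) :
    ∫ z, |f z| * |g z| ∂m ≤ Real.sqrt (∫ z, f z ^ 2 ∂m) * Real.sqrt (∫ z, g z ^ 2 ∂m) := by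
  have h := integral_mul_norm_le_Lp_mul_Lq (p := 2) (q := 2) (f := f) (g := g) (μ := m)
    (by norm_num [Real.holderConjugate_iff]) (by simpa using hf) (by simpa using hg)
  simpa [Real.sqrt_eq_rpow] using h

theorem sq_integral_mul_le {α : Type*} [MeasurableSpace α] {m : Measure α} {f g : α → ℝ}
    (hf : MemLp f 2 m) (hg : MemLp g 2 m) :
    (∫ z, f z * g z ∂m) ^ 2 ≤ (∫ z, f z ^ 2 ∂m) * ∫ z, g z ^ 2 ∂m := by
  have h1 : |∫ z, f z * g z ∂m| ≤ Real.sqrt (∫ z, f z ^ 2 ∂m) * Real.sqrt (∫ z, g z ^ 2 ∂m) := by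
    refine le_trans ?_ (integral_mul_le_sqrt hf hg)
    simpa [abs_mul] using abs_integral_le_integral_abs (f := fun z => f z * g z) (μ := m)
  have h2 := pow_le_pow_left₀ (abs_nonneg _) h1 2
  rwa [sq_abs, mul_pow, Real.sq_sqrt (integral_nonneg fun z => sq_nonneg _),
    Real.sq_sqrt (integral_nonneg fun z => sq_nonneg _)] at h2

end BackwardJacobi

/-! ### Local absolute continuity and integration by parts without boundary terms. -/

namespace BackwardJacobi
open Set Filter Topology

/-- Local absolute continuity in the open unit interval. -/
def LocAC (v : ℝ → ℝ) : Prop :=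
  ∀ a b : ℝ, 0 < a → a < b → b < 1 → AbsolutelyContinuousOnInterval v a b

theorem LocAC.ac {v : ℝ → ℝ} (hv : LocAC v) {x y : ℝ} (hx : x ∈ Ioo (0 : ℝ) 1)
    (hy : y ∈ Ioo (0 : ℝ) 1) : AbsolutelyContinuousOnInterval v x y := by
  have h1 : 0 < min x y := lt_min hx.1 hy.1
  have h2 : max x y < 1 := max_lt hx.2 hy.2
  have h3 : min x y ≤ max x y := min_le_max
  refine (hv (min x y / 2) ((max x y + 1) / 2) (by linarith) (by linarith) (by linarith)).mono ?_
  rw [uIcc_of_le (a := min x y / 2) (by linarith)]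
  exact Icc_subset_Icc (by linarith) (by linarith)

theorem LocAC.ae_differentiableAt {v : ℝ → ℝ} (hv : LocAC v) :
    ∀ᵐ z, z ∈ Ioo (0 : ℝ) 1 → DifferentiableAt ℝ v z := by
  have h : ∀ n : ℕ, ∀ᵐ z, z ∈ uIcc ((1 : ℝ) / (n + 2)) (1 - 1 / (n + 2)) →
      DifferentiableAt ℝ v z := by
    intro n
    have h1 : (0 : ℝ) < 1 / (n + 2) := by positivity
    have h2 : (1 : ℝ) / (n + 2) < 1 := by rw [div_lt_one (by positivity)]; linarith [n.cast_nonneg (α := ℝ)]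
    exact (hv.ac ⟨h1, h2⟩ ⟨by linarith, by linarith⟩).ae_differentiableAt
  filter_upwards [ae_all_iff.2 h] with z hz hz1
  obtain ⟨n, hn⟩ := exists_nat_one_div_lt (lt_min hz1.1 (sub_pos.2 hz1.2))
  have h3 : (1 : ℝ) / (n + 2) < 1 / (n + 1) := by
    apply one_div_lt_one_div_of_lt <;> [positivity; linarith]
  have h4 := lt_min_iff.1 (h3.trans hn)
  refine hz n ?_
  rw [uIcc_of_le (by linarith)]
  exact ⟨by linarith, by linarith⟩

theorem LocAC.mul {u v : ℝ → ℝ} (hu : LocAC u) (hv : LocAC v) : LocAC (fun z => u z * v z) :=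
  fun a b ha hab hb => (hu a b ha hab hb).fun_mul (hv a b ha hab hb)

theorem LocAC.sub {u v : ℝ → ℝ} (hu : LocAC u) (hv : LocAC v) : LocAC (fun z => u z - v z) :=
  fun a b ha hab hb => (hu a b ha hab hb).fun_sub (hv a b ha hab hb)

theorem locAC_polynomial (p : Polynomial ℝ) : LocAC fun z => p.eval z := fun a b _ _ _ =>
  ContDiffOn.absolutelyContinuousOnInterval (by
    have : ContDiff ℝ 1 fun z => p.eval z := by simpa using p.contDiff_aeval (𝕜 := ℝ) 1
    exact this.contDiffOn)

theorem locAC_jw (μ υ : ℝ) : LocAC (jw μ υ) := fun a b ha hab hb =>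
  ContDiffOn.absolutelyContinuousOnInterval (by
    rw [uIcc_of_le hab.le]
    exact contDiffOn_jw μ υ ha hb)

theorem LocAC.continuousOn {v : ℝ → ℝ} (hv : LocAC v) : ContinuousOn v (Ioo 0 1) := by
  intro z hz
  have h := (hv (z / 2) ((z + 1) / 2) (by linarith [hz.1]) (by linarith [hz.2])
    (by linarith [hz.2])).continuousOn
  rw [uIcc_of_le (by linarith [hz.2])] at h
  exact (h.continuousAt (Icc_mem_nhds (by linarith [hz.1]) (by linarith [hz.2]))).continuousWithinAt

/-- Integrability of the derivative up to the endpoints gives a continuous extension `H` to the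
closed interval; boundary values are read off from `H`, since `h` itself is arbitrary at `0` and
`1`. -/
theorem LocAC.exists_primitive {h : ℝ → ℝ} (hh : LocAC h)
    (hi : IntegrableOn (deriv h) (Ioo 0 1)) :
    ∃ H : ℝ → ℝ, ContinuousOn H (Icc 0 1) ∧ EqOn H h (Ioo 0 1) ∧
      ∫ z in Ioo 0 1, deriv h z = H 1 - H 0 := by
  have hii : IntervalIntegrable (deriv h) volume 0 1 :=
    (intervalIntegrable_iff_integrableOn_Ioo_of_le zero_le_one).2 hi
  have hmid : (1 / 2 : ℝ) ∈ uIcc (0 : ℝ) 1 := by rw [uIcc_of_le zero_le_one]; constructor <;> norm_num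
  have hc := intervalIntegral.continuousOn_primitive_interval' hii hmid
  rw [uIcc_of_le zero_le_one] at hc
  refine ⟨fun x => h (1 / 2) + ∫ t in (1 / 2)..x, deriv h t, continuousOn_const.add hc, ?_, ?_⟩
  · intro x hx
    simp only
    rw [(hh.ac (x := 1 / 2) (by constructor <;> norm_num) hx).integral_deriv_eq_sub]
    ring
  · have hsub : ∀ x ∈ uIcc (0 : ℝ) 1, IntervalIntegrable (deriv h) volume (1 / 2) x :=
      fun x hx => hii.mono_set (uIcc_subset_uIcc hmid hx)
    rw [← integral_Ioc_eq_integral_Ioo, ← intervalIntegral.integral_of_le zero_le_one,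
      ← intervalIntegral.integral_interval_sub_left (hsub 1 right_mem_uIcc) (hsub 0 left_mem_uIcc)]
    ring

/-- A nonzero limit at `0` would make `1 / z` integrable there. -/
theorem eq_zero_of_integrable_div {H : ℝ → ℝ} (hH : ContinuousOn H (Icc 0 1))
    (hi : IntegrableOn (fun z => H z / z) (Ioo 0 1)) : H 0 = 0 := by
  by_contra hne
  have hpos : 0 < |H 0| / 2 := half_pos (abs_pos.2 hne)
  have h1 : ∀ᶠ z in 𝓝[Icc 0 1] (0 : ℝ), |H 0| / 2 < |H z| :=
    (hH.abs 0 (by simp)).eventually_const_lt (by simpa using hpos)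
  obtain ⟨r, hr, hr1⟩ := Metric.mem_nhdsWithin_iff.1 h1
  set d := min (r / 2) (1 / 2) with hd
  have hd0 : 0 < d := lt_min (by linarith) (by norm_num)
  have hdr : d ≤ r / 2 := min_le_left _ _
  have hd1 : d ≤ 1 / 2 := min_le_right _ _
  have h2 : IntegrableOn (fun z : ℝ => z⁻¹) (Ioo 0 d) := by
    refine Integrable.mono' ((hi.mono_set (Ioo_subset_Ioo_right (by linarith))).norm.const_mul
      (|H 0| / 2)⁻¹) (by fun_prop) ?_
    filter_upwards [ae_restrict_mem measurableSet_Ioo] with z hz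
    have h3 : |H 0| / 2 < |H z| := hr1 ⟨by
      rw [Metric.mem_ball, dist_zero_right, Real.norm_eq_abs, abs_of_pos hz.1]; linarith [hz.2],
      ⟨hz.1.le, by linarith [hz.2]⟩⟩
    have h4 := hz.1
    rw [Real.norm_eq_abs, Real.norm_eq_abs, abs_inv, abs_div, abs_of_pos h4, ← div_eq_inv_mul,
      le_div_iff₀ hpos, inv_mul_eq_div]
    exact div_le_div_of_nonneg_right h3.le h4.le
  have h5 := (intervalIntegrable_iff_integrableOn_Ioo_of_le hd0.le).2 h2
  rw [intervalIntegrable_inv_iff] at h5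
  rcases h5 with h5 | h5
  · exact hd0.ne h5
  · exact h5 left_mem_uIcc

theorem LocAC.integral_deriv_eq_zero {h : ℝ → ℝ} (hh : LocAC h)
    (hi : IntegrableOn (deriv h) (Ioo 0 1))
    (hd : IntegrableOn (fun z => h z / (z * (1 - z))) (Ioo 0 1)) :
    ∃ H : ℝ → ℝ, ContinuousOn H (Icc 0 1) ∧ EqOn H h (Ioo 0 1) ∧ H 0 = 0 ∧ H 1 = 0 ∧
      ∫ z in Ioo 0 1, deriv h z = 0 := by
  obtain ⟨H, hH, he, hint⟩ := hh.exists_primitive hi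
  have hd1 : IntegrableOn (fun z => H z / z) (Ioo 0 1) := by
    have h1 : IntegrableOn (fun z => (1 - z) * (h z / (z * (1 - z)))) (Ioo 0 1) := by
      refine Integrable.bdd_mul (c := 1) hd (by fun_prop) ?_
      filter_upwards [ae_restrict_mem measurableSet_Ioo] with z hz
      rw [Real.norm_eq_abs, abs_of_nonneg (by linarith [hz.2])]
      linarith [hz.1]
    refine h1.congr_fun (fun z hz => ?_) measurableSet_Ioo
    have := hz.1.ne'
    have := (sub_pos.2 hz.2).ne'
    simp only [he hz]
    field_simp
  have hd2 : IntegrableOn (fun z => H (1 - z) / z) (Ioo 0 1) := by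
    have h1 : IntegrableOn (fun z => z * (h z / (z * (1 - z)))) (Ioo 0 1) := by
      refine Integrable.bdd_mul (c := 1) hd (by fun_prop) ?_
      filter_upwards [ae_restrict_mem measurableSet_Ioo] with z hz
      rw [Real.norm_eq_abs, abs_of_nonneg hz.1.le]
      exact hz.2.le
    have h2 := ((intervalIntegrable_iff_integrableOn_Ioo_of_le zero_le_one).2 h1).comp_sub_left 1
    rw [sub_self, sub_zero] at h2
    have h3 := (intervalIntegrable_iff_integrableOn_Ioo_of_le zero_le_one).1 h2.symm
    refine h3.congr_fun (fun z hz => ?_) measurableSet_Ioo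
    have := hz.1.ne'
    have := (sub_pos.2 hz.2).ne'
    simp only [he (show 1 - z ∈ Ioo (0 : ℝ) 1 from ⟨by linarith [hz.2], by linarith [hz.1]⟩)]
    simp only [sub_sub_cancel]
    field_simp
  have h0 := eq_zero_of_integrable_div hH hd1
  have hH' : ContinuousOn (fun z => H (1 - z)) (Icc 0 1) :=
    hH.comp (by fun_prop) fun z hz => ⟨by linarith [hz.2], by linarith [hz.1]⟩
  have h1 := eq_zero_of_integrable_div hH' hd2
  rw [sub_zero] at h1
  exact ⟨H, hH, he, h0, h1, by rw [hint, h0, h1, sub_zero]⟩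

/-- The boundary term `z(1-z) w(z) g(z)` of an integration by parts against the Jacobi weight
vanishes at both ends. -/
theorem LocAC.jw_succ_mul {μ υ : ℝ} {g : ℝ → ℝ} (hg : LocAC g)
    (h0 : Integrable g (jm μ υ)) (h1 : Integrable (deriv g) (jm (μ + 1) (υ + 1))) :
    (∃ H : ℝ → ℝ, ContinuousOn H (Icc 0 1) ∧
      EqOn H (fun z => jw (μ + 1) (υ + 1) z * g z) (Ioo 0 1) ∧ H 0 = 0 ∧ H 1 = 0) ∧
    ∫ z, deriv g z ∂jm (μ + 1) (υ + 1) = -∫ z, g z * ((υ + 1) - (μ + υ + 2) * z) ∂jm μ υ := by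
  have hac : LocAC fun z => jw (μ + 1) (υ + 1) z * g z := (locAC_jw _ _).mul hg
  have hder : deriv (fun z => jw (μ + 1) (υ + 1) z * g z) =ᵐ[volume.restrict (Ioo 0 1)] fun z =>
      jw μ υ z * (g z * ((υ + 1) - (μ + υ + 2) * z)) + jw (μ + 1) (υ + 1) z * deriv g z := by
    rw [EventuallyEq, ae_restrict_iff' measurableSet_Ioo]
    filter_upwards [hg.ae_differentiableAt] with z hz hz1
    rw [((hasDerivAt_jw_succ hz1).fun_mul (hz hz1).hasDerivAt).deriv]
    ring
  have i0 : IntegrableOn (fun z => jw μ υ z * (g z * ((υ + 1) - (μ + υ + 2) * z))) (Ioo 0 1) := by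
    have h := integrable_mul_polynomial h0
      (Polynomial.C (υ + 1) - Polynomial.C (μ + υ + 2) * Polynomial.X)
    simp only [Polynomial.eval_sub, Polynomial.eval_C, Polynomial.eval_mul, Polynomial.eval_X] at h
    exact integrable_jm.1 h
  have i1 : IntegrableOn (fun z => jw (μ + 1) (υ + 1) z * deriv g z) (Ioo 0 1) := integrable_jm.1 h1
  have hi : IntegrableOn (deriv fun z => jw (μ + 1) (υ + 1) z * g z) (Ioo 0 1) :=
    (i0.add i1).congr hder.symm
  -- Dividing the raised weight by `z (1 - z)` gives back `jw μ υ`, so integrability of `g` is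
  -- exactly what forces the boundary values to vanish.
  have hd : IntegrableOn (fun z => jw (μ + 1) (υ + 1) z * g z / (z * (1 - z))) (Ioo 0 1) := by
    refine (integrable_jm.1 h0).congr_fun (fun z hz => ?_) measurableSet_Ioo
    have := hz.1.ne'
    have := (sub_pos.2 hz.2).ne'
    simp only [jw_succ hz]
    field_simp
  obtain ⟨H, hH, he, hz0, hz1, hint⟩ := hac.integral_deriv_eq_zero hi hd
  refine ⟨⟨H, hH, he, hz0, hz1⟩, ?_⟩
  rw [integral_congr_ae hder, integral_add i0 i1] at hint
  rw [integral_jm, integral_jm]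
  linarith

/-- The first order operator adjoint to differentiation with respect to the Jacobi weights:
`q ↦ z (1 - z) q' + ((υ + 1) - (μ + υ + 2) z) q`. -/
noncomputable def adjDeriv (μ υ : ℝ) (q : Polynomial ℝ) : Polynomial ℝ :=
  Polynomial.X * (1 - Polynomial.X) * Polynomial.derivative q +
    (Polynomial.C (υ + 1) - Polynomial.C (μ + υ + 2) * Polynomial.X) * q

/-- The identity without boundary terms, applied to the product `g q`: the terms carrying `q'` and
`q` assemble into `adjDeriv`. -/
theorem LocAC.integral_deriv_mul {μ υ : ℝ} {g : ℝ → ℝ} (hg : LocAC g)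
    (h0 : Integrable g (jm μ υ)) (h1 : Integrable (deriv g) (jm (μ + 1) (υ + 1)))
    (q : Polynomial ℝ) :
    ∫ z, deriv g z * q.eval z ∂jm (μ + 1) (υ + 1) =
      -∫ z, g z * (adjDeriv μ υ q).eval z ∂jm μ υ := by
  have hder : (deriv fun z => g z * q.eval z) =ᵐ[jm (μ + 1) (υ + 1)] fun z =>
      deriv g z * q.eval z + g z * (Polynomial.derivative q).eval z := by
    rw [EventuallyEq, ae_jm]
    filter_upwards [hg.ae_differentiableAt] with z hz hz1
    exact ((hz hz1).hasDerivAt.fun_mul (q.hasDerivAt z)).deriv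
  have i1 := integrable_mul_polynomial h1 q
  have i2 := integrable_mul_polynomial h0 (Polynomial.derivative q)
  have i3 := integrable_jm_succ i2
  have hq := integrable_mul_polynomial h0 q
  have key := ((hg.mul (locAC_polynomial q)).jw_succ_mul hq ((i1.add i3).congr hder.symm)).2
  rw [integral_congr_ae hder, integral_add i1 i3] at key
  have e1 : ∫ z, g z * (Polynomial.derivative q).eval z ∂jm (μ + 1) (υ + 1) =
      ∫ z, g z * (Polynomial.X * (1 - Polynomial.X) * Polynomial.derivative q).eval z ∂jm μ υ := by
    rw [integral_jm, integral_jm]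
    refine setIntegral_congr_fun measurableSet_Ioo fun z hz => ?_
    simp [jw_succ hz]
    ring
  have i4 := integrable_mul_polynomial h0
    (Polynomial.X * (1 - Polynomial.X) * Polynomial.derivative q)
  have i5 := integrable_mul_polynomial h0
    ((Polynomial.C (υ + 1) - Polynomial.C (μ + υ + 2) * Polynomial.X) * q)
  have e2 : ∫ z, g z * (adjDeriv μ υ q).eval z ∂jm μ υ =
      ∫ z, g z * (Polynomial.X * (1 - Polynomial.X) * Polynomial.derivative q).eval z ∂jm μ υ +
      ∫ z, g z * ((Polynomial.C (υ + 1) - Polynomial.C (μ + υ + 2) * Polynomial.X) * q).eval z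
        ∂jm μ υ := by
    rw [← integral_add i4 i5]
    simp [adjDeriv, mul_add]
  have e3 : ∫ z, g z * q.eval z * ((υ + 1) - (μ + υ + 2) * z) ∂jm μ υ =
      ∫ z, g z * ((Polynomial.C (υ + 1) - Polynomial.C (μ + υ + 2) * Polynomial.X) * q).eval z
        ∂jm μ υ := by
    refine integral_congr_ae (Eventually.of_forall fun z => ?_)
    simp
    ring
  rw [e1, e3] at key
  rw [e2]
  linarith

end BackwardJacobi

/-! ### Shifted Jacobi polynomials and their differential equation. -/

namespace BackwardJacobi
open Set Filter Topology Polynomial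

/-- The Jacobi polynomial transplanted to the unit interval. -/
noncomputable def sjac (μ υ : ℝ) (n : ℕ) : ℝ[X] := (jacobi n μ υ).comp (2 * X - 1)

/-- The eigenvalues of the Jacobi operator. -/
def jev (μ υ : ℝ) (n : ℕ) : ℝ := n * (n + μ + υ + 1)

/-- The coefficient of `(z - 1) ^ k` in `sjac μ υ n`. -/
noncomputable def jcoef (μ υ : ℝ) (n k : ℕ) : ℝ :=
  (ascPochhammer ℝ k).eval (n + μ + υ + 1) * (ascPochhammer ℝ (n - k)).eval (μ + k + 1) /
        (k.factorial * (n - k).factorial : ℝ)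

theorem sjac_eq_sum (μ υ : ℝ) (n : ℕ) :
    sjac μ υ n = ∑ k ∈ Finset.range (n + 1), C (jcoef μ υ n k) * (X - 1) ^ k := by
  rw [sjac, jacobi, Polynomial.sum_comp]
  refine Finset.sum_congr rfl fun k _ => ?_
  have h : (C (1 / 2) * (2 * X - 1 - 1) : ℝ[X]) = X - 1 := by
    have h2 : (2 : ℝ[X]) = C 2 := rfl
    have h3 : (C (1 / 2) * C 2 : ℝ[X]) = 1 := by rw [← C_mul]; norm_num
    have : (C (1 / 2) * (2 * X - 1 - 1) : ℝ[X]) = (C (1 / 2) * C 2) * (X - 1) := by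
      rw [h2.symm]; ring
    rw [this, h3, one_mul]
  simp only [mul_comp, C_comp, pow_comp, sub_comp, X_comp, one_comp, h]
  rfl

/-- This two-term recurrence is the Jacobi equation read on the coefficients of the powers of `z -
1`. -/
theorem jcoef_succ {μ υ : ℝ} (hμ : -1 < μ) {n k : ℕ} (hk : k < n) :
    jcoef μ υ n (k + 1) * ((k + 1) * (k + 1 + μ)) =
      jcoef μ υ n k * ((n - k) * (n + k + μ + υ + 1)) := by
  obtain ⟨m, rfl⟩ := Nat.exists_eq_add_of_lt hk
  have e1 : k + m + 1 - (k + 1) = m := by omega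
  have e2 : k + m + 1 - k = m + 1 := by omega
  have hμk : (μ + k + 1 : ℝ) ≠ 0 := by
    have := k.cast_nonneg (α := ℝ)
    linarith
  rw [jcoef, jcoef, e1, e2, ascPochhammer_succ_eval, ascPochhammer_succ_left (S := ℝ) (n := m)]
  simp only [eval_mul, eval_X, eval_comp, eval_add, eval_one, Nat.factorial_succ]
  push_cast
  have h1 : ((k.factorial : ℕ) : ℝ) ≠ 0 := by positivity
  have h2 : ((m.factorial : ℕ) : ℝ) ≠ 0 := by positivity
  have h3 : (k : ℝ) + 1 ≠ 0 := by positivity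
  have h4 : (m : ℝ) + 1 ≠ 0 := by positivity
  have e3 : μ + ((k : ℝ) + 1) + 1 = μ + k + 1 + 1 := by ring
  rw [e3]
  field_simp
  ring

theorem jcoef_self_pos {μ υ : ℝ} (hμ : -1 < μ) (hυ : -1 < υ) (n : ℕ) : 0 < jcoef μ υ n n := by
  rw [jcoef, Nat.sub_self]
  rcases Nat.eq_zero_or_pos n with rfl | hn
  · simp
  · have : (1 : ℝ) ≤ n := by exact_mod_cast hn
    have := ascPochhammer_pos n ((n : ℝ) + μ + υ + 1) (by linarith)
    simp only [ascPochhammer_zero, eval_one]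
    positivity

theorem adjDeriv_C_mul (μ υ c : ℝ) (q : ℝ[X]) :
    adjDeriv μ υ (C c * q) = C c * adjDeriv μ υ q := by
  simp only [adjDeriv, derivative_C_mul]
  ring

theorem adjDeriv_sum {ι : Type*} (μ υ : ℝ) (s : Finset ι) (p : ι → ℝ[X]) :
    adjDeriv μ υ (∑ i ∈ s, p i) = ∑ i ∈ s, adjDeriv μ υ (p i) := by
  simp only [adjDeriv, derivative_sum, Finset.mul_sum, Finset.sum_add_distrib]

theorem adjDeriv_derivative_pow (μ υ : ℝ) (k : ℕ) :
    adjDeriv μ υ (derivative ((X - 1) ^ k)) =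
      -(C (k * (k + μ + υ + 1)) * (X - 1) ^ k) - C (k * (k + μ)) * (X - 1) ^ (k - 1) := by
  have h2 : (C 2 : ℝ[X]) = 2 := rfl
  rcases k with _ | _ | k
  · simp [adjDeriv]
  · simp [adjDeriv, h2]
    ring
  · simp [adjDeriv, derivative_pow, h2]
    ring

theorem sjac_ode {μ υ : ℝ} (hμ : -1 < μ) (n : ℕ) :
    adjDeriv μ υ (derivative (sjac μ υ n)) = -(C (jev μ υ n) * sjac μ υ n) := by
  rw [← add_eq_zero_iff_eq_neg, sjac_eq_sum, derivative_sum, adjDeriv_sum, Finset.mul_sum,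
    ← Finset.sum_add_distrib]
  have h : ∀ k ∈ Finset.range (n + 1),
      adjDeriv μ υ (derivative (C (jcoef μ υ n k) * (X - 1) ^ k)) +
        C (jev μ υ n) * (C (jcoef μ υ n k) * (X - 1) ^ k) =
      C (jcoef μ υ n k * ((n - k) * (n + k + μ + υ + 1))) * (X - 1) ^ k -
        C (jcoef μ υ n k * (k * (k + μ))) * (X - 1) ^ (k - 1) := by
    intro k _
    have e : ((n : ℝ) - k) * (n + k + μ + υ + 1) = jev μ υ n - k * (k + μ + υ + 1) := by
      rw [jev]; ring
    rw [e, derivative_C_mul, adjDeriv_C_mul, adjDeriv_derivative_pow]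
    simp only [C_mul, C_sub]
    ring
  -- The sum telescopes: the first family loses its top term (factor `n - k`), the second its bottom
  -- term (factor `k`), and after a shift the recurrence matches the rest.
  rw [Finset.sum_congr rfl h, Finset.sum_sub_distrib, Finset.sum_range_succ, Finset.sum_range_succ']
  simp only [sub_self, zero_mul, mul_zero, C_0, add_zero, Nat.cast_zero]
  rw [sub_eq_zero]
  refine Finset.sum_congr rfl fun k hk => ?_
  rw [← jcoef_succ hμ (Finset.mem_range.1 hk)]
  simp

theorem degree_sum_lt (n : ℕ) (c : ℕ → ℝ) :
    (∑ k ∈ Finset.range n, C (c k) * (X - 1) ^ k : ℝ[X]).degree < n := by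
  refine mem_degreeLT.1 (Submodule.sum_mem _ fun k hk => mem_degreeLT.2 ?_)
  have h1 : ((X - 1 : ℝ[X]) ^ k).degree = k := by
    rw [degree_pow, ← C_1, degree_X_sub_C]; simp
  refine (degree_mul_le _ _).trans_lt ((add_le_add_left degree_C_le _).trans_lt ?_)
  rw [h1, zero_add]
  exact_mod_cast Finset.mem_range.1 hk

theorem degree_sjac {μ υ : ℝ} (hμ : -1 < μ) (hυ : -1 < υ) (n : ℕ) :
    (sjac μ υ n).degree = n := by
  rw [sjac_eq_sum, Finset.sum_range_succ]
  have h1 : (C (jcoef μ υ n n) * (X - 1) ^ n : ℝ[X]).degree = n := by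
    rw [degree_C_mul (jcoef_self_pos hμ hυ n).ne', degree_pow, ← C_1, degree_X_sub_C]
    simp
  rw [degree_add_eq_right_of_degree_lt, h1]
  rw [h1]
  exact degree_sum_lt _ _

theorem sjac_ne_zero {μ υ : ℝ} (hμ : -1 < μ) (hυ : -1 < υ) (n : ℕ) : sjac μ υ n ≠ 0 := by
  intro h
  have := degree_sjac hμ hυ n
  rw [h, degree_zero] at this
  exact absurd this (by simp)

theorem jev_strictMono {μ υ : ℝ} (hμ : -1 < μ) (hυ : -1 < υ) : StrictMono (jev μ υ) := by
  refine strictMono_nat_of_lt_succ fun n => ?_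
  have := n.cast_nonneg (α := ℝ)
  simp only [jev]
  push_cast
  nlinarith

theorem jev_nonneg {μ υ : ℝ} (hμ : -1 < μ) (hυ : -1 < υ) (n : ℕ) : 0 ≤ jev μ υ n := by
  have := (jev_strictMono hμ hυ).monotone (Nat.zero_le n)
  simpa [jev] using this

theorem degree_adjDeriv_lt (μ υ : ℝ) {q : ℝ[X]} {m : ℕ} (hq : q.degree < m) :
    (adjDeriv μ υ q).degree < (m + 1 : ℕ) := by
  rcases eq_or_ne q 0 with rfl | h0
  · simp [adjDeriv]
  have hn : q.natDegree < m := (natDegree_lt_iff_degree_lt h0).2 hq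
  have h1 : (adjDeriv μ υ q).natDegree ≤ q.natDegree + 1 := by
    rw [adjDeriv]
    refine natDegree_add_le_of_degree_le ?_ ?_
    · rcases Nat.eq_zero_or_pos q.natDegree with h | h
      · rw [natDegree_eq_zero.1 h |>.choose_spec.symm]
        simp
      · refine natDegree_mul_le.trans ?_
        have a1 : (X * (1 - X) : ℝ[X]).natDegree ≤ 2 := by compute_degree
        have a2 := natDegree_derivative_lt h.ne'
        omega
    · refine natDegree_mul_le.trans ?_
      have a1 : (C (υ + 1) - C (μ + υ + 2) * X : ℝ[X]).natDegree ≤ 1 := by compute_degree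
      omega
  exact (degree_le_natDegree).trans_lt (by exact_mod_cast (by omega))

end BackwardJacobi

/-! ### Orthogonal expansions, the inverse inequality and the Poincaré inequality. -/

namespace BackwardJacobi
open Set Filter Topology Polynomial

theorem eLpNorm_two_eq {α : Type*} [MeasurableSpace α] {m : Measure α} {f : α → ℝ}
    (hf : MemLp f 2 m) : eLpNorm f 2 m = ENNReal.ofReal (Real.sqrt (∫ z, f z ^ 2 ∂m)) := by
  rw [hf.eLpNorm_eq_integral_rpow_norm two_ne_zero ENNReal.ofNat_ne_top, Real.sqrt_eq_rpow]
  simp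

theorem exists_polynomial_integral_sq_sub_le {μ υ : ℝ} (hμ : -1 < μ) (hυ : -1 < υ) {g : ℝ → ℝ}
    (hg : MemLp g 2 (jm μ υ)) {ε : ℝ} (hε : 0 < ε) :
    ∃ p : ℝ[X], ∫ z, (g z - p.eval z) ^ 2 ∂jm μ υ ≤ ε := by
  have := isFiniteMeasure_jm hμ hυ
  -- The target `ε` is split into two errors of `ε / 4`, doubled by `(a + b) ^ 2 ≤ 2 a ^ 2 + 2 b ^
  -- 2`. The added `1` keeps the divisor `M` positive.
  set M : ℝ := (jm μ υ).real univ + 1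
  have hM : 0 < M := by positivity
  set δ : ℝ := Real.sqrt (ε / 4)
  have hδ : 0 < δ := Real.sqrt_pos.2 (by positivity)
  set η : ℝ := Real.sqrt (ε / (4 * M))
  have hη : 0 < η := Real.sqrt_pos.2 (by positivity)
  obtain ⟨h, hh1, hh2⟩ := hg.exists_boundedContinuous_eLpNorm_sub_le (by simp)
    (ε := ENNReal.ofReal δ) (by simpa using hδ)
  obtain ⟨p, hp⟩ := exists_polynomial_near_of_continuousOn 0 1 h h.continuous.continuousOn η hη
  have hgh : MemLp (fun z => g z - h z) 2 (jm μ υ) := hg.sub hh2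
  have hhp : MemLp (fun z => h z - p.eval z) 2 (jm μ υ) := hh2.sub (memLp_polynomial hμ hυ p 2)
  have hgp : MemLp (fun z => g z - p.eval z) 2 (jm μ υ) := hg.sub (memLp_polynomial hμ hυ p 2)
  have b1 : ∫ z, (g z - h z) ^ 2 ∂jm μ υ ≤ ε / 4 := by
    have h1 : eLpNorm (fun z => g z - h z) 2 (jm μ υ) ≤ ENNReal.ofReal δ := hh1
    rw [eLpNorm_two_eq hgh, ENNReal.ofReal_le_ofReal_iff hδ.le,
      Real.sqrt_le_sqrt_iff (by positivity)] at h1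
    exact h1
  have b2 : ∫ z, (h z - p.eval z) ^ 2 ∂jm μ υ ≤ ε / 4 := by
    have h1 : ∫ z, (h z - p.eval z) ^ 2 ∂jm μ υ ≤ ∫ _, ε / (4 * M) ∂jm μ υ := by
      refine integral_mono_ae hhp.integrable_sq (integrable_const _)
        (ae_jm_of_forall fun z hz => ?_)
      have h2 := (hp z ⟨hz.1.le, hz.2.le⟩).le
      have h3 := pow_le_pow_left₀ (abs_nonneg _) h2 2
      rw [sq_abs, Real.sq_sqrt (by positivity)] at h3
      simp only
      linarith [show (h z - p.eval z) ^ 2 = (p.eval z - h z) ^ 2 by ring]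
    refine h1.trans ?_
    rw [integral_const, smul_eq_mul, mul_div_assoc', div_le_div_iff₀ (by positivity) (by norm_num)]
    have : (jm μ υ).real univ ≤ M := by simp [M]
    nlinarith
  refine ⟨p, ?_⟩
  have h3 : ∫ z, (g z - p.eval z) ^ 2 ∂jm μ υ ≤
      ∫ z, (2 * (g z - h z) ^ 2 + 2 * (h z - p.eval z) ^ 2) ∂jm μ υ := by
    refine integral_mono hgp.integrable_sq
      ((hgh.integrable_sq.const_mul 2).add (hhp.integrable_sq.const_mul 2)) fun z => ?_
    simp only
    nlinarith [sq_nonneg ((g z - h z) - (h z - p.eval z))]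
  rw [integral_add (hgh.integrable_sq.const_mul 2) (hhp.integrable_sq.const_mul 2),
    integral_const_mul, integral_const_mul] at h3
  linarith

theorem MemLp.integrable_jm {μ υ : ℝ} (hμ : -1 < μ) (hυ : -1 < υ) {g : ℝ → ℝ}
    (hg : MemLp g 2 (jm μ υ)) : Integrable g (jm μ υ) := by
  have := isFiniteMeasure_jm hμ hυ
  exact hg.integrable one_le_two

theorem integral_mul_sum {μ υ : ℝ} {g : ℝ → ℝ} (hg : Integrable g (jm μ υ))
    (s : Finset ℕ) (c : ℕ → ℝ) (q : ℕ → ℝ[X]) :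
    ∫ z, g z * (∑ n ∈ s, C (c n) * q n).eval z ∂jm μ υ =
      ∑ n ∈ s, c n * ∫ z, g z * (q n).eval z ∂jm μ υ := by
  simp only [eval_finsetSum, eval_mul, eval_C, Finset.mul_sum]
  rw [integral_finsetSum _ fun n _ => ?_]
  · refine Finset.sum_congr rfl fun n _ => ?_
    rw [← integral_const_mul]
    refine integral_congr_ae (Eventually.of_forall fun z => ?_)
    simp only
    ring
  · refine ((integrable_mul_polynomial hg (q n)).const_mul (c n)).congr
      (Eventually.of_forall fun z => ?_)
    simp only
    ring

theorem integral_derivative_mul {μ υ : ℝ} (hμ : -1 < μ) (hυ : -1 < υ) (p q : ℝ[X]) :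
    ∫ z, (derivative p).eval z * q.eval z ∂jm (μ + 1) (υ + 1) =
      -∫ z, p.eval z * (adjDeriv μ υ q).eval z ∂jm μ υ := by
  have hμ' : -1 < μ + 1 := by linarith
  have hυ' : -1 < υ + 1 := by linarith
  have hd : Integrable (deriv fun z => p.eval z) (jm (μ + 1) (υ + 1)) := by
    rw [show (deriv fun z => p.eval z) = fun z => (derivative p).eval z from funext fun z => p.deriv]
    exact integrable_polynomial hμ' hυ' (derivative p)
  have h := (locAC_polynomial p).integral_deriv_mul (integrable_polynomial hμ hυ p) hd q
  simpa using h

/-- The Jacobi operator is symmetric, since pairing two derivatives in the raised weight is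
symmetric, and its eigenvalues are distinct. -/
theorem integral_sjac_mul_sjac {μ υ : ℝ} (hμ : -1 < μ) (hυ : -1 < υ) {m n : ℕ} (h : m ≠ n) :
    ∫ z, (sjac μ υ m).eval z * (sjac μ υ n).eval z ∂jm μ υ = 0 := by
  have key : ∀ m n, ∫ z, (derivative (sjac μ υ m)).eval z * (derivative (sjac μ υ n)).eval z
      ∂jm (μ + 1) (υ + 1) =
      jev μ υ n * ∫ z, (sjac μ υ m).eval z * (sjac μ υ n).eval z ∂jm μ υ := by
    intro m n
    rw [integral_derivative_mul hμ hυ, sjac_ode hμ, ← integral_neg, ← integral_const_mul]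
    refine integral_congr_ae (Eventually.of_forall fun z => ?_)
    simp
    ring
  have h1 := key m n
  have h2 := key n m
  simp only [mul_comm (eval _ (derivative (sjac μ υ n)))] at h2
  simp only [mul_comm (eval _ (sjac μ υ n))] at h2
  have h3 : (jev μ υ m - jev μ υ n) *
      ∫ z, (sjac μ υ m).eval z * (sjac μ υ n).eval z ∂jm μ υ = 0 := by linarith
  rcases mul_eq_zero.1 h3 with h4 | h4
  · exact absurd ((jev_strictMono hμ hυ).injective (sub_eq_zero.1 h4)) h
  · exact h4

theorem integral_polynomial_pos {μ υ : ℝ} (hμ : -1 < μ) (hυ : -1 < υ) {p : ℝ[X]} (hp : p ≠ 0)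
    (hpos : ∀ z ∈ Ioo (0 : ℝ) 1, 0 ≤ p.eval z) : 0 < ∫ z, p.eval z ∂jm μ υ := by
  rw [integral_pos_iff_support_of_nonneg_ae (ae_jm_of_forall hpos) (integrable_polynomial hμ hυ p)]
  by_contra h
  have h0 : jm μ υ (Function.support fun z => p.eval z) = 0 := by simpa using h
  have h1 : ∀ᵐ z ∂jm μ υ, p.eval z = 0 := by
    rw [ae_iff]; exact h0
  rw [ae_jm] at h1
  have hfin : {z : ℝ | p.IsRoot z}.Finite := finite_setOfPred_isRoot hp
  have h2 : volume {z : ℝ | p.IsRoot z} = 0 := hfin.measure_zero _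
  have h3 : volume (Ioo (0 : ℝ) 1) = 0 := by
    rw [← compl_compl (Ioo (0 : ℝ) 1)]
    change ∀ᵐ z, z ∈ (Ioo (0 : ℝ) 1)ᶜ
    have h4 : ∀ᵐ z, ¬ p.IsRoot z := by rw [ae_iff]; simpa using h2
    filter_upwards [h1, h4] with z hz1 hz2 hz3
    exact hz2 (hz1 hz3)
  simp at h3

/-- The squared norm of `sjac μ υ n`. -/
noncomputable def jnorm (μ υ : ℝ) (n : ℕ) : ℝ :=
  ∫ z, (sjac μ υ n).eval z * (sjac μ υ n).eval z ∂jm μ υ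

theorem jnorm_pos {μ υ : ℝ} (hμ : -1 < μ) (hυ : -1 < υ) (n : ℕ) : 0 < jnorm μ υ n := by
  have := integral_polynomial_pos hμ hυ (p := sjac μ υ n * sjac μ υ n)
    (mul_ne_zero (sjac_ne_zero hμ hυ n) (sjac_ne_zero hμ hυ n))
    (fun z _ => by rw [eval_mul]; exact mul_self_nonneg _)
  simpa [jnorm] using this

theorem exists_eq_sum_sjac {μ υ : ℝ} (hμ : -1 < μ) (hυ : -1 < υ) (K : ℕ) :
    ∀ p : ℝ[X], p.degree < K → ∃ c : ℕ → ℝ, p = ∑ n ∈ Finset.range K, C (c n) * sjac μ υ n := by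
  induction K with
  | zero =>
    intro p hp
    refine ⟨0, ?_⟩
    simpa using degree_eq_bot.1 (Nat.WithBot.lt_zero_iff.1 hp)
  | succ K ih =>
    intro p hp
    have hd := degree_sjac hμ hυ K
    have hl : (sjac μ υ K).coeff K ≠ 0 := by
      have : (sjac μ υ K).natDegree = K := natDegree_eq_of_degree_eq_some hd
      have h2 := leadingCoeff_ne_zero.2 (sjac_ne_zero hμ hυ K)
      rwa [leadingCoeff, this] at h2
    set a := p.coeff K / (sjac μ υ K).coeff K
    have h1 : (p - C a * sjac μ υ K).degree < K := by
      have h2 : (p - C a * sjac μ υ K).degree < (K + 1 : ℕ) := by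
        refine (degree_sub_le _ _).trans_lt (max_lt hp ?_)
        refine (degree_mul_le _ _).trans_lt ((add_le_add_left degree_C_le _).trans_lt ?_)
        rw [hd, zero_add]
        exact_mod_cast K.lt_succ_self
      rw [degree_lt_iff_coeff_zero] at h2 ⊢
      intro m hm
      rcases hm.eq_or_lt with rfl | hm
      · simp [a, hl]
      · exact h2 m hm
    obtain ⟨c, hc⟩ := ih _ h1
    refine ⟨fun n => if n = K then a else c n, ?_⟩
    rw [Finset.sum_range_succ]
    simp only [↓reduceIte]
    have h3 : ∑ n ∈ Finset.range K, C (if n = K then a else c n) * sjac μ υ n =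
        ∑ n ∈ Finset.range K, C (c n) * sjac μ υ n :=
      Finset.sum_congr rfl fun n hn => by rw [if_neg (Finset.mem_range.1 hn).ne]
    rw [h3, ← hc]
    ring

theorem integral_sum_mul_sjac {μ υ : ℝ} (hμ : -1 < μ) (hυ : -1 < υ) {K n : ℕ} (hn : n < K)
    (c : ℕ → ℝ) :
    ∫ z, (∑ i ∈ Finset.range K, C (c i) * sjac μ υ i).eval z * (sjac μ υ n).eval z ∂jm μ υ =
      c n * jnorm μ υ n := by
  simp only [mul_comm _ ((sjac μ υ n).eval _)]
  rw [integral_mul_sum (integrable_polynomial hμ hυ _), Finset.sum_eq_single n]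
  · rfl
  · intro m _ hm
    rw [integral_sjac_mul_sjac hμ hυ hm.symm, mul_zero]
  · intro h
    exact absurd (Finset.mem_range.2 hn) h

theorem integral_sum_sq {μ υ : ℝ} (hμ : -1 < μ) (hυ : -1 < υ) (K : ℕ) (c : ℕ → ℝ) :
    ∫ z, (∑ i ∈ Finset.range K, C (c i) * sjac μ υ i).eval z ^ 2 ∂jm μ υ =
      ∑ n ∈ Finset.range K, c n ^ 2 * jnorm μ υ n := by
  simp only [sq]
  rw [integral_mul_sum (integrable_polynomial hμ hυ _)]
  refine Finset.sum_congr rfl fun n hn => ?_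
  rw [integral_sum_mul_sjac hμ hυ (Finset.mem_range.1 hn)]
  ring

theorem adjDeriv_derivative_sum {μ υ : ℝ} (hμ : -1 < μ) (K : ℕ) (c : ℕ → ℝ) :
    adjDeriv μ υ (derivative (∑ i ∈ Finset.range K, C (c i) * sjac μ υ i)) =
      ∑ i ∈ Finset.range K, C (-(c i * jev μ υ i)) * sjac μ υ i := by
  rw [derivative_sum, adjDeriv_sum]
  refine Finset.sum_congr rfl fun n _ => ?_
  rw [derivative_C_mul, adjDeriv_C_mul, sjac_ode hμ]
  simp only [C_neg, C_mul]
  ring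

/-- Derivatives of the Jacobi polynomials are again orthogonal, for the raised weight, with squared
norms multiplied by the eigenvalues. Both the inverse inequality (largest eigenvalue present) and
the Poincaré inequality (smallest) come from this formula. -/
theorem integral_derivative_sum_sq {μ υ : ℝ} (hμ : -1 < μ) (hυ : -1 < υ) (K : ℕ) (c : ℕ → ℝ) :
    ∫ z, (derivative (∑ i ∈ Finset.range K, C (c i) * sjac μ υ i)).eval z ^ 2
        ∂jm (μ + 1) (υ + 1) =
      ∑ n ∈ Finset.range K, jev μ υ n * (c n ^ 2 * jnorm μ υ n) := by
  simp only [sq]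
  rw [integral_derivative_mul hμ hυ, adjDeriv_derivative_sum hμ,
    integral_mul_sum (integrable_polynomial hμ hυ _), ← Finset.sum_neg_distrib]
  refine Finset.sum_congr rfl fun n hn => ?_
  rw [integral_sum_mul_sjac hμ hυ (Finset.mem_range.1 hn)]
  ring

/-- The inverse (Markov–Bernstein) inequality in Jacobi-weighted `L²` norms. -/
theorem integral_derivative_sq_le {μ υ : ℝ} (hμ : -1 < μ) (hυ : -1 < υ) {m : ℕ} {p : ℝ[X]}
    (hp : p.degree < (m + 1 : ℕ)) :
    ∫ z, (derivative p).eval z ^ 2 ∂jm (μ + 1) (υ + 1) ≤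
      jev μ υ m * ∫ z, p.eval z ^ 2 ∂jm μ υ := by
  obtain ⟨c, rfl⟩ := exists_eq_sum_sjac hμ hυ _ p hp
  rw [integral_derivative_sum_sq hμ hυ, integral_sum_sq hμ hυ, Finset.mul_sum]
  refine Finset.sum_le_sum fun n hn => ?_
  refine mul_le_mul_of_nonneg_right ((jev_strictMono hμ hυ).monotone ?_)
    (mul_nonneg (sq_nonneg _) (jnorm_pos hμ hυ n).le)
  exact Nat.lt_succ_iff.1 (Finset.mem_range.1 hn)

/-- Orthogonality to all polynomials of degree `< m`. -/
def OrthLT (μ υ : ℝ) (g : ℝ → ℝ) (m : ℕ) : Prop :=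
  ∀ q : ℝ[X], q.degree < m → ∫ z, g z * q.eval z ∂jm μ υ = 0

/-- The orthogonal projection onto the polynomials of degree `< K`. -/
noncomputable def jproj (μ υ : ℝ) (g : ℝ → ℝ) (K : ℕ) : ℝ[X] :=
  ∑ n ∈ Finset.range K,
    C ((∫ z, g z * (sjac μ υ n).eval z ∂jm μ υ) / jnorm μ υ n) * sjac μ υ n

theorem degree_jproj_lt {μ υ : ℝ} (hμ : -1 < μ) (hυ : -1 < υ) (g : ℝ → ℝ) (K : ℕ) :
    (jproj μ υ g K).degree < K := by
  refine mem_degreeLT.1 (Submodule.sum_mem _ fun n hn => mem_degreeLT.2 ?_)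
  refine (degree_mul_le _ _).trans_lt ((add_le_add_left degree_C_le _).trans_lt ?_)
  rw [degree_sjac hμ hυ, zero_add]
  exact_mod_cast Finset.mem_range.1 hn

theorem orthLT_sub_jproj {μ υ : ℝ} (hμ : -1 < μ) (hυ : -1 < υ) {g : ℝ → ℝ}
    (hg : Integrable g (jm μ υ)) (K : ℕ) :
    OrthLT μ υ (fun z => g z - (jproj μ υ g K).eval z) K := by
  intro q hq
  obtain ⟨c, rfl⟩ := exists_eq_sum_sjac hμ hυ _ q hq
  have hp := integrable_polynomial hμ hυ (jproj μ υ g K)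
  have hgp : Integrable (fun z => g z - (jproj μ υ g K).eval z) (jm μ υ) := hg.sub hp
  refine (integral_mul_sum hgp _ _ _).trans ?_
  refine Finset.sum_eq_zero fun n hn => ?_
  simp only [sub_mul]
  rw [integral_sub (integrable_mul_polynomial hg _) (integrable_mul_polynomial hp _), jproj,
    integral_sum_mul_sjac hμ hυ (Finset.mem_range.1 hn), div_mul_cancel₀ _ (jnorm_pos hμ hυ n).ne',
    sub_self, mul_zero]

theorem OrthLT.integral_add_sq {μ υ : ℝ} (hμ : -1 < μ) (hυ : -1 < υ) {g : ℝ → ℝ} {m : ℕ}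
    (ho : OrthLT μ υ g m) (hg : MemLp g 2 (jm μ υ)) {q : ℝ[X]} (hq : q.degree < m) :
    ∫ z, (g z + q.eval z) ^ 2 ∂jm μ υ =
      ∫ z, g z ^ 2 ∂jm μ υ + ∫ z, q.eval z ^ 2 ∂jm μ υ := by
  have hi := MemLp.integrable_jm hμ hυ hg
  have h1 : ∀ z, (g z + q.eval z) ^ 2 = g z ^ 2 + 2 * (g z * q.eval z) + q.eval z ^ 2 :=
    fun z => by ring
  have i2 := (integrable_mul_polynomial hi q).const_mul 2
  have i3 := (memLp_polynomial hμ hυ q 2).integrable_sq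
  have i4 : Integrable (fun z => g z ^ 2 + 2 * (g z * q.eval z)) (jm μ υ) := hg.integrable_sq.add i2
  simp only [h1]
  rw [integral_add i4 i3, integral_add hg.integrable_sq i2,
    integral_const_mul, ho q hq]
  ring

/-- Bessel's inequality for `g'`: the derivative of the projection of `g` is the projection of `g'`
onto the derivatives of the polynomials of degree `< K`. -/
theorem LocAC.integral_jproj_derivative_sq_le {μ υ : ℝ} (hμ : -1 < μ) (hυ : -1 < υ)
    {g : ℝ → ℝ} (hg : LocAC g) (h0 : MemLp g 2 (jm μ υ))
    (h1 : MemLp (deriv g) 2 (jm (μ + 1) (υ + 1))) (K : ℕ) :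
    ∫ z, (derivative (jproj μ υ g K)).eval z ^ 2 ∂jm (μ + 1) (υ + 1) ≤
      ∫ z, deriv g z ^ 2 ∂jm (μ + 1) (υ + 1) := by
  set p := jproj μ υ g K with hp
  set I := ∫ z, (derivative p).eval z ^ 2 ∂jm (μ + 1) (υ + 1) with hI
  set J := ∫ z, deriv g z ^ 2 ∂jm (μ + 1) (υ + 1) with hJ
  have i0 := MemLp.integrable_jm hμ hυ h0
  have i1 := MemLp.integrable_jm (by linarith) (by linarith) h1
  have hip := integrable_polynomial hμ hυ p
  -- Moving the derivative off `g` and off `p` leaves the pairing of `g - p` with a polynomial of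
  -- degree `< K`, which is zero. Cauchy–Schwarz then gives `I ^ 2 ≤ J I`.
  have e1 : I = ∫ z, deriv g z * (derivative p).eval z ∂jm (μ + 1) (υ + 1) := by
    rw [hg.integral_deriv_mul i0 i1, hI]
    simp only [sq]
    rw [integral_derivative_mul hμ hυ, neg_inj, eq_comm, ← sub_eq_zero,
      ← integral_sub (integrable_mul_polynomial i0 _) (integrable_mul_polynomial hip _)]
    simp only [← sub_mul]
    refine orthLT_sub_jproj hμ hυ i0 K _ ?_
    rw [hp, jproj, adjDeriv_derivative_sum hμ]
    refine mem_degreeLT.1 (Submodule.sum_mem _ fun n hn => mem_degreeLT.2 ?_)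
    refine (degree_mul_le _ _).trans_lt ((add_le_add_left degree_C_le _).trans_lt ?_)
    rw [degree_sjac hμ hυ, zero_add]
    exact_mod_cast Finset.mem_range.1 hn
  have e2 := sq_integral_mul_le h1
    (memLp_polynomial (by linarith : -1 < μ + 1) (by linarith : -1 < υ + 1) (derivative p) 2)
  rw [← e1, ← hI, ← hJ] at e2
  have hI0 : 0 ≤ I := integral_nonneg fun z => sq_nonneg _
  have hJ0 : 0 ≤ J := integral_nonneg fun z => sq_nonneg _
  rcases hI0.eq_or_lt with h | h
  · rw [← h]; exact hJ0
  · nlinarith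

/-- The weighted Poincaré inequality for functions orthogonal to polynomials of low degree. -/
theorem LocAC.poincare {μ υ : ℝ} (hμ : -1 < μ) (hυ : -1 < υ)
    {g : ℝ → ℝ} (hg : LocAC g) (h0 : MemLp g 2 (jm μ υ))
    (h1 : MemLp (deriv g) 2 (jm (μ + 1) (υ + 1))) {m : ℕ} (ho : OrthLT μ υ g m) :
    jev μ υ m * ∫ z, g z ^ 2 ∂jm μ υ ≤ ∫ z, deriv g z ^ 2 ∂jm (μ + 1) (υ + 1) := by
  have i0 := MemLp.integrable_jm hμ hυ h0
  have hjm := jev_nonneg hμ hυ m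
  -- No convergence of the full expansion is used: `g` is split at a finite projection `r`, whose
  -- coefficients below `m` vanish, and the remainder is at most the distance to `p`, later made
  -- small by density of polynomials.
  have key : ∀ p : ℝ[X], jev μ υ m * ∫ z, g z ^ 2 ∂jm μ υ ≤
      ∫ z, deriv g z ^ 2 ∂jm (μ + 1) (υ + 1) +
        jev μ υ m * ∫ z, (g z - p.eval z) ^ 2 ∂jm μ υ := by
    intro p
    set K := p.natDegree + 1
    have hpK : p.degree < K := degree_le_natDegree.trans_lt (by exact_mod_cast p.natDegree.lt_succ_self)
    set r := jproj μ υ g K with hr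
    have hrK := degree_jproj_lt hμ hυ g K
    have hgr : MemLp (fun z => g z - r.eval z) 2 (jm μ υ) := h0.sub (memLp_polynomial hμ hυ r 2)
    have hor := orthLT_sub_jproj hμ hυ i0 K
    have a1 : ∫ z, g z ^ 2 ∂jm μ υ =
        ∫ z, (g z - r.eval z) ^ 2 ∂jm μ υ + ∫ z, r.eval z ^ 2 ∂jm μ υ := by
      rw [← hor.integral_add_sq hμ hυ hgr hrK]
      simp
    have a2 : ∫ z, (g z - r.eval z) ^ 2 ∂jm μ υ ≤ ∫ z, (g z - p.eval z) ^ 2 ∂jm μ υ := by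
      have a3 := hor.integral_add_sq hμ hυ hgr (q := r - p)
        ((degree_sub_le _ _).trans_lt (max_lt hrK hpK))
      simp only [eval_sub, ← hr, sub_add_sub_cancel] at a3
      rw [a3]
      exact le_add_of_nonneg_right (integral_nonneg fun z => sq_nonneg _)
    have a4 : jev μ υ m * ∫ z, r.eval z ^ 2 ∂jm μ υ ≤
        ∫ z, (derivative r).eval z ^ 2 ∂jm (μ + 1) (υ + 1) := by
      rw [hr, jproj, integral_derivative_sum_sq hμ hυ, integral_sum_sq hμ hυ, Finset.mul_sum]
      refine Finset.sum_le_sum fun n _ => ?_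
      rcases lt_or_ge n m with hnm | hnm
      · rw [ho _ (by rw [degree_sjac hμ hυ]; exact_mod_cast hnm)]
        simp
      · exact mul_le_mul_of_nonneg_right ((jev_strictMono hμ hυ).monotone hnm)
          (mul_nonneg (sq_nonneg _) (jnorm_pos hμ hυ n).le)
    have a5 := hg.integral_jproj_derivative_sq_le hμ hυ h0 h1 K
    have a6 := mul_le_mul_of_nonneg_left a2 hjm
    rw [a1, mul_add]
    linarith
  refine le_of_forall_pos_le_add fun ε hε => ?_
  -- The divisor is the eigenvalue plus one because the eigenvalue is zero when `m = 0`.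
  obtain ⟨p, hp⟩ := exists_polynomial_integral_sq_sub_le hμ hυ h0
    (ε := ε / (jev μ υ m + 1)) (by positivity)
  refine (key p).trans (add_le_add_right ?_ _)
  rw [le_div_iff₀ (by positivity)] at hp
  have : 0 ≤ ∫ z, (g z - p.eval z) ^ 2 ∂jm μ υ := integral_nonneg fun z => sq_nonneg _
  nlinarith

/-- Differentiation preserves orthogonality to polynomials of low degree. -/
theorem OrthLT.deriv {μ υ : ℝ} {g : ℝ → ℝ} (hg : LocAC g)
    (h0 : Integrable g (jm μ υ)) (h1 : Integrable (deriv g) (jm (μ + 1) (υ + 1)))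
    {m : ℕ} (ho : OrthLT μ υ g (m + 1)) : OrthLT (μ + 1) (υ + 1) (deriv g) m := by
  intro q hq
  rw [hg.integral_deriv_mul h0 h1, ho _ (degree_adjDeriv_lt μ υ hq), neg_zero]

end BackwardJacobi

/-! ### Iterated derivatives and the error of the orthogonal projection. -/

namespace BackwardJacobi
open Set Filter Topology Polynomial

theorem degree_iterate_derivative_lt {p : ℝ[X]} {m : ℕ} (hp : p.degree < m) (k : ℕ) :
    (derivative^[k] p).degree < (m - k : ℕ) := by
  rw [degree_lt_iff_coeff_zero] at hp ⊢
  intro i hi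
  rw [coeff_iterate_derivative, hp (i + k) (by omega), smul_zero]

/-- Each derivative lowers the degree by one and raises both parameters by one, so the `k`-th
eigenvalue is `(N - k) (N + k + μ + υ + 1)`. It never exceeds `N ^ 2 + B N`, whatever `k`. -/
theorem integral_iterate_derivative_sq_le {μ υ B : ℝ} (hμ : -1 < μ) (hυ : -1 < υ)
    (hB0 : 0 ≤ B) (hB : μ + υ + 1 ≤ B) {N : ℕ} {p : ℝ[X]} (hp : p.degree < (N + 1 : ℕ)) :
    ∀ j ≤ N + 1, ∫ z, (derivative^[j] p).eval z ^ 2 ∂jm (μ + j) (υ + j) ≤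
      ((N : ℝ) ^ 2 + B * N) ^ j * ∫ z, p.eval z ^ 2 ∂jm μ υ := by
  intro j
  induction j with
  | zero => simp
  | succ k ih =>
    intro hk
    have hkN : k ≤ N := by omega
    have h1 := ih (by omega)
    have hd : (derivative^[k] p).degree < (N - k + 1 : ℕ) := by
      have := degree_iterate_derivative_lt hp k
      rwa [Nat.sub_add_comm hkN] at this
    have hk0 : (0 : ℝ) ≤ k := k.cast_nonneg
    have h2 := integral_derivative_sq_le (μ := μ + k) (υ := υ + k) (by linarith) (by linarith) hd
    rw [Function.iterate_succ_apply']
    push_cast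
    rw [← add_assoc, ← add_assoc]
    have hN : (k : ℝ) ≤ N := by exact_mod_cast hkN
    have h3 : jev (μ + k) (υ + k) (N - k) ≤ (N : ℝ) ^ 2 + B * N := by
      rw [jev, Nat.cast_sub hkN]
      nlinarith [mul_nonneg (sub_nonneg.2 hN) (sub_nonneg.2 hB), mul_nonneg hB0 hk0]
    have hI : 0 ≤ ∫ z, (derivative^[k] p).eval z ^ 2 ∂jm (μ + k) (υ + k) :=
      integral_nonneg fun z => sq_nonneg _
    have hM : 0 ≤ (N : ℝ) ^ 2 + B * N := by positivity
    calc _ ≤ _ := h2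
      _ ≤ ((N : ℝ) ^ 2 + B * N) * (((N : ℝ) ^ 2 + B * N) ^ k * ∫ z, p.eval z ^ 2 ∂jm μ υ) :=
        mul_le_mul h3 h1 hI hM
      _ = _ := by ring

/-- The exponent is at most `N + 1 ≤ 2 N`, so `(1 + B / N) ^ j ≤ exp (2 B)`. This is why the
constant of part (i) does not depend on the order of differentiation. -/
theorem pow_add_mul_le {B : ℝ} (hB0 : 0 ≤ B) {N j : ℕ} (hN : 1 ≤ N) (hj : j ≤ N + 1) :
    ((N : ℝ) ^ 2 + B * N) ^ j ≤ Real.exp (2 * B) * (N : ℝ) ^ (2 * j) := by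
  have hN0 : (0 : ℝ) < N := by exact_mod_cast hN
  have h1 : (N : ℝ) ^ 2 + B * N = (B / N + 1) * (N : ℝ) ^ 2 := by field_simp; ring
  have h2 : (j : ℝ) ≤ 2 * N := by
    have : (1 : ℝ) ≤ N := by exact_mod_cast hN
    have : (j : ℝ) ≤ N + 1 := by exact_mod_cast hj
    linarith
  rw [h1, mul_pow, ← pow_mul]
  refine mul_le_mul_of_nonneg_right ?_ (by positivity)
  calc (B / N + 1) ^ j ≤ Real.exp (B / N) ^ j :=
        pow_le_pow_left₀ (by positivity) (Real.add_one_le_exp _) _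
    _ = Real.exp (j * (B / N)) := by rw [← Real.exp_nat_mul]
    _ ≤ Real.exp (2 * B) := by
      rw [Real.exp_le_exp]
      calc (j : ℝ) * (B / N) ≤ 2 * N * (B / N) := mul_le_mul_of_nonneg_right h2 (by positivity)
        _ = 2 * B := by field_simp

/-- Membership in the weighted Sobolev space of order `s` on the unit interval, with the iterated
classical derivatives as generalized derivatives. -/
structure WSob (μ υ : ℝ) (s : ℕ) (F : ℝ → ℝ) : Prop where
  locAC : ∀ k < s, LocAC (deriv^[k] F)
  memLp : ∀ k ≤ s, MemLp (deriv^[k] F) 2 (jm (μ + k) (υ + k))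

/-- The `k`-th derivative of the difference of a function and a polynomial. -/
noncomputable def dsub (F : ℝ → ℝ) (p : ℝ[X]) (k : ℕ) (z : ℝ) : ℝ :=
  deriv^[k] F z - (derivative^[k] p).eval z

namespace WSob

variable {μ υ : ℝ} {s : ℕ} {F : ℝ → ℝ}

theorem locAC_dsub (hF : WSob μ υ s F) (p : ℝ[X]) {k : ℕ} (hk : k < s) :
    LocAC (dsub F p k) :=
  (hF.locAC k hk).sub (locAC_polynomial _)

theorem memLp_dsub (hμ : -1 < μ) (hυ : -1 < υ) (hF : WSob μ υ s F) (p : ℝ[X]) {k : ℕ}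
    (hk : k ≤ s) : MemLp (dsub F p k) 2 (jm (μ + k) (υ + k)) := by
  have hk0 : (0 : ℝ) ≤ k := k.cast_nonneg
  exact (hF.memLp k hk).sub (memLp_polynomial (by linarith) (by linarith) _ 2)

theorem deriv_dsub (hF : WSob μ υ s F) (p : ℝ[X]) {k : ℕ} (hk : k < s) (α β : ℝ) :
    deriv (dsub F p k) =ᵐ[jm α β] dsub F p (k + 1) := by
  rw [EventuallyEq, ae_jm]
  filter_upwards [(hF.locAC k hk).ae_differentiableAt] with z hz hz1
  have h := ((hz hz1).hasDerivAt.fun_sub ((derivative^[k] p).hasDerivAt z)).deriv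
  rw [dsub, Function.iterate_succ_apply', Function.iterate_succ_apply']
  exact h

theorem memLp_deriv_dsub (hμ : -1 < μ) (hυ : -1 < υ) (hF : WSob μ υ s F) (p : ℝ[X]) {k : ℕ}
    (hk : k < s) : MemLp (deriv (dsub F p k)) 2 (jm (μ + k + 1) (υ + k + 1)) := by
  have h := hF.memLp_dsub hμ hυ p (Nat.succ_le_of_lt hk)
  push_cast at h
  rw [← add_assoc, ← add_assoc] at h
  exact (memLp_congr_ae (hF.deriv_dsub p hk _ _)).2 h

theorem integral_deriv_dsub_sq (hF : WSob μ υ s F) (p : ℝ[X]) {k : ℕ} (hk : k < s) :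
    ∫ z, deriv (dsub F p k) z ^ 2 ∂jm (μ + k + 1) (υ + k + 1) =
      ∫ z, dsub F p (k + 1) z ^ 2 ∂jm (μ + (k + 1 : ℕ)) (υ + (k + 1 : ℕ)) := by
  push_cast
  rw [← add_assoc, ← add_assoc]
  refine integral_congr_ae ?_
  filter_upwards [hF.deriv_dsub p hk (μ + k + 1) (υ + k + 1)] with z hz
  rw [hz]

/-- Each differentiation costs one degree of orthogonality and raises the weight; these are the
hypotheses needed to iterate the Poincaré inequality. -/
theorem orthLT_dsub (hμ : -1 < μ) (hυ : -1 < υ) (hF : WSob μ υ s F) {N : ℕ} (hs : s ≤ N + 1) :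
    ∀ k ≤ s, OrthLT (μ + k) (υ + k) (dsub F (jproj μ υ F (N + 1)) k) (N + 1 - k) := by
  intro k
  induction k with
  | zero =>
    intro _
    have h := hF.memLp 0 (Nat.zero_le _)
    simp only [Nat.cast_zero, add_zero, Function.iterate_zero, id] at h ⊢
    exact orthLT_sub_jproj hμ hυ (MemLp.integrable_jm hμ hυ h) (N + 1)
  | succ k ih =>
    intro hk
    have hk0 : (0 : ℝ) ≤ k := k.cast_nonneg
    have h1 := ih (by omega)
    rw [show N + 1 - k = N + 1 - (k + 1) + 1 by omega] at h1
    have h2 := h1.deriv (hF.locAC_dsub _ hk)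
      (MemLp.integrable_jm (by linarith) (by linarith) (hF.memLp_dsub hμ hυ _ (by omega)))
      (MemLp.integrable_jm (by linarith) (by linarith) (hF.memLp_deriv_dsub hμ hυ _ hk))
    intro q hq
    push_cast
    rw [← add_assoc, ← add_assoc, ← h2 q hq]
    refine integral_congr_ae ?_
    filter_upwards [hF.deriv_dsub (jproj μ υ F (N + 1)) hk (μ + k + 1) (υ + k + 1)] with z hz
    rw [hz]

/-- Pythagoras: the `s`-th derivative of `F - p` is orthogonal to that of `p`, whose degree is below
`N + 1 - s`. -/
theorem integral_dsub_top_le (hμ : -1 < μ) (hυ : -1 < υ) (hF : WSob μ υ s F) {N : ℕ}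
    (hs : s ≤ N + 1) :
    ∫ z, dsub F (jproj μ υ F (N + 1)) s z ^ 2 ∂jm (μ + s) (υ + s) ≤
      ∫ z, deriv^[s] F z ^ 2 ∂jm (μ + s) (υ + s) := by
  have hs0 : (0 : ℝ) ≤ s := s.cast_nonneg
  set p := jproj μ υ F (N + 1) with hp
  have h := (hF.orthLT_dsub hμ hυ hs s le_rfl).integral_add_sq (by linarith) (by linarith)
    (hF.memLp_dsub hμ hυ p le_rfl)
    (degree_iterate_derivative_lt (degree_jproj_lt hμ hυ F (N + 1)) s)
  simp only [← hp, dsub, sub_add_cancel] at h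
  rw [h]
  exact le_add_of_nonneg_right (integral_nonneg fun z => sq_nonneg _)

/-- The error of the orthogonal projection, in all intermediate norms. -/
theorem integral_dsub_le (hμ : -1 < μ) (hυ : -1 < υ) (hF : WSob μ υ s F) {N : ℕ}
    (hs : s ≤ N + 1) {l : ℕ} (hl : l ≤ s) :
    ((N + 1 - l).factorial : ℝ) * (N : ℝ) ^ (s - l) *
        ∫ z, dsub F (jproj μ υ F (N + 1)) l z ^ 2 ∂jm (μ + l) (υ + l) ≤
      ((N + 1 - s).factorial : ℝ) * ∫ z, deriv^[s] F z ^ 2 ∂jm (μ + s) (υ + s) := by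
  induction hl using Nat.decreasingInduction with
  | self =>
    rw [Nat.sub_self, pow_zero, mul_one]
    exact mul_le_mul_of_nonneg_left (hF.integral_dsub_top_le hμ hυ hs) (by positivity)
  | of_succ k hk ih =>
    refine le_trans ?_ ih
    have hk0 : (0 : ℝ) ≤ k := k.cast_nonneg
    have h1 := (hF.locAC_dsub (jproj μ υ F (N + 1)) hk).poincare (by linarith) (by linarith)
      (hF.memLp_dsub hμ hυ _ (by omega)) (hF.memLp_deriv_dsub hμ hυ _ hk)
      (hF.orthLT_dsub hμ hυ hs k (by omega))
    rw [hF.integral_deriv_dsub_sq _ hk] at h1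
    have e1 : N + 1 - k = (N + 1 - (k + 1)) + 1 := by omega
    have e2 : s - k = (s - (k + 1)) + 1 := by omega
    -- The eigenvalue is `(N + 1 - k) (N + k + μ + υ + 2)`; its first factor builds the factorial,
    -- and its second is at least `N` because `μ + υ > -2`.
    have h2 : ((N + 1 - k : ℕ) : ℝ) * N ≤ jev (μ + k) (υ + k) (N + 1 - k) := by
      have hc : ((N + 1 - k : ℕ) : ℝ) = N + 1 - k := by
        rw [Nat.cast_sub (by omega)]; push_cast; ring
      have hkN : (k : ℝ) ≤ N + 1 := by exact_mod_cast (by omega : k ≤ N + 1)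
      rw [jev]
      refine mul_le_mul_of_nonneg_left ?_ (Nat.cast_nonneg _)
      rw [hc]
      linarith
    have hI : 0 ≤ ∫ z, dsub F (jproj μ υ F (N + 1)) k z ^ 2 ∂jm (μ + k) (υ + k) :=
      integral_nonneg fun z => sq_nonneg _
    have h3 := (mul_le_mul_of_nonneg_right h2 hI).trans h1
    have h4 := mul_le_mul_of_nonneg_left h3
      (by positivity : 0 ≤ ((N + 1 - (k + 1)).factorial : ℝ) * (N : ℝ) ^ (s - (k + 1)))
    refine le_trans (le_of_eq ?_) h4
    rw [e2, pow_succ]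
    conv_lhs => rw [e1, Nat.factorial_succ, ← e1]
    push_cast
    ring

end WSob

end BackwardJacobi

/-! ### Zeros of Jacobi polynomials and Gauss quadrature. -/

namespace BackwardJacobi
open Set Filter Topology Polynomial

/-- `f` does not change sign on the open unit interval. -/
def ConstSign (f : ℝ → ℝ) : Prop :=
  (∀ x ∈ Ioo (0 : ℝ) 1, 0 ≤ f x) ∨ ∀ x ∈ Ioo (0 : ℝ) 1, f x ≤ 0

theorem ConstSign.mul {f g : ℝ → ℝ} (hf : ConstSign f) (hg : ConstSign g) :
    ConstSign fun x => f x * g x := by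
  rcases hf with hf | hf <;> rcases hg with hg | hg
  · exact Or.inl fun x hx => mul_nonneg (hf x hx) (hg x hx)
  · exact Or.inr fun x hx => mul_nonpos_of_nonneg_of_nonpos (hf x hx) (hg x hx)
  · exact Or.inr fun x hx => mul_nonpos_of_nonpos_of_nonneg (hf x hx) (hg x hx)
  · exact Or.inl fun x hx => mul_nonneg_of_nonpos_of_nonpos (hf x hx) (hg x hx)

theorem constSign_finset_prod {ι : Type*} (s : Finset ι) (f : ι → ℝ → ℝ)
    (h : ∀ i ∈ s, ConstSign (f i)) : ConstSign fun x => ∏ i ∈ s, f i x := by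
  classical
  induction s using Finset.induction_on with
  | empty => exact Or.inl fun x _ => by simp
  | insert a s ha ih =>
    simp only [Finset.prod_insert ha]
    exact (h a (Finset.mem_insert_self _ _)).mul (ih fun i hi => h i (Finset.mem_insert_of_mem hi))

theorem constSign_of_ne_zero {f : ℝ → ℝ} (hf : ContinuousOn f (Ioo 0 1))
    (h : ∀ x ∈ Ioo (0 : ℝ) 1, f x ≠ 0) : ConstSign f := by
  by_contra hc
  rw [ConstSign, not_or] at hc
  push Not at hc
  obtain ⟨⟨x, hx, hx0⟩, y, hy, hy0⟩ := hc
  obtain ⟨z, hz, hz0⟩ := isPreconnected_Ioo.intermediate_value hx hy hf ⟨hx0.le, hy0.le⟩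
  exact h z hz hz0

theorem ConstSign.pow {f : ℝ → ℝ} (hf : ConstSign f) (n : ℕ) : ConstSign fun x => f x ^ n := by
  have := constSign_finset_prod (Finset.range n) (fun _ => f) fun _ _ => hf
  simpa using this

theorem ConstSign.integral_ne_zero {μ υ : ℝ} (hμ : -1 < μ) (hυ : -1 < υ) {p : ℝ[X]} (hp : p ≠ 0)
    (h : ConstSign fun x => p.eval x) : ∫ z, p.eval z ∂jm μ υ ≠ 0 := by
  rcases h with h | h
  · exact (integral_polynomial_pos hμ hυ hp h).ne'
  · have := integral_polynomial_pos hμ hυ (neg_ne_zero.2 hp) (fun z hz => by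
      simpa using h z hz)
    simp only [eval_neg, integral_neg] at this
    linarith

theorem orthLT_sjac {μ υ : ℝ} (hμ : -1 < μ) (hυ : -1 < υ) (n : ℕ) :
    OrthLT μ υ (fun z => (sjac μ υ n).eval z) n := by
  intro q hq
  obtain ⟨c, rfl⟩ := exists_eq_sum_sjac hμ hυ _ q hq
  rw [integral_mul_sum (integrable_polynomial hμ hυ _)]
  refine Finset.sum_eq_zero fun m hm => ?_
  rw [integral_sjac_mul_sjac hμ hυ (Finset.mem_range.1 hm).ne', mul_zero]

open Classical in
/-- The zeros of `sjac μ υ n` in the open unit interval. -/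
noncomputable def jzeros (μ υ : ℝ) (n : ℕ) : Finset ℝ :=
  (sjac μ υ n).roots.toFinset.filter fun z => z ∈ Ioo (0 : ℝ) 1

theorem mem_jzeros {μ υ : ℝ} (hμ : -1 < μ) (hυ : -1 < υ) {n : ℕ} {z : ℝ} :
    z ∈ jzeros μ υ n ↔ z ∈ Ioo (0 : ℝ) 1 ∧ (sjac μ υ n).eval z = 0 := by
  classical
  rw [jzeros, Finset.mem_filter, Multiset.mem_toFinset, mem_roots (sjac_ne_zero hμ hυ n), and_comm]
  rfl

/-- If fewer than `n` interior zeros had odd multiplicity, multiplying by the corresponding linear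
factors would give a polynomial of constant sign on the interval, contradicting orthogonality to
degrees `< n`. -/
theorem card_jzeros {μ υ : ℝ} (hμ : -1 < μ) (hυ : -1 < υ) (n : ℕ) :
    (jzeros μ υ n).card = n := by
  classical
  set Q := sjac μ υ n with hQ
  have hQ0 : Q ≠ 0 := sjac_ne_zero hμ hυ n
  have hdeg : Q.natDegree = n := natDegree_eq_of_degree_eq_some (degree_sjac hμ hυ n)
  have hle : (jzeros μ υ n).card ≤ n := by
    calc (jzeros μ υ n).card ≤ Q.roots.toFinset.card := Finset.card_filter_le _ _
      _ ≤ Q.roots.card := Multiset.toFinset_card_le _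
      _ ≤ Q.natDegree := card_roots' _
      _ = n := hdeg
  set O := (jzeros μ υ n).filter fun z => Odd (Q.roots.count z) with hO
  suffices h : n ≤ O.card from le_antisymm hle (h.trans (Finset.card_filter_le _ _))
  by_contra! hlt
  set T : ℝ[X] := ∏ z ∈ O, (X - C z) with hT
  have hT0 : T ≠ 0 := Finset.prod_ne_zero_iff.2 fun z _ => X_sub_C_ne_zero z
  have hTd : T.degree < n := by
    rw [hT, degree_prod]
    simpa using hlt
  obtain ⟨R, hR, -, hR0⟩ := exists_prod_multiset_X_sub_C_mul Q
  have hRne : R ≠ 0 := fun h => hQ0 (by rw [← hR, h, mul_zero])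
  have hRs : ConstSign fun x => R.eval x := by
    refine constSign_of_ne_zero R.continuous.continuousOn fun x _ hx => ?_
    have : x ∈ R.roots := (mem_roots hRne).2 hx
    simp [hR0] at this
  have hfac : ∀ x, Q.eval x * T.eval x = (∏ z ∈ Q.roots.toFinset,
      ((x - z) ^ Q.roots.count z * if z ∈ O then x - z else 1)) * R.eval x := by
    intro x
    have e1 : Q.eval x = (∏ z ∈ Q.roots.toFinset, (x - z) ^ Q.roots.count z) * R.eval x := by
      conv_lhs => rw [← hR, Finset.prod_multiset_map_count]
      simp [eval_prod]
    have e2 : T.eval x = ∏ z ∈ Q.roots.toFinset, if z ∈ O then x - z else 1 := by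
      have hsub : O ⊆ Q.roots.toFinset :=
        (Finset.filter_subset _ _).trans (Finset.filter_subset _ _)
      rw [hT, eval_prod, ← Finset.prod_filter, Finset.filter_mem_eq_inter,
        Finset.inter_eq_right.2 hsub]
      simp
    rw [Finset.prod_mul_distrib, ← e2, e1]
    ring
  have hsign : ConstSign fun x => (Q * T).eval x := by
    simp only [eval_mul, hfac]
    refine (constSign_finset_prod _ _ fun z hz => ?_).mul hRs
    by_cases hz1 : z ∈ Ioo (0 : ℝ) 1
    · have hzj : z ∈ jzeros μ υ n := Finset.mem_filter.2 ⟨hz, hz1⟩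
      by_cases hodd : Odd (Q.roots.count z)
      · refine Or.inl fun x _ => ?_
        have hzO : z ∈ O := Finset.mem_filter.2 ⟨hzj, hodd⟩
        simp only [if_pos hzO, ← pow_succ]
        exact (hodd.add_odd odd_one).pow_nonneg _
      · refine Or.inl fun x _ => ?_
        have hzO : z ∉ O := fun h => hodd (Finset.mem_filter.1 h).2
        simp only [if_neg hzO, mul_one]
        exact (Nat.not_odd_iff_even.1 hodd).pow_nonneg _
    · have h1 : ConstSign fun x => x - z := by
        refine constSign_of_ne_zero (by fun_prop) fun x hx h => hz1 ?_
        rwa [← sub_eq_zero.1 h]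
      have h2 : z ∉ O := fun h => hz1 (Finset.mem_filter.1 (Finset.mem_filter.1 h).1).2
      simp only [if_neg h2, mul_one]
      exact h1.pow _
  refine hsign.integral_ne_zero hμ hυ (mul_ne_zero hQ0 hT0) ?_
  simp only [eval_mul]
  exact orthLT_sjac hμ hυ n T hTd

/-- The Christoffel numbers of Gauss quadrature. -/
noncomputable def jomega (μ υ : ℝ) (n : ℕ) (τ : ℝ) : ℝ :=
  ∫ z, (Lagrange.basis (jzeros μ υ n) id τ).eval z ∂jm μ υ

theorem sjac_eq_C_mul_nodal {μ υ : ℝ} (hμ : -1 < μ) (hυ : -1 < υ) (n : ℕ) :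
    ∃ a : ℝ, a ≠ 0 ∧ sjac μ υ n = C a * Lagrange.nodal (jzeros μ υ n) id := by
  have hQ0 : sjac μ υ n ≠ 0 := sjac_ne_zero hμ hυ n
  refine ⟨(sjac μ υ n).leadingCoeff, leadingCoeff_ne_zero.2 hQ0, ?_⟩
  refine eq_of_degree_sub_lt_of_eval_finset_eq (jzeros μ υ n) ?_ fun z hz => ?_
  · rw [card_jzeros hμ hυ, ← degree_sjac hμ hυ n]
    have hm : (Lagrange.nodal (jzeros μ υ n) (id : ℝ → ℝ)).Monic := Lagrange.nodal_monic
    refine degree_sub_lt_left ?_ hQ0 ?_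
    · rw [degree_C_mul (leadingCoeff_ne_zero.2 hQ0), Lagrange.degree_nodal, card_jzeros hμ hυ,
        degree_sjac hμ hυ]
    · rw [leadingCoeff_mul, leadingCoeff_C, hm.leadingCoeff, mul_one]
  · rw [((mem_jzeros hμ hυ).1 hz).2, eval_mul]
    have h0 : (Lagrange.nodal (jzeros μ υ n) id).eval z = 0 :=
      Lagrange.eval_nodal_at_node (v := (id : ℝ → ℝ)) hz
    rw [h0, mul_zero]

/-- Exactness of Gauss quadrature. -/
theorem integral_eq_sum_jomega {μ υ : ℝ} (hμ : -1 < μ) (hυ : -1 < υ) {n : ℕ} {p : ℝ[X]}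
    (hp : p.degree < (2 * n : ℕ)) :
    ∫ z, p.eval z ∂jm μ υ = ∑ τ ∈ jzeros μ υ n, jomega μ υ n τ * p.eval τ := by
  classical
  set Z := jzeros μ υ n with hZ
  set D := Lagrange.nodal Z (id : ℝ → ℝ) with hD
  have hm : D.Monic := Lagrange.nodal_monic
  have hDd : D.degree = n := by rw [hD, Lagrange.degree_nodal, card_jzeros hμ hυ]
  obtain ⟨a, ha, hQ⟩ := sjac_eq_C_mul_nodal hμ hυ n
  rw [← hZ, ← hD] at hQ
  have hpd := modByMonic_add_div p D
  have hr : (p %ₘ D).degree < Z.card := by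
    rw [hZ, card_jzeros hμ hυ, ← hDd]
    exact degree_modByMonic_lt p hm
  have hq : (p /ₘ D).degree < n := by
    by_cases h : p.degree < D.degree
    · rw [(divByMonic_eq_zero_iff hm).2 h, degree_zero]
      exact WithBot.bot_lt_coe n
    · have h1 := degree_add_divByMonic hm (not_lt.1 h)
      have hp0 : p ≠ 0 := by
        rintro rfl
        rw [degree_zero, hDd] at h
        exact h (WithBot.bot_lt_coe n)
      have hq0 : p /ₘ D ≠ 0 := fun h0 => h ((divByMonic_eq_zero_iff hm).1 h0)
      rw [hDd, degree_eq_natDegree hq0, degree_eq_natDegree hp0] at h1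
      rw [degree_eq_natDegree hp0] at hp
      rw [degree_eq_natDegree hq0]
      have h2 : n + (p /ₘ D).natDegree = p.natDegree := by exact_mod_cast h1
      have h3 : p.natDegree < 2 * n := by exact_mod_cast hp
      exact_mod_cast (by omega : (p /ₘ D).natDegree < n)
  -- The quotient of `p` by the nodal polynomial has degree `< n`, so orthogonality removes it; the
  -- remainder has the same values as `p` at the nodes and is recovered by interpolation.
  have h1 : ∫ z, D.eval z * (p /ₘ D).eval z ∂jm μ υ = 0 := by
    have := orthLT_sjac hμ hυ n _ hq
    simp only [hQ, eval_mul, eval_C, mul_assoc] at this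
    rw [integral_const_mul] at this
    exact (mul_eq_zero.1 this).resolve_left ha
  have hval : ∀ τ ∈ Z, (p %ₘ D).eval τ = p.eval τ := by
    intro τ hτ
    have h0 : D.eval τ = 0 := Lagrange.eval_nodal_at_node (v := (id : ℝ → ℝ)) hτ
    conv_rhs => rw [← hpd, eval_add, eval_mul, h0, zero_mul, add_zero]
  have h2 : p %ₘ D = ∑ τ ∈ Z, C (p.eval τ) * Lagrange.basis Z id τ := by
    rw [Lagrange.eq_interpolate (v := (id : ℝ → ℝ)) (s := Z) Function.injective_id.injOn hr,
      Lagrange.interpolate_apply]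
    exact Finset.sum_congr rfl fun τ hτ => by rw [id, hval τ hτ]
  have h3 : ∫ z, p.eval z ∂jm μ υ = ∫ z, (p %ₘ D).eval z ∂jm μ υ := by
    conv_lhs => rw [← hpd]
    simp only [eval_add, eval_mul]
    rw [integral_add (integrable_polynomial hμ hυ _)
      (integrable_mul_polynomial (integrable_polynomial hμ hυ _) _), h1, add_zero]
  rw [h3, h2]
  simp only [eval_finsetSum, eval_mul, eval_C]
  rw [integral_finsetSum _ fun τ _ => (integrable_polynomial hμ hυ _).const_mul _]
  refine Finset.sum_congr rfl fun τ _ => ?_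
  rw [integral_const_mul, jomega, mul_comm]

/-- The discrete expression of the norm of the interpolation polynomial. -/
theorem integral_interpolate_sq {μ υ : ℝ} (hμ : -1 < μ) (hυ : -1 < υ) {n : ℕ} (hn : 0 < n)
    (v : ℝ → ℝ) :
    ∫ z, (Lagrange.interpolate (jzeros μ υ n) id v).eval z ^ 2 ∂jm μ υ =
      ∑ τ ∈ jzeros μ υ n, jomega μ υ n τ * v τ ^ 2 := by
  classical
  set L := Lagrange.interpolate (jzeros μ υ n) id v with hL
  have hinj : Set.InjOn (id : ℝ → ℝ) (jzeros μ υ n : Set ℝ) := Function.injective_id.injOn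
  have hd : (L ^ 2).degree < (2 * n : ℕ) := by
    have h1 : L.degree < n := by
      have := Lagrange.degree_interpolate_lt (r := v) hinj
      rwa [card_jzeros hμ hυ] at this
    have h2 : L.natDegree < n := by
      rcases eq_or_ne L 0 with h | h
      · rw [h]; simpa using hn
      · exact (natDegree_lt_iff_degree_lt h).2 h1
    refine degree_le_natDegree.trans_lt ?_
    rw [natDegree_pow]
    exact_mod_cast (by omega : 2 * L.natDegree < 2 * n)
  have h1 := integral_eq_sum_jomega hμ hυ hd
  simp only [eval_pow] at h1
  rw [h1]
  refine Finset.sum_congr rfl fun τ hτ => ?_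
  have : L.eval τ = v τ := Lagrange.eval_interpolate_at_node v hinj hτ
  rw [this]

end BackwardJacobi

/-! ### Sturm-type estimates for zeros of solutions of the Jacobi equation. -/

namespace BackwardJacobi
open Set Filter Topology Polynomial

theorem rpow_le_rpow_abs {R t : ℝ} (p : ℝ) (hR : 1 ≤ R) (h1 : R⁻¹ ≤ t) (h2 : t ≤ R) :
    t ^ p ≤ R ^ |p| := by
  have hR0 : 0 < R := by linarith
  have ht : 0 < t := (inv_pos.2 hR0).trans_le h1
  rcases le_total 0 p with hp | hp
  · rw [abs_of_nonneg hp]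
    exact Real.rpow_le_rpow ht.le h2 hp
  · have e : t ^ p = t⁻¹ ^ (-p) := by rw [Real.inv_rpow ht.le, Real.rpow_neg ht.le, inv_inv]
    rw [abs_of_nonpos hp, e]
    exact Real.rpow_le_rpow (inv_pos.2 ht).le (inv_le_of_inv_le₀ hR0 h1) (by linarith)

theorem one_le_rpow_abs_mul {R t : ℝ} (p : ℝ) (hR : 1 ≤ R) (h1 : R⁻¹ ≤ t) (h2 : t ≤ R) :
    1 ≤ R ^ |p| * t ^ p := by
  have hR0 : 0 < R := by linarith
  have ht : 0 < t := (inv_pos.2 hR0).trans_le h1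
  have h := rpow_le_rpow_abs (-p) hR h1 h2
  rw [abs_neg] at h
  calc (1 : ℝ) = t ^ (-p) * t ^ p := by rw [← Real.rpow_add ht]; simp
    _ ≤ _ := mul_le_mul_of_nonneg_right h (Real.rpow_nonneg ht.le _)

/-- For `z ≤ 3 / 4` the base `1 - z` lies in `[1 / 4, 1]`, so only the factor `z ^ υ` matters. -/
theorem jw_le_of_le {μ υ z : ℝ} (hz : 0 < z) (hz1 : z ≤ 3 / 4) :
    jw μ υ z ≤ 4 ^ |μ| * z ^ υ :=
  mul_le_mul_of_nonneg_right (rpow_le_rpow_abs μ (by norm_num) (by linarith) (by linarith))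
    (Real.rpow_nonneg hz.le _)

theorem rpow_le_jw {μ υ z : ℝ} (hz : 0 < z) (hz1 : z ≤ 3 / 4) :
    z ^ υ ≤ 4 ^ |μ| * jw μ υ z := by
  rw [jw, ← mul_assoc]
  exact le_mul_of_one_le_left (Real.rpow_nonneg hz.le _)
    (one_le_rpow_abs_mul μ (by norm_num) (by linarith) (by linarith))

/-- A doubling constant for the Jacobi weight near the left endpoint. -/
noncomputable def jdbl (μ υ : ℝ) : ℝ := 4 ^ |μ| * 2 ^ |υ|

theorem one_le_jdbl (μ υ : ℝ) : 1 ≤ jdbl μ υ :=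
  one_le_mul_of_one_le_of_one_le (Real.one_le_rpow (by norm_num) (abs_nonneg _))
    (Real.one_le_rpow (by norm_num) (abs_nonneg _))

theorem jw_le_jdbl {μ υ x z : ℝ} (hx : 0 < x) (h1 : x / 2 ≤ z) (h2 : z ≤ 2 * x) (h3 : z ≤ 3 / 4) :
    jw μ υ z ≤ jdbl μ υ * x ^ υ := by
  have hz : 0 < z := by linarith
  refine (jw_le_of_le hz h3).trans ?_
  rw [jdbl, mul_assoc]
  refine mul_le_mul_of_nonneg_left ?_ (by positivity)
  have h := rpow_le_rpow_abs υ (R := 2) (t := z / x) (by norm_num)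
    (by rw [le_div_iff₀ hx]; linarith) (by rw [div_le_iff₀ hx]; linarith)
  rwa [Real.div_rpow hz.le hx.le, div_le_iff₀ (Real.rpow_pos_of_pos hx _)] at h

theorem rpow_le_jdbl {μ υ x z : ℝ} (hx : 0 < x) (h1 : x / 2 ≤ z) (h2 : z ≤ 2 * x)
    (h3 : z ≤ 3 / 4) : x ^ υ ≤ jdbl μ υ * jw μ υ z := by
  have hz : 0 < z := by linarith
  have h := one_le_rpow_abs_mul υ (R := 2) (t := z / x) (by norm_num)
    (by rw [le_div_iff₀ hx]; linarith) (by rw [div_le_iff₀ hx]; linarith)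
  rw [Real.div_rpow hz.le hx.le, mul_div_assoc', le_div_iff₀ (Real.rpow_pos_of_pos hx _),
    one_mul] at h
  calc x ^ υ ≤ 2 ^ |υ| * z ^ υ := h
    _ ≤ 2 ^ |υ| * (4 ^ |μ| * jw μ υ z) :=
      mul_le_mul_of_nonneg_left (rpow_le_jw hz h3) (by positivity)
    _ = _ := by rw [jdbl]; ring

/-- The Jacobi differential equation with eigenvalue `l`. -/
def JacobiODE (μ υ l : ℝ) (y : ℝ[X]) : Prop :=
  adjDeriv μ υ (derivative y) = -(C l * y)

theorem JacobiODE.hasDerivAt {μ υ l : ℝ} {y : ℝ[X]} (h : JacobiODE μ υ l y) {z : ℝ}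
    (hz : z ∈ Ioo (0 : ℝ) 1) :
    HasDerivAt (fun t => jw (μ + 1) (υ + 1) t * (derivative y).eval t)
      (-(l * jw μ υ z * y.eval z)) z := by
  refine ((hasDerivAt_jw_succ hz).fun_mul ((derivative y).hasDerivAt z)).congr_deriv ?_
  have h1 := congrArg (fun p : ℝ[X] => p.eval z) h
  simp only [adjDeriv, eval_add, eval_mul, eval_sub, eval_X, eval_one, eval_C, eval_neg] at h1
  rw [jw_succ hz]
  linear_combination (jw μ υ z) * h1

/-- Picone's inequality with a polynomial test function: a solution of the Jacobi equation has no
long interval without zeros. -/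
theorem JacobiODE.length_sq_le {μ υ l : ℝ} {y : ℝ[X]} (h : JacobiODE μ υ l y) (hl : 0 ≤ l)
    {c d m M : ℝ} (hc : 0 < c) (hcd : c < d) (hd : d < 1)
    (hM : ∀ z ∈ Icc c d, jw (μ + 1) (υ + 1) z ≤ M) (hm : ∀ z ∈ Icc c d, m ≤ jw μ υ z)
    (hy : ∀ z ∈ Icc c d, y.eval z ≠ 0) : l * m * (d - c) ^ 2 ≤ 10 * M := by
  set L := d - c with hL
  have hL0 : 0 < L := sub_pos.2 hcd
  set H : ℝ → ℝ := fun z => ((z - c) * (L - (z - c))) ^ 2 *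
    (jw (μ + 1) (υ + 1) z * (derivative y).eval z) / y.eval z with hH
  -- With `φ = (z - c) (d - z)`, `K` is the primitive of `M φ' ^ 2 - l m φ ^ 2` vanishing at `c`,
  -- and `H = φ ^ 2 w₁ y' / y` vanishes at both ends.
  set K : ℝ → ℝ := fun z =>
    M * (L ^ 2 * (z - c) - 2 * L * (z - c) ^ 2 + 4 * (z - c) ^ 3 / 3) -
      l * m * (L ^ 2 * (z - c) ^ 3 / 3 - L * (z - c) ^ 4 / 2 + (z - c) ^ 5 / 5) with hK
  have hder : ∀ z ∈ Icc c d, ∃ e, 0 ≤ e ∧ HasDerivAt (fun z => K z - H z) e z := by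
    intro z hz
    have hz01 : z ∈ Ioo (0 : ℝ) 1 := ⟨by linarith [hz.1], by linarith [hz.2]⟩
    have hu : HasDerivAt (fun z : ℝ => z - c) 1 z := (hasDerivAt_id z).sub_const c
    have hφ : HasDerivAt (fun z => ((z - c) * (L - (z - c))) ^ 2)
        (2 * ((z - c) * (L - (z - c))) * (L - 2 * (z - c))) z := by
      refine ((hu.fun_mul (hu.const_sub L)).fun_pow 2).congr_deriv ?_
      push_cast
      ring
    have hK' : HasDerivAt K
        (M * (L - 2 * (z - c)) ^ 2 - l * m * ((z - c) * (L - (z - c))) ^ 2) z := by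
      refine (((((hu.const_mul (L ^ 2)).fun_sub ((hu.fun_pow 2).const_mul (2 * L))).fun_add
        (((hu.fun_pow 3).const_mul 4).div_const 3)).const_mul M).fun_sub
        ((((((hu.fun_pow 3).const_mul (L ^ 2)).div_const 3).fun_sub
          (((hu.fun_pow 4).const_mul L).div_const 2)).fun_add
          ((hu.fun_pow 5).div_const 5)).const_mul (l * m))).congr_deriv ?_
      simp
      ring
    have hH' := (hφ.fun_mul (h.hasDerivAt hz01)).fun_div (y.hasDerivAt z) (hy z hz)
    refine ⟨_, ?_, hK'.fun_sub hH'⟩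
    have hy0 := hy z hz
    set φ := (z - c) * (L - (z - c)) with hφd
    set ψ := L - 2 * (z - c) with hψd
    set w1 := jw (μ + 1) (υ + 1) z with hw1
    set w0 := jw μ υ z with hw0
    set Y := y.eval z
    set Y' := (derivative y).eval z
    -- Picone's identity: the derivative of `K - H` is a sum of nonnegative terms, the last being a
    -- completed square.
    have e : (M * ψ ^ 2 - l * m * φ ^ 2) -
        ((2 * φ * ψ * (w1 * Y') + φ ^ 2 * -(l * w0 * Y)) * Y - φ ^ 2 * (w1 * Y') * Y') / Y ^ 2 =
        (M - w1) * ψ ^ 2 + l * (w0 - m) * φ ^ 2 + w1 * (ψ - φ * Y' / Y) ^ 2 := by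
      field_simp
      ring
    rw [e]
    have a1 : 0 ≤ M - w1 := sub_nonneg.2 (hM z hz)
    have a2 : 0 ≤ w0 - m := sub_nonneg.2 (hm z hz)
    have a3 : 0 ≤ w1 := jw_nonneg hz01
    positivity
  choose! e he0 he using hder
  have hmono : MonotoneOn (fun z => K z - H z) (Icc c d) := by
    refine monotoneOn_of_hasDerivWithinAt_nonneg (convex_Icc c d)
      (fun z hz => (he z hz).continuousAt.continuousWithinAt)
      (fun z hz => (he z (interior_subset hz)).hasDerivWithinAt)
      (fun z hz => he0 z (interior_subset hz))
  have h1 := hmono (left_mem_Icc.2 hcd.le) (right_mem_Icc.2 hcd.le) hcd.le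
  have e1 : K c - H c = 0 := by simp [hK, hH]
  -- The integrals of `φ' ^ 2` and `φ ^ 2` are `L ^ 3 / 3` and `L ^ 5 / 30`, whence the constant
  -- `10`.
  have e2 : K d - H d = L ^ 3 * (M / 3 - l * m * L ^ 2 / 30) := by
    simp only [hK, hH, ← hL, sub_self]
    ring
  simp only [e1, e2] at h1
  have h2 := nonneg_of_mul_nonneg_right h1 (by positivity)
  linarith

theorem JacobiODE.length_sq_le_of_Ioo {μ υ l : ℝ} {y : ℝ[X]} (h : JacobiODE μ υ l y) (hl : 0 ≤ l)
    {x c d : ℝ} (hx : 0 < x) (hc : x / 2 ≤ c) (hcd : c < d) (hd : d ≤ 2 * x) (hd1 : d ≤ 3 / 4)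
    (hy : ∀ z ∈ Ioo c d, y.eval z ≠ 0) : l * (d - c) ^ 2 ≤ 80 * jdbl μ υ ^ 2 * x := by
  have hG := one_le_jdbl μ υ
  set Γ := jdbl μ υ
  have hxp : 0 < x ^ υ := Real.rpow_pos_of_pos hx _
  -- The endpoints may be zeros, so a quarter of the interval is dropped at each side. Halving the
  -- length costs a factor `4`, which with `10` and the `2` in `M` gives `80`.
  have h1 := h.length_sq_le hl (c := c + (d - c) / 4) (d := d - (d - c) / 4) (by linarith)
    (by linarith) (by linarith) (M := 2 * x * (Γ * x ^ υ)) (m := x ^ υ / Γ) ?_ ?_ ?_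
  · have e : d - (d - c) / 4 - (c + (d - c) / 4) = (d - c) / 2 := by ring
    rw [e] at h1
    have e2 : l * (x ^ υ / Γ) * ((d - c) / 2) ^ 2 = (l * (d - c) ^ 2) * (x ^ υ / (4 * Γ)) := by
      field_simp
      ring
    have e3 : 10 * (2 * x * (Γ * x ^ υ)) = (80 * Γ ^ 2 * x) * (x ^ υ / (4 * Γ)) := by
      field_simp
      ring
    rw [e2, e3] at h1
    exact le_of_mul_le_mul_right h1 (by positivity)
  · intro z hz
    have hz1 : z ∈ Ioo (0 : ℝ) 1 := ⟨by linarith [hz.1], by linarith [hz.2]⟩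
    rw [jw_succ hz1]
    have h2 : z * (1 - z) ≤ 2 * x := by nlinarith [hz1.1, hz1.2, hz.2]
    exact mul_le_mul h2 (jw_le_jdbl hx (by linarith [hz.1]) (by linarith [hz.2])
      (by linarith [hz.2])) (jw_nonneg hz1) (by linarith)
  · intro z hz
    rw [div_le_iff₀ (by linarith), mul_comm]
    exact rpow_le_jdbl hx (by linarith [hz.1]) (by linarith [hz.2]) (by linarith [hz.2])
  · intro z hz
    exact hy z ⟨by linarith [hz.1], by linarith [hz.2]⟩

/-- Zeros of a solution of the Jacobi equation stay away from the endpoint. -/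
theorem JacobiODE.le_mul_zero {μ υ l : ℝ} (hυ : -1 < υ) {y : ℝ[X]} (h : JacobiODE μ υ l y)
    (hl : 0 < l) (hy : y ≠ 0) {ζ : ℝ} (hζ0 : 0 < ζ) (hζ1 : ζ ≤ 1 / 2) (hζ : y.eval ζ = 0) :
    1 ≤ (4 * (4 ^ |μ|) ^ 2 / (υ + 1)) * (l * ζ) := by
  have hυ1 : 0 < υ + 1 := by linarith
  set κ : ℝ := 4 ^ |μ| with hκ
  have hκ0 : 0 < κ := by positivity
  obtain ⟨x₀, hx₀, hmax⟩ := isCompact_Icc.exists_isMaxOn (s := Icc 0 ζ) ⟨0, by simp [hζ0.le]⟩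
    (y.continuous.abs.continuousOn (s := Icc 0 ζ))
  set M := |y.eval x₀| with hM
  have hM0 : 0 < M := by
    rw [hM, abs_pos]
    intro h0
    refine hy (eq_zero_of_infinite_isRoot y ((Icc_infinite hζ0).mono fun z hz => ?_))
    have : |y.eval z| ≤ |y.eval x₀| := hmax hz
    rw [h0, abs_zero] at this
    exact abs_nonpos_iff.1 this
  set K := l * M * κ / (υ + 1) with hK
  have hK0 : 0 < K := by positivity
  -- The flux `w₁ y'` vanishes at `0` and has derivative bounded by that of `K z ^ (υ + 1)`. The
  -- signs `ε = ±1` turn this into a two-sided bound on the flux, hence on `y'`; the mean value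
  -- theorem then compares the maximum of `|y|` with the zero at `ζ`.
  have hmono : ∀ ε : ℝ, |ε| = 1 → MonotoneOn (fun z => K * z ^ (υ + 1) -
      ε * (jw (μ + 1) (υ + 1) z * (derivative y).eval z)) (Icc 0 ζ) := by
    intro ε hε
    have hcont : ContinuousOn (fun z => K * z ^ (υ + 1) -
        ε * (jw (μ + 1) (υ + 1) z * (derivative y).eval z)) (Icc 0 ζ) := by
      have c1 : Continuous fun z : ℝ => z ^ (υ + 1) :=
        Real.continuous_rpow_const hυ1.le
      have c2 : ContinuousOn (fun z : ℝ => (1 - z) ^ (μ + 1)) (Icc 0 ζ) :=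
        (continuousOn_const.sub continuousOn_id).rpow_const
          fun z hz => Or.inl (sub_pos.2 (by simp only [id]; linarith [hz.2])).ne'
      unfold jw
      exact (continuousOn_const.mul c1.continuousOn).sub (continuousOn_const.mul
        ((c2.mul c1.continuousOn).mul (derivative y).continuous.continuousOn))
    refine monotoneOn_of_hasDerivWithinAt_nonneg (f' := fun z => K * ((υ + 1) * z ^ υ) -
      ε * (-(l * jw μ υ z * y.eval z))) (convex_Icc _ _) hcont ?_ ?_
    · intro z hz
      rw [interior_Icc] at hz
      have h1 := (Real.hasDerivAt_rpow_const (x := z) (p := υ + 1) (Or.inl hz.1.ne')).const_mul K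
      rw [add_sub_cancel_right] at h1
      exact (h1.fun_sub ((h.hasDerivAt ⟨hz.1, by linarith [hz.2]⟩).const_mul ε)).hasDerivWithinAt
    · intro z hz
      rw [interior_Icc] at hz
      have h1 : jw μ υ z ≤ κ * z ^ υ := jw_le_of_le hz.1 (by linarith [hz.2])
      have h0 : 0 ≤ jw μ υ z := jw_nonneg ⟨hz.1, by linarith [hz.2]⟩
      have h2 : |y.eval z| ≤ M := hmax ⟨hz.1.le, hz.2.le⟩
      have h3 : |ε * (-(l * jw μ υ z * y.eval z))| ≤ l * (κ * z ^ υ) * M := by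
        have hz0 := hz.1.le
        rw [abs_mul, hε, one_mul, abs_neg, abs_mul, abs_mul, abs_of_pos hl, abs_of_nonneg h0]
        gcongr
      have h4 : K * ((υ + 1) * z ^ υ) = l * (κ * z ^ υ) * M := by
        rw [hK]; field_simp
      rw [h4]
      linarith [le_abs_self (ε * (-(l * jw μ υ z * y.eval z)))]
  have hder : ∀ z ∈ Ioo 0 ζ, |(derivative y).eval z| ≤ 4 * κ * K := by
    intro z hz
    have hzζ : z ∈ Icc 0 ζ := ⟨hz.1.le, hz.2.le⟩
    have h01 : z ∈ Ioo (0 : ℝ) 1 := ⟨hz.1, by linarith [hz.2]⟩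
    have hz0 : (0 : ℝ) ∈ Icc 0 ζ := ⟨le_rfl, hζ0.le⟩
    have hjw0 : jw (μ + 1) (υ + 1) 0 = 0 := by rw [jw, Real.zero_rpow hυ1.ne', mul_zero]
    have a1 := hmono 1 (by simp) hz0 hzζ hz.1.le
    have a2 := hmono (-1) (by simp) hz0 hzζ hz.1.le
    simp only [hjw0, Real.zero_rpow hυ1.ne', zero_mul, mul_zero, sub_zero] at a1 a2
    have a3 : |jw (μ + 1) (υ + 1) z * (derivative y).eval z| ≤ K * z ^ (υ + 1) :=
      abs_le.2 ⟨by linarith, by linarith⟩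
    have hzp : 0 < z ^ υ := Real.rpow_pos_of_pos hz.1 _
    have a4 := rpow_le_jw (μ := μ) (υ := υ) hz.1 (by linarith [hz.2])
    rw [← hκ] at a4
    rw [abs_mul, abs_of_nonneg (jw_nonneg h01), jw_succ h01, Real.rpow_add_one hz.1.ne'] at a3
    have hj := jw_pos (μ := μ) (υ := υ) h01
    have a5 : jw μ υ z * z * ((1 - z) * |(derivative y).eval z|) ≤
        jw μ υ z * z * (K * κ) := by
      calc _ = z * (1 - z) * jw μ υ z * |(derivative y).eval z| := by ring
        _ ≤ K * (z ^ υ * z) := a3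
        _ ≤ K * ((κ * jw μ υ z) * z) := by
          have := hz.1.le
          gcongr
        _ = _ := by ring
    have a6 := le_of_mul_le_mul_left a5 (mul_pos hj hz.1)
    have a7 : 1 / 2 ≤ 1 - z := by linarith [hz.2]
    nlinarith [abs_nonneg ((derivative y).eval z), mul_pos hK0 hκ0]
  have hx₀ζ : x₀ < ζ := by
    refine lt_of_le_of_ne hx₀.2 ?_
    rintro rfl
    rw [hM, hζ, abs_zero] at hM0
    exact hM0.false
  obtain ⟨ξ, hξ, hslope⟩ := exists_hasDerivAt_eq_slope (fun z => y.eval z)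
    (fun z => (derivative y).eval z) hx₀ζ y.continuous.continuousOn fun z _ => y.hasDerivAt z
  rw [hζ, zero_sub, eq_div_iff (by linarith)] at hslope
  have h5 : M ≤ 4 * κ * K * ζ := by
    calc M = |(derivative y).eval ξ * (ζ - x₀)| := by rw [hslope, abs_neg]
      _ = |(derivative y).eval ξ| * (ζ - x₀) := by
        rw [abs_mul, abs_of_pos (sub_pos.2 hx₀ζ)]
      _ ≤ 4 * κ * K * ζ := by
        refine mul_le_mul (hder ξ ⟨hx₀.1.trans_lt hξ.1, hξ.2⟩) (by linarith [hx₀.1])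
          (by linarith) (by positivity)
  have h6 : 4 * κ * K * ζ = (4 * κ ^ 2 / (υ + 1) * (l * ζ)) * M := by
    rw [hK]; field_simp
  rw [h6] at h5
  exact le_of_mul_le_mul_right (by linarith) hM0

end BackwardJacobi

/-! ### The weight of zero-free intervals. -/

namespace BackwardJacobi
open Set Filter Topology Polynomial

theorem intervalIntegrable_jw_of_mem {μ υ a b : ℝ} (hμ : -1 < μ) (hυ : -1 < υ)
    (ha : a ∈ Icc (0 : ℝ) 1) (hb : b ∈ Icc (0 : ℝ) 1) :
    IntervalIntegrable (jw μ υ) volume a b := by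
  refine (intervalIntegrable_jw hμ hυ).mono_set (uIcc_subset_uIcc ?_ ?_)
  · rwa [uIcc_of_le zero_le_one]
  · rwa [uIcc_of_le zero_le_one]

theorem integral_jw_mono {μ υ a b c d : ℝ} (hμ : -1 < μ) (hυ : -1 < υ) (hca : c ≤ a)
    (hab : a ≤ b) (hbd : b ≤ d) (hc : 0 ≤ c) (hd : d ≤ 1) :
    ∫ z in a..b, jw μ υ z ≤ ∫ z in c..d, jw μ υ z := by
  refine intervalIntegral.integral_mono_interval hca hab hbd ?_
    (intervalIntegrable_jw_of_mem hμ hυ ⟨hc, by linarith⟩ ⟨by linarith, hd⟩)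
  rw [← restrict_Ioo_eq_restrict_Ioc]
  filter_upwards [ae_restrict_mem measurableSet_Ioo] with z hz
  exact jw_nonneg ⟨by linarith [hz.1], by linarith [hz.2]⟩

theorem integral_jw_nonneg {μ υ a b : ℝ} (ha : 0 ≤ a) (hab : a ≤ b) (hb : b ≤ 1) :
    0 ≤ ∫ z in a..b, jw μ υ z := by
  refine intervalIntegral.integral_nonneg hab fun z hz => ?_
  exact mul_nonneg (Real.rpow_nonneg (by linarith [hz.2]) _) (Real.rpow_nonneg (ha.trans hz.1) _)

/-- Near `0` the weight is comparable to `z ^ υ`. For `b > 3 / 4` the total mass is a harmless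
constant times `b ^ (υ + 1)`. -/
theorem exists_integral_jw_le {μ υ : ℝ} (hμ : -1 < μ) (hυ : -1 < υ) :
    ∃ C : ℝ, 0 < C ∧ ∀ b ∈ Ioc (0 : ℝ) 1, ∫ z in 0..b, jw μ υ z ≤ C * b ^ (υ + 1) := by
  have hυ1 : 0 < υ + 1 := by linarith
  set B := ∫ z in 0..1, jw μ υ z with hB
  have hB0 : 0 ≤ B := integral_jw_nonneg le_rfl zero_le_one le_rfl
  refine ⟨4 ^ |μ| / (υ + 1) + B * (4 / 3) ^ (υ + 1), by positivity, fun b hb => ?_⟩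
  have hb0 := hb.1.le
  have hbp : 0 ≤ b ^ (υ + 1) := Real.rpow_nonneg hb0 _
  rw [add_mul]
  rcases le_or_gt b (3 / 4) with h | h
  · refine le_trans ?_ (le_add_of_nonneg_right (by positivity))
    calc ∫ z in 0..b, jw μ υ z ≤ ∫ z in 0..b, 4 ^ |μ| * z ^ υ := by
          refine intervalIntegral.integral_mono_ae_restrict hb0
            (intervalIntegrable_jw_of_mem hμ hυ ⟨le_rfl, zero_le_one⟩ ⟨hb0, hb.2⟩)
            ((intervalIntegral.intervalIntegrable_rpow' hυ).const_mul _) ?_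
          rw [← restrict_Ioo_eq_restrict_Icc]
          filter_upwards [ae_restrict_mem measurableSet_Ioo] with z hz
          exact jw_le_of_le hz.1 (by linarith [hz.2])
      _ = _ := by
        rw [intervalIntegral.integral_const_mul, integral_rpow (Or.inl hυ),
          Real.zero_rpow hυ1.ne', sub_zero]
        ring
  · refine le_trans ?_ (le_add_of_nonneg_left (by positivity))
    rw [mul_assoc, ← Real.mul_rpow (by norm_num) hb0]
    refine (integral_jw_mono hμ hυ le_rfl hb0 hb.2 le_rfl le_rfl).trans ?_
    refine le_mul_of_one_le_right hB0 (Real.one_le_rpow (by linarith) hυ1.le)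

/-- Estimates of the Jacobi mass of the zero-free intervals adjacent to a point of the left half
of the unit interval, for a solution of the Jacobi equation with eigenvalue `l`. -/
theorem exists_zero_free_bound {μ υ : ℝ} (hμ : -1 < μ) (hυ : -1 < υ) :
    ∃ C : ℝ, 0 < C ∧ ∀ (l : ℝ) (y : ℝ[X]), 0 < l → y ≠ 0 → JacobiODE μ υ l y →
      ∀ x ∈ Ioc (0 : ℝ) (1 / 2),
        (∀ a, 0 ≤ a → a < x → (∀ z ∈ Ioo a x, y.eval z ≠ 0) →
          √l * ∫ z in a..x, jw μ υ z ≤ C * (jw μ υ x * √x)) ∧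
        (∀ b, x < b → b ≤ 1 → (∀ z ∈ Ioo x b, y.eval z ≠ 0) →
          (∃ ζ ∈ Ioo 0 x, y.eval ζ = 0) →
          √l * ∫ z in x..b, jw μ υ z ≤ C * (jw μ υ x * √x)) := by
  have hυ1 : 0 < υ + 1 := by linarith
  obtain ⟨A, hA, hAb⟩ := exists_integral_jw_le hμ hυ
  have hG := one_le_jdbl μ υ
  set Γ := jdbl μ υ with hΓ
  have hΓ0 : 0 < Γ := by linarith
  set D := 80 * Γ ^ 2 with hD
  have hD0 : 0 < D := by positivity
  set c₀ := 4 * (4 ^ |μ|) ^ 2 / (υ + 1) with hc₀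
  have hc₀0 : 0 < c₀ := by positivity
  -- `R` bounds `b / x` in the endpoint regime: there `l b ≤ 12 D`, while a zero to the left of `x`
  -- forces `1 ≤ c₀ l x`.
  set R := 12 * D * c₀ + 1 with hR
  have hR1 : 1 ≤ R := by rw [hR]; linarith [mul_pos (mul_pos (by norm_num : (0:ℝ) < 12) hD0) hc₀0]
  set E := A * R ^ (υ + 1) with hE
  have hE0 : 0 < E := by positivity
  have hAE : A ≤ E := le_mul_of_one_le_right hA.le (Real.one_le_rpow hR1 hυ1.le)
  refine ⟨Γ * (Γ * √D) + Γ * (2 * E * √D), by positivity, ?_⟩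
  intro l y hl hy hode x hx
  have hx0 := hx.1
  have hxp : 0 < x ^ υ := Real.rpow_pos_of_pos hx0 _
  have hjx : x ^ υ ≤ Γ * jw μ υ x := rpow_le_jdbl hx0 (by linarith) (by linarith) (by linarith [hx.2])
  have hj0 : 0 < jw μ υ x := jw_pos ⟨hx0, by linarith [hx.2]⟩
  have hsl : 0 < √l := Real.sqrt_pos.2 hl
  have hsx : 0 < √x := Real.sqrt_pos.2 hx0
  have gap : ∀ {x c d : ℝ}, 0 < x → x / 2 ≤ c → c < d → d ≤ 2 * x → d ≤ 3 / 4 →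
      (∀ z ∈ Ioo c d, y.eval z ≠ 0) → l * (d - c) ^ 2 ≤ D * x :=
    fun h1 h2 h3 h4 h5 h6 => hode.length_sq_le_of_Ioo hl.le h1 h2 h3 h4 h5 h6
  -- short intervals
  have short : ∀ {c d : ℝ}, x / 2 ≤ c → c < d → d ≤ 2 * x → d ≤ 3 / 4 →
      (∀ z ∈ Ioo c d, y.eval z ≠ 0) →
      √l * ∫ z in c..d, jw μ υ z ≤ Γ * (Γ * √D) * (jw μ υ x * √x) := by
    intro c d h1 h2 h3 h4 h5
    have hg := gap hx0 h1 h2 h3 h4 h5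
    have h6 : √l * (d - c) ≤ √D * √x := by
      rw [← Real.sqrt_mul hD0.le]
      refine Real.le_sqrt_of_sq_le ?_
      rwa [mul_pow, Real.sq_sqrt hl.le]
    have h7 : ∫ z in c..d, jw μ υ z ≤ Γ * x ^ υ * (d - c) := by
      have : ∫ z in c..d, jw μ υ z ≤ ∫ _ in c..d, Γ * x ^ υ := by
        refine intervalIntegral.integral_mono_on h2.le
          (intervalIntegrable_jw_of_mem hμ hυ ⟨by linarith, by linarith⟩
            ⟨by linarith, by linarith⟩) intervalIntegrable_const fun z hz => ?_
        exact jw_le_jdbl hx0 (by linarith [hz.1]) (by linarith [hz.2]) (by linarith [hz.2])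
      rwa [intervalIntegral.integral_const, smul_eq_mul, mul_comm] at this
    calc √l * ∫ z in c..d, jw μ υ z ≤ √l * (Γ * x ^ υ * (d - c)) := by gcongr
      _ = Γ * x ^ υ * (√l * (d - c)) := by ring
      _ ≤ Γ * (Γ * jw μ υ x) * (√D * √x) := by
        have : 0 ≤ √l * (d - c) := mul_nonneg hsl.le (by linarith)
        gcongr
      _ = _ := by ring
  -- points close to the endpoint
  have long : l * x ≤ 4 * D → ∀ I : ℝ, I ≤ E * x ^ (υ + 1) →
      √l * I ≤ Γ * (2 * E * √D) * (jw μ υ x * √x) := by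
    intro h1 I hI
    have h2 : √l * √x ≤ 2 * √D := by
      rw [← Real.sqrt_mul hl.le, show (2 : ℝ) = √4 by
        rw [show (4 : ℝ) = 2 ^ 2 by norm_num, Real.sqrt_sq (by norm_num)],
        ← Real.sqrt_mul (by norm_num)]
      exact Real.sqrt_le_sqrt h1
    calc √l * I ≤ √l * (E * x ^ (υ + 1)) := by gcongr
      _ = E * x ^ υ * √x * (√l * √x) := by
        rw [Real.rpow_add_one hx0.ne']
        nth_rw 1 [← Real.mul_self_sqrt hx0.le]
        rw [Real.mul_self_sqrt hx0.le]
        nth_rw 2 [← Real.mul_self_sqrt hx0.le]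
        ring
      _ ≤ E * (Γ * jw μ υ x) * √x * (2 * √D) := by gcongr
      _ = _ := by ring
  have fin1 : ∀ I : ℝ, I ≤ Γ * (Γ * √D) * (jw μ υ x * √x) →
      I ≤ (Γ * (Γ * √D) + Γ * (2 * E * √D)) * (jw μ υ x * √x) := by
    intro I hI
    rw [add_mul]
    exact hI.trans (le_add_of_nonneg_right (by positivity))
  have fin2 : ∀ I : ℝ, I ≤ Γ * (2 * E * √D) * (jw μ υ x * √x) →
      I ≤ (Γ * (Γ * √D) + Γ * (2 * E * √D)) * (jw μ υ x * √x) := by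
    intro I hI
    rw [add_mul]
    exact hI.trans (le_add_of_nonneg_left (by positivity))
  constructor
  · intro a ha hax hz
    rcases le_or_gt (x / 2) a with h | h
    · exact fin1 _ (short h hax (by linarith) (by linarith [hx.2]) hz)
    · refine fin2 _ (long ?_ _ ?_)
      · have h1 := gap hx0 (c := x / 2) (d := x) le_rfl (by linarith) (by linarith)
          (by linarith [hx.2]) fun z hz1 => hz z ⟨by linarith [hz1.1], hz1.2⟩
        have h2 : l * x * (x / 4) ≤ (4 * D) * (x / 4) := by
          have e : l * (x - x / 2) ^ 2 = l * x * (x / 4) := by ring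
          linarith
        exact le_of_mul_le_mul_right h2 (by positivity)
      · refine (integral_jw_mono hμ hυ ha hax.le le_rfl le_rfl (by linarith [hx.2])).trans ?_
        refine (hAb x ⟨hx0, by linarith [hx.2]⟩).trans ?_
        gcongr
  · intro b hxb hb1 hz hζ
    obtain ⟨ζ, hζx, hζ0⟩ := hζ
    rcases le_or_gt b (min (2 * x) (3 / 4)) with h | h
    · rw [le_min_iff] at h
      exact fin1 _ (short (by linarith) hxb h.1 h.2 hz)
    · have hd : x + x / 2 ≤ min (2 * x) (3 / 4) := le_min (by linarith) (by linarith [hx.2])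
      have h1 := gap hx0 (c := x) (d := min (2 * x) (3 / 4)) (by linarith) (by linarith)
        (min_le_left _ _) (min_le_right _ _) fun z hz1 => hz z ⟨hz1.1, by linarith [hz1.2]⟩
      have hlx : l * x ≤ 4 * D := by
        have h2 : l * x * (x / 4) ≤ (4 * D) * (x / 4) := by
          calc l * x * (x / 4) = l * (x / 2) ^ 2 := by ring
            _ ≤ l * (min (2 * x) (3 / 4) - x) ^ 2 := by gcongr; linarith
            _ ≤ D * x := h1
            _ = _ := by ring
        exact le_of_mul_le_mul_right h2 (by positivity)
      refine fin2 _ (long hlx _ ?_)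
      have hlb : l * b ≤ 12 * D := by
        rcases le_or_gt b (3 / 4) with hb | hb
        · have hb2 : 2 * x < b := by
            rcases min_lt_iff.1 h with h | h <;> linarith
          have hb0 : 0 < b := by linarith
          have h2 := gap hb0 (c := b / 2) (d := b) le_rfl (by linarith) (by linarith) hb
            fun z hz1 => hz z ⟨by linarith [hz1.1], hz1.2⟩
          have h3 : l * b * (b / 4) ≤ (4 * D) * (b / 4) := by
            have e : l * (b - b / 2) ^ 2 = l * b * (b / 4) := by ring
            linarith
          have := le_of_mul_le_mul_right h3 (by positivity)
          linarith
        · have hl12 : l ≤ 12 * D := by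
            rcases le_or_gt x (3 / 8) with hx3 | hx3
            · have h2 := gap (x := 3 / 4) (by norm_num) (c := 3 / 8) (d := 3 / 4) (by norm_num)
                (by norm_num) (by norm_num) le_rfl
                fun z hz1 => hz z ⟨by linarith [hz1.1], by linarith [hz1.2]⟩
              norm_num at h2
              linarith
            · nlinarith
          nlinarith
      have hζl := hode.le_mul_zero hυ hl hy hζx.1 (by linarith [hζx.2, hx.2]) hζ0
      have hbR : b ≤ R * x := by
        have h2 : 1 ≤ c₀ * (l * x) := hζl.trans (by
          have := hζx.2.le
          gcongr)
        have h3 : l * b ≤ l * (12 * D * c₀ * x) := by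
          calc l * b ≤ 12 * D := hlb
            _ ≤ 12 * D * (c₀ * (l * x)) := le_mul_of_one_le_right (by positivity) h2
            _ = _ := by ring
        have h4 := le_of_mul_le_mul_left h3 hl
        rw [hR]
        linarith
      refine (integral_jw_mono hμ hυ hx0.le hxb.le le_rfl le_rfl hb1).trans ?_
      refine (hAb b ⟨by linarith, hb1⟩).trans ?_
      rw [hE, mul_assoc, ← Real.mul_rpow (by linarith) hx0.le]
      have : 0 ≤ b := by linarith
      gcongr

end BackwardJacobi

/-! ### The discrepancy between Gauss quadrature and the Jacobi weight. -/

namespace BackwardJacobi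
open Set Filter Topology Polynomial

theorem exists_derivative_eq {m : ℕ} {q : ℝ[X]} (hq : q.natDegree < m) :
    ∃ p : ℝ[X], p.degree < (m + 1 : ℕ) ∧ derivative p = q := by
  refine ⟨∑ i ∈ Finset.range m, C (q.coeff i / (i + 1)) * X ^ (i + 1), ?_, ?_⟩
  · refine mem_degreeLT.1 (Submodule.sum_mem _ fun i hi => mem_degreeLT.2 ?_)
    refine (degree_C_mul_X_pow_le _ _).trans_lt ?_
    have := Finset.mem_range.1 hi
    exact_mod_cast (by omega : i + 1 < m + 1)
  · conv_rhs => rw [q.as_sum_range' m hq]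
    rw [derivative_sum]
    refine Finset.sum_congr rfl fun i _ => ?_
    have : (i : ℝ) + 1 ≠ 0 := by positivity
    rw [derivative_C_mul_X_pow, ← C_mul_X_pow_eq_monomial]
    push_cast
    rw [div_mul_cancel₀ _ this]

/-- The difference of the distribution functions of Gauss quadrature and of the Jacobi weight. -/
noncomputable def jphi (μ υ : ℝ) (n : ℕ) (x : ℝ) : ℝ :=
  ∑ τ ∈ jzeros μ υ n, (if τ ≤ x then jomega μ υ n τ else 0) - ∫ z in 0..x, jw μ υ z

theorem integral_jm_eq_interval (μ υ : ℝ) (f : ℝ → ℝ) :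
    ∫ z, f z ∂jm μ υ = ∫ z in 0..1, jw μ υ z * f z := by
  rw [integral_jm, intervalIntegral.integral_of_le zero_le_one, integral_Ioc_eq_integral_Ioo]

theorem sum_jomega {μ υ : ℝ} (hμ : -1 < μ) (hυ : -1 < υ) {n : ℕ} (hn : 0 < n) :
    ∑ τ ∈ jzeros μ υ n, jomega μ υ n τ = ∫ z in 0..1, jw μ υ z := by
  have h := integral_eq_sum_jomega hμ hυ (n := n) (p := 1) (by
    rw [degree_one]; exact_mod_cast (by omega : 0 < 2 * n))
  rw [integral_jm_eq_interval] at h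
  simpa using h.symm

theorem integral_ite_mul {a b τ c : ℝ} {g : ℝ → ℝ} (hg : IntervalIntegrable g volume a b)
    (h1 : a ≤ τ) (h2 : τ ≤ b) :
    IntervalIntegrable (fun x => (if τ ≤ x then c else 0) * g x) volume a b ∧
    ∫ x in a..b, (if τ ≤ x then c else 0) * g x = c * ∫ x in τ..b, g x := by
  have hτ : τ ∈ uIcc a b := by rw [uIcc_of_le (h1.trans h2)]; exact ⟨h1, h2⟩
  have e1 : EqOn (fun _ => (0 : ℝ)) (fun x => (if τ ≤ x then c else 0) * g x) (Ioo a τ) :=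
    fun x hx => by simp [not_le.2 hx.2]
  have e2 : EqOn (fun x => c * g x) (fun x => (if τ ≤ x then c else 0) * g x) (Ioo τ b) :=
    fun x hx => by simp [hx.1.le]
  have i1 : IntervalIntegrable (fun x => (if τ ≤ x then c else 0) * g x) volume a τ :=
    intervalIntegrable_const.congr_uIoo (by rwa [uIoo_of_le h1])
  have i2 : IntervalIntegrable (fun x => (if τ ≤ x then c else 0) * g x) volume τ b :=
    ((hg.mono_set (uIcc_subset_uIcc hτ right_mem_uIcc)).const_mul c).congr_uIoo
      (by rwa [uIoo_of_le h2])
  refine ⟨i1.trans i2, ?_⟩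
  rw [← uIoo_of_le h1] at e1
  rw [← uIoo_of_le h2] at e2
  rw [← intervalIntegral.integral_add_adjacent_intervals i1 i2,
    ← intervalIntegral.integral_congr_uIoo e1, ← intervalIntegral.integral_congr_uIoo e2]
  simp

theorem integral_primitive_jw_mul_deriv {μ υ : ℝ} (hμ : -1 < μ) (hυ : -1 < υ) {a b : ℝ}
    (ha : 0 ≤ a) (hab : a ≤ b) (hb : b ≤ 1) {v : ℝ → ℝ}
    (hv : AbsolutelyContinuousOnInterval v a b) :
    IntervalIntegrable (fun x => (∫ z in 0..x, jw μ υ z) * deriv v x) volume a b ∧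
    ∫ x in a..b, (∫ z in 0..x, jw μ υ z) * deriv v x =
      (∫ z in 0..b, jw μ υ z) * v b - (∫ z in 0..a, jw μ υ z) * v a -
        ∫ x in a..b, jw μ υ x * v x := by
  have hsub : uIcc a b ⊆ uIcc (0 : ℝ) 1 := by
    rw [uIcc_of_le hab, uIcc_of_le zero_le_one]
    exact Icc_subset_Icc ha hb
  have hW : AbsolutelyContinuousOnInterval (fun x => ∫ z in 0..x, jw μ υ z) a b :=
    ((intervalIntegrable_jw hμ hυ).absolutelyContinuousOnInterval_intervalIntegral
      (c := 0) (by simp)).mono hsub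
  refine ⟨hv.intervalIntegrable_deriv.continuousOn_mul hW.continuousOn, ?_⟩
  rw [hW.integral_mul_deriv_eq_deriv_mul hv]
  congr 1
  refine intervalIntegral.integral_congr_uIoo fun x hx => ?_
  rw [uIoo_of_le hab] at hx
  have hx1 : x ∈ Ioo (0 : ℝ) 1 := ⟨by linarith [hx.1], by linarith [hx.2]⟩
  have hd : HasDerivAt (fun x => ∫ z in 0..x, jw μ υ z) (jw μ υ x) x := by
    refine intervalIntegral.integral_hasDerivAt_right
      (intervalIntegrable_jw_of_mem hμ hυ ⟨le_rfl, zero_le_one⟩ ⟨hx1.1.le, hx1.2.le⟩) ?_ ?_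
    · exact (measurable_jw μ υ).stronglyMeasurable.stronglyMeasurableAtFilter
    · exact (continuousOn_jw μ υ).continuousAt (Ioo_mem_nhds hx1.1 hx1.2)
  simp only [hd.deriv]

/-- Integration by parts: `Φ` jumps by the Christoffel number at each node and otherwise decreases
with density `jw`. The boundary terms are kept so that the interval can later be exhausted from
inside. -/
theorem integral_jphi_mul_deriv {μ υ : ℝ} (hμ : -1 < μ) (hυ : -1 < υ) {n : ℕ} (hn : 0 < n)
    {a b : ℝ} (ha : 0 ≤ a) (hab : a ≤ b) (hb : b ≤ 1)
    (hZ : ∀ τ ∈ jzeros μ υ n, a ≤ τ ∧ τ ≤ b) {v : ℝ → ℝ}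
    (hv : AbsolutelyContinuousOnInterval v a b) :
    IntervalIntegrable (fun x => jphi μ υ n x * deriv v x) volume a b ∧
    ∫ x in a..b, jphi μ υ n x * deriv v x =
      (∫ z in b..1, jw μ υ z) * v b + (∫ z in 0..a, jw μ υ z) * v a +
        (∫ x in a..b, jw μ υ x * v x) - ∑ τ ∈ jzeros μ υ n, jomega μ υ n τ * v τ := by
  have hd := hv.intervalIntegrable_deriv
  obtain ⟨i1, e1⟩ := integral_primitive_jw_mul_deriv hμ hυ ha hab hb hv
  have i2 : ∀ τ ∈ jzeros μ υ n, IntervalIntegrable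
      (fun x => (if τ ≤ x then jomega μ υ n τ else 0) * deriv v x) volume a b :=
    fun τ hτ => (integral_ite_mul hd (hZ τ hτ).1 (hZ τ hτ).2).1
  have i3 : IntervalIntegrable (fun x => ∑ τ ∈ jzeros μ υ n,
      (if τ ≤ x then jomega μ υ n τ else 0) * deriv v x) volume a b := by
    have := IntervalIntegrable.sum (jzeros μ υ n) i2
    refine this.congr_uIoo fun x _ => ?_
    simp
  have e2 : ∀ x, jphi μ υ n x * deriv v x = (∑ τ ∈ jzeros μ υ n,
      (if τ ≤ x then jomega μ υ n τ else 0) * deriv v x) -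
        (∫ z in 0..x, jw μ υ z) * deriv v x := by
    intro x
    rw [jphi, sub_mul, Finset.sum_mul]
  simp only [e2]
  refine ⟨i3.sub i1, ?_⟩
  rw [intervalIntegral.integral_sub i3 i1, intervalIntegral.integral_finsetSum i2, e1]
  have e3 : ∀ τ ∈ jzeros μ υ n, ∫ x in a..b, (if τ ≤ x then jomega μ υ n τ else 0) * deriv v x =
      jomega μ υ n τ * v b - jomega μ υ n τ * v τ := by
    intro τ hτ
    have hτ' : τ ∈ uIcc a b := by rw [uIcc_of_le hab]; exact hZ τ hτ
    rw [(integral_ite_mul hd (hZ τ hτ).1 (hZ τ hτ).2).2,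
      (hv.mono (uIcc_subset_uIcc hτ' right_mem_uIcc)).integral_deriv_eq_sub]
    ring
  rw [Finset.sum_congr rfl e3, Finset.sum_sub_distrib, ← Finset.sum_mul, sum_jomega hμ hυ hn,
    ← intervalIntegral.integral_add_adjacent_intervals
      (intervalIntegrable_jw_of_mem hμ hυ ⟨le_rfl, zero_le_one⟩ ⟨by linarith, hb⟩)
      (intervalIntegrable_jw_of_mem (b := 1) hμ hυ ⟨by linarith, hb⟩ ⟨zero_le_one, le_rfl⟩)]
  ring

theorem ac_polynomial (p : ℝ[X]) (a b : ℝ) :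
    AbsolutelyContinuousOnInterval (fun z => p.eval z) a b :=
  ContDiffOn.absolutelyContinuousOnInterval (by
    have : ContDiff ℝ 1 fun z => p.eval z := by simpa using p.contDiff_aeval (𝕜 := ℝ) 1
    exact this.contDiffOn)

/-- A primitive of `q` has degree below `2 n`, where quadrature is exact; hence `Φ` is orthogonal to
degrees up to `2 n - 2`. -/
theorem integral_jphi_mul_polynomial {μ υ : ℝ} (hμ : -1 < μ) (hυ : -1 < υ) {n : ℕ} (hn : 0 < n)
    {q : ℝ[X]} (hq : q.natDegree < 2 * n - 1) :
    IntervalIntegrable (fun x => jphi μ υ n x * q.eval x) volume 0 1 ∧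
    ∫ x in 0..1, jphi μ υ n x * q.eval x = 0 := by
  obtain ⟨p, hp, rfl⟩ := exists_derivative_eq hq
  rw [Nat.sub_add_cancel (by omega)] at hp
  have hZ : ∀ τ ∈ jzeros μ υ n, (0 : ℝ) ≤ τ ∧ τ ≤ 1 := fun τ hτ =>
    ⟨((mem_jzeros hμ hυ).1 hτ).1.1.le, ((mem_jzeros hμ hυ).1 hτ).1.2.le⟩
  obtain ⟨h1, h2⟩ := integral_jphi_mul_deriv hμ hυ hn le_rfl zero_le_one le_rfl hZ
    (ac_polynomial p 0 1)
  simp only [Polynomial.deriv] at h1 h2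
  refine ⟨h1, ?_⟩
  rw [h2, ← integral_jm_eq_interval, integral_eq_sum_jomega hμ hυ hp]
  simp

theorem jphi_sub {μ υ : ℝ} (hμ : -1 < μ) (hυ : -1 < υ) (n : ℕ) {x y : ℝ} (hx : 0 ≤ x)
    (hxy : x ≤ y) (hy : y ≤ 1) :
    jphi μ υ n y - jphi μ υ n x =
      ∑ τ ∈ (jzeros μ υ n).filter (fun τ => x < τ ∧ τ ≤ y), jomega μ υ n τ -
        ∫ z in x..y, jw μ υ z := by
  have h1 : ∑ τ ∈ jzeros μ υ n, (if τ ≤ y then jomega μ υ n τ else 0) -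
      ∑ τ ∈ jzeros μ υ n, (if τ ≤ x then jomega μ υ n τ else 0) =
      ∑ τ ∈ (jzeros μ υ n).filter (fun τ => x < τ ∧ τ ≤ y), jomega μ υ n τ := by
    rw [← Finset.sum_sub_distrib, Finset.sum_filter]
    refine Finset.sum_congr rfl fun τ _ => ?_
    by_cases h : τ ≤ x
    · simp [h, h.trans hxy, not_lt.2 h]
    · simp [h, not_le.1 h]
  rw [jphi, jphi, ← h1,
    ← intervalIntegral.integral_add_adjacent_intervals
      (intervalIntegrable_jw_of_mem (μ := μ) (υ := υ) (a := 0) (b := x) hμ hυ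
        ⟨le_rfl, zero_le_one⟩ ⟨hx, by linarith⟩)
      (intervalIntegrable_jw_of_mem (b := y) hμ hυ ⟨hx, by linarith⟩ ⟨by linarith, hy⟩)]
  ring

theorem jphi_eq_sub {μ υ : ℝ} (hμ : -1 < μ) (hυ : -1 < υ) (n : ℕ) {x y : ℝ} (hx : 0 ≤ x)
    (hxy : x ≤ y) (hy : y ≤ 1) (h : ∀ τ ∈ jzeros μ υ n, x < τ → y < τ) :
    jphi μ υ n y = jphi μ υ n x - ∫ z in x..y, jw μ υ z := by
  have h1 := jphi_sub hμ hυ n hx hxy hy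
  rw [Finset.filter_false_of_mem (fun τ hτ h2 => absurd (h τ hτ h2.1) (not_lt.2 h2.2)),
    Finset.sum_empty] at h1
  linarith

theorem jphi_zero {μ υ : ℝ} (hμ : -1 < μ) (hυ : -1 < υ) (n : ℕ) : jphi μ υ n 0 = 0 := by
  rw [jphi, intervalIntegral.integral_same, sub_zero]
  refine Finset.sum_eq_zero fun τ hτ => if_neg (not_le.2 ((mem_jzeros hμ hυ).1 hτ).1.1)

theorem jphi_one {μ υ : ℝ} (hμ : -1 < μ) (hυ : -1 < υ) {n : ℕ} (hn : 0 < n) :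
    jphi μ υ n 1 = 0 := by
  rw [jphi, ← sum_jomega hμ hυ hn, ← Finset.sum_sub_distrib]
  refine Finset.sum_eq_zero fun τ hτ => ?_
  rw [if_pos ((mem_jzeros hμ hυ).1 hτ).1.2.le, sub_self]

theorem jphi_of_lt {μ υ : ℝ} (hμ : -1 < μ) (hυ : -1 < υ) (n : ℕ) {x : ℝ} (hx : 0 ≤ x)
    (hx1 : x ≤ 1) (h : ∀ τ ∈ jzeros μ υ n, x < τ) :
    jphi μ υ n x = -∫ z in 0..x, jw μ υ z := by
  rw [jphi_eq_sub hμ hυ n le_rfl hx hx1 fun τ hτ _ => h τ hτ, jphi_zero hμ hυ, zero_sub]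

theorem jphi_of_ge {μ υ : ℝ} (hμ : -1 < μ) (hυ : -1 < υ) {n : ℕ} (hn : 0 < n) {x : ℝ}
    (hx : 0 ≤ x) (hx1 : x ≤ 1) (h : ∀ τ ∈ jzeros μ υ n, τ ≤ x) :
    jphi μ υ n x = ∫ z in x..1, jw μ υ z := by
  have := jphi_eq_sub hμ hυ n hx hx1 le_rfl fun τ hτ h1 => absurd h1 (not_lt.2 (h τ hτ))
  rw [jphi_one hμ hυ hn] at this
  linarith

/-- `ξ` may be an endpoint, which covers functions of constant sign. No condition is imposed at `ξ`
itself. -/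
theorem exists_sign_change {f : ℝ → ℝ} {a b : ℝ} (hab : a < b) (hf : AntitoneOn f (Ico a b)) :
    ∃ ξ ∈ Icc a b, ∀ x ∈ Ico a b, (x < ξ → 0 ≤ f x) ∧ (ξ < x → f x ≤ 0) := by
  by_cases hne : ∃ x ∈ Ico a b, 0 ≤ f x
  · set S := {x | x ∈ Ico a b ∧ 0 ≤ f x} with hS
    have hSne : S.Nonempty := hne
    have hbdd : BddAbove S := ⟨b, fun x hx => hx.1.2.le⟩
    obtain ⟨x₀, hx₀, hx₀f⟩ := hne
    refine ⟨sSup S, ⟨hx₀.1.trans (le_csSup hbdd ⟨hx₀, hx₀f⟩),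
      csSup_le hSne fun x hx => hx.1.2.le⟩, fun x hx => ⟨fun h => ?_, fun h => ?_⟩⟩
    · obtain ⟨s, hs, hxs⟩ := exists_lt_of_lt_csSup hSne h
      exact hs.2.trans (hf hx hs.1 hxs.le)
    · by_contra! h0
      exact absurd (le_csSup hbdd ⟨hx, h0.le⟩) (not_le.2 h)
  · push Not at hne
    exact ⟨a, left_mem_Icc.2 hab.le, fun x hx => ⟨fun h => absurd hx.1 (not_le.2 h),
      fun _ => (hne x hx).le⟩⟩

end BackwardJacobi

/-! ### The Chebyshev–Markov–Stieltjes inequalities. -/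

namespace BackwardJacobi
open Set Filter Topology Polynomial

theorem exists_enum_jzeros {μ υ : ℝ} (hμ : -1 < μ) (hυ : -1 < υ) (N : ℕ) :
    ∃ z : ℕ → ℝ, (∀ i j, i < j → j ≤ N → z i < z j) ∧
      ∀ τ, τ ∈ jzeros μ υ (N + 1) ↔ ∃ i ≤ N, z i = τ := by
  set e := (jzeros μ υ (N + 1)).orderEmbOfFin (card_jzeros hμ hυ (N + 1)) with he
  refine ⟨fun i => if h : i < N + 1 then e ⟨i, h⟩ else 0, fun i j hij hj => ?_, fun τ => ?_⟩
  · simp only [dif_pos (by omega : i < N + 1), dif_pos (by omega : j < N + 1)]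
    exact e.strictMono hij
  · have hr : τ ∈ jzeros μ υ (N + 1) ↔ τ ∈ range e := by
      rw [he, Finset.range_orderEmbOfFin]
      rfl
    rw [hr]
    constructor
    · rintro ⟨i, rfl⟩
      exact ⟨i, by omega, dif_pos i.2⟩
    · rintro ⟨i, hi, rfl⟩
      exact ⟨⟨i, by omega⟩, by simp [(by omega : i < N + 1)]⟩

/-- The product of all `x - z i` and `x - ξ i` has the sign of `Φ`. If some `ξ` equals a node, the
squared factor can be removed, leaving a polynomial of degree `2 N - 1` to which `Φ` is orthogonal
although their product is nonnegative almost everywhere. -/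
theorem jphi_sign_change_ne {μ υ : ℝ} (hμ : -1 < μ) (hυ : -1 < υ) {N : ℕ} {z ξ : ℕ → ℝ}
    (hz : ∀ i j, i < j → j ≤ N → z i < z j)
    (hzZ : ∀ τ, τ ∈ jzeros μ υ (N + 1) ↔ ∃ i ≤ N, z i = τ)
    (hξ : ∀ i < N, ξ i ∈ Icc (z i) (z (i + 1)) ∧ ∀ x ∈ Ico (z i) (z (i + 1)),
      (x < ξ i → 0 ≤ jphi μ υ (N + 1) x) ∧ (ξ i < x → jphi μ υ (N + 1) x ≤ 0))
    {i₀ k₀ : ℕ} (hi₀ : i₀ < N) (hk₀ : k₀ ≤ N) : ξ i₀ ≠ z k₀ := by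
  intro heq
  set Φ := jphi μ υ (N + 1) with hΦ
  have hz01 : ∀ i ≤ N, z i ∈ Ioo (0 : ℝ) 1 := fun i hi =>
    ((mem_jzeros hμ hυ).1 ((hzZ _).2 ⟨i, hi, rfl⟩)).1
  have hzle : ∀ i j, i ≤ j → j ≤ N → z i ≤ z j := fun i j hij hj => by
    rcases hij.eq_or_lt with rfl | h
    · exact le_rfl
    · exact (hz i j h hj).le
  set T : ℝ → ℝ := fun x => (∏ i ∈ Finset.range (N + 1), (x - z i)) *
    ∏ i ∈ Finset.range N, (x - ξ i) with hT
  have hTb : ∀ x, T x = (x - z 0) * ∏ i ∈ Finset.range N, ((x - z (i + 1)) * (x - ξ i)) := by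
    intro x
    simp only [hT]
    rw [Finset.prod_range_succ', Finset.prod_mul_distrib]
    ring
  have hlt0 : ∀ x, 0 < x → x < z 0 → Φ x < 0 := by
    intro x hx0 hx
    have hx1 : x < 1 := hx.trans (hz01 0 (Nat.zero_le _)).2
    rw [hΦ, jphi_of_lt hμ hυ _ hx0.le hx1.le fun τ hτ => by
      obtain ⟨i, hi, rfl⟩ := (hzZ τ).1 hτ
      exact hx.trans_le (hzle 0 i (Nat.zero_le _) hi), neg_lt_zero]
    refine intervalIntegral.intervalIntegral_pos_of_pos_on
      (intervalIntegrable_jw_of_mem hμ hυ ⟨le_rfl, zero_le_one⟩ ⟨hx0.le, hx1.le⟩)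
      (fun t ht => jw_pos ⟨ht.1, ht.2.trans hx1⟩) hx0
  have br_right : ∀ x i, i < N → z (i + 1) ≤ x → 0 ≤ (x - z (i + 1)) * (x - ξ i) :=
    fun x i hi h => mul_nonneg (by linarith) (by linarith [(hξ i hi).1.2])
  have br_left : ∀ x i, i < N → x ≤ z i → 0 ≤ (x - z (i + 1)) * (x - ξ i) :=
    fun x i hi h => mul_nonneg_of_nonpos_of_nonpos (by linarith [(hξ i hi).1.2, (hξ i hi).1.1])
      (by linarith [(hξ i hi).1.1])
  have hΦT : ∀ x ∈ Ioo (0 : ℝ) 1, 0 ≤ Φ x * T x := by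
    intro x hx
    rw [hTb]
    rcases lt_or_ge x (z 0) with h0 | h0
    · have h1 : 0 ≤ ∏ i ∈ Finset.range N, ((x - z (i + 1)) * (x - ξ i)) :=
        Finset.prod_nonneg fun i hi => by
          have hi' := Finset.mem_range.1 hi
          exact br_left x i hi' (h0.le.trans (hzle 0 i (Nat.zero_le _) hi'.le))
      have h2 := (hlt0 x hx.1 h0).le
      exact mul_nonneg_of_nonpos_of_nonpos h2 (mul_nonpos_of_nonpos_of_nonneg (by linarith) h1)
    · set i := Nat.findGreatest (fun i => z i ≤ x) N with hi
      have hi1 : z i ≤ x := Nat.findGreatest_spec (P := fun i => z i ≤ x) (Nat.zero_le N) h0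
      have hiN : i ≤ N := Nat.findGreatest_le N
      have hi2 : ∀ k, i < k → k ≤ N → x < z k := fun k hk hkN => by
        have := Nat.findGreatest_is_greatest (P := fun i => z i ≤ x) hk hkN
        simpa using this
      have hbr : ∀ l ∈ Finset.range N, l ≠ i → 0 ≤ (x - z (l + 1)) * (x - ξ l) := by
        intro l hl hne
        have hl' := Finset.mem_range.1 hl
        rcases lt_or_gt_of_ne hne with h | h
        · exact br_right x l hl' ((hzle (l + 1) i h hiN).trans hi1)
        · exact br_left x l hl' (hi2 l h hl'.le).le
      rcases hiN.eq_or_lt with h | h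
      · have h1 : 0 ≤ Φ x := by
          rw [hΦ, jphi_of_ge hμ hυ N.succ_pos hx.1.le hx.2.le fun τ hτ => by
            obtain ⟨k, hk, rfl⟩ := (hzZ τ).1 hτ
            exact (hzle k N hk le_rfl).trans (h ▸ hi1)]
          exact integral_jw_nonneg hx.1.le hx.2.le le_rfl
        refine mul_nonneg h1 (mul_nonneg (by linarith) (Finset.prod_nonneg fun l hl => ?_))
        exact hbr l hl (by have := Finset.mem_range.1 hl; omega)
      · rw [← Finset.mul_prod_erase _ _ (Finset.mem_range.2 h)]
        have h1 : 0 ≤ ∏ l ∈ (Finset.range N).erase i, ((x - z (l + 1)) * (x - ξ l)) :=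
          Finset.prod_nonneg fun l hl =>
            hbr l (Finset.mem_of_mem_erase hl) (Finset.ne_of_mem_erase hl)
        have hx2 : x < z (i + 1) := hi2 (i + 1) (Nat.lt_succ_self i) h
        have h2 := (hξ i h).2 x ⟨hi1, hx2⟩
        have h3 : 0 ≤ Φ x * ((x - z (i + 1)) * (x - ξ i)) := by
          rcases lt_trichotomy x (ξ i) with h4 | h4 | h4
          · exact mul_nonneg (h2.1 h4)
              (mul_nonneg_of_nonpos_of_nonpos (by linarith) (by linarith))
          · rw [h4]; simp
          · exact mul_nonneg_of_nonpos_of_nonpos (h2.2 h4)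
              (mul_nonpos_of_nonpos_of_nonneg (by linarith) (by linarith))
        have e : Φ x * ((x - z 0) * ((x - z (i + 1)) * (x - ξ i) *
            ∏ l ∈ (Finset.range N).erase i, ((x - z (l + 1)) * (x - ξ l)))) =
            (x - z 0) * (Φ x * ((x - z (i + 1)) * (x - ξ i))) *
              ∏ l ∈ (Finset.range N).erase i, ((x - z (l + 1)) * (x - ξ l)) := by ring
        rw [e]
        exact mul_nonneg (mul_nonneg (by linarith) h3) h1
  set S : ℝ[X] := (∏ i ∈ (Finset.range (N + 1)).erase k₀, (X - C (z i))) *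
    ∏ i ∈ (Finset.range N).erase i₀, (X - C (ξ i)) with hS
  have hk₀' : k₀ ∈ Finset.range (N + 1) := Finset.mem_range.2 (by omega)
  have hi₀' : i₀ ∈ Finset.range N := Finset.mem_range.2 hi₀
  have hSe : ∀ x, S.eval x = (∏ i ∈ (Finset.range (N + 1)).erase k₀, (x - z i)) *
      ∏ i ∈ (Finset.range N).erase i₀, (x - ξ i) := by
    intro x
    simp [hS, eval_prod]
  have hTS : ∀ x, T x = (x - z k₀) ^ 2 * S.eval x := by
    intro x
    rw [hSe]
    simp only [hT]
    rw [← Finset.mul_prod_erase _ _ hk₀', ← Finset.mul_prod_erase (Finset.range N) _ hi₀', heq]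
    ring
  have hSd : S.natDegree < 2 * (N + 1) - 1 := by
    have h1 := natDegree_prod_le ((Finset.range (N + 1)).erase k₀) fun i => (X - C (z i) : ℝ[X])
    have h2 := natDegree_prod_le ((Finset.range N).erase i₀) fun i => (X - C (ξ i) : ℝ[X])
    simp only [natDegree_X_sub_C, Finset.sum_const, smul_eq_mul, mul_one,
      Finset.card_erase_of_mem hk₀', Finset.card_erase_of_mem hi₀', Finset.card_range] at h1 h2
    have h3 := natDegree_mul_le (p := ∏ i ∈ (Finset.range (N + 1)).erase k₀, (X - C (z i) : ℝ[X]))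
      (q := ∏ i ∈ (Finset.range N).erase i₀, (X - C (ξ i)))
    rw [← hS] at h3
    omega
  obtain ⟨hi, h0⟩ := integral_jphi_mul_polynomial hμ hυ N.succ_pos hSd
  rw [← hΦ] at hi h0
  have hΦS : ∀ x ∈ Ioo (0 : ℝ) 1, x ≠ z k₀ → 0 ≤ Φ x * S.eval x := by
    intro x hx hne
    have h1 := hΦT x hx
    rw [hTS] at h1
    have h2 : 0 < (x - z k₀) ^ 2 := by
      have := sub_ne_zero.2 hne
      positivity
    refine nonneg_of_mul_nonneg_right (a := (x - z k₀) ^ 2) ?_ h2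
    linarith
  rw [intervalIntegral.integral_of_le zero_le_one, integral_Ioc_eq_integral_Ioo] at h0
  rw [intervalIntegrable_iff_integrableOn_Ioo_of_le zero_le_one] at hi
  have hne : ∀ᵐ x, x ≠ z k₀ := by simp [ae_iff]
  have hae : ∀ᵐ x, x ∈ Ioo (0 : ℝ) 1 → Φ x * S.eval x = 0 := by
    rw [← ae_restrict_iff' measurableSet_Ioo]
    refine (setIntegral_eq_zero_iff_of_nonneg_ae ?_ hi).1 h0
    rw [EventuallyLE, ae_restrict_iff' measurableSet_Ioo]
    filter_upwards [hne] with x hx1 hx2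
    exact hΦS x hx2 hx1
  have hz0 := hz01 0 (Nat.zero_le _)
  -- Left of the first node `Φ` is strictly negative and `S` has no zero, so a product vanishing
  -- almost everywhere would make this interval null.
  have hnull : volume (Ioo 0 (z 0)) = 0 := by
    refine measure_mono_null (fun x hx => ?_) hae
    intro hcon
    have h1 := hcon ⟨hx.1, hx.2.trans hz0.2⟩
    have h2 := (hlt0 x hx.1 hx.2).ne
    refine mul_ne_zero h2 ?_ h1
    rw [hSe]
    refine mul_ne_zero (Finset.prod_ne_zero_iff.2 fun i hi => ?_)
      (Finset.prod_ne_zero_iff.2 fun i hi => ?_)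
    · have hi' := Finset.mem_range.1 (Finset.mem_of_mem_erase hi)
      have := hzle 0 i (Nat.zero_le _) (by omega)
      exact (sub_neg.2 (hx.2.trans_le this)).ne
    · have hi' := Finset.mem_range.1 (Finset.mem_of_mem_erase hi)
      have := hzle 0 i (Nat.zero_le _) hi'.le
      exact (sub_neg.2 (hx.2.trans_le (this.trans (hξ i hi').1.1))).ne
  rw [Real.volume_Ioo, sub_zero, ENNReal.ofReal_eq_zero] at hnull
  linarith [hz0.1]

/-- The Chebyshev–Markov–Stieltjes inequalities for Gauss–Jacobi quadrature. -/
theorem jphi_node {μ υ : ℝ} (hμ : -1 < μ) (hυ : -1 < υ) (N : ℕ) {τ : ℝ}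
    (hτ : τ ∈ jzeros μ υ (N + 1)) :
    0 ≤ jphi μ υ (N + 1) τ ∧ jphi μ υ (N + 1) τ - jomega μ υ (N + 1) τ ≤ 0 := by
  obtain ⟨z, hz, hzZ⟩ := exists_enum_jzeros hμ hυ N
  set Φ := jphi μ υ (N + 1) with hΦ
  have hz01 : ∀ i ≤ N, z i ∈ Ioo (0 : ℝ) 1 := fun i hi =>
    ((mem_jzeros hμ hυ).1 ((hzZ _).2 ⟨i, hi, rfl⟩)).1
  have hzle : ∀ i j, i ≤ j → j ≤ N → z i ≤ z j := fun i j hij hj => by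
    rcases hij.eq_or_lt with rfl | h
    · exact le_rfl
    · exact (hz i j h hj).le
  have hdec : ∀ i < N, ∀ x y, z i ≤ x → x ≤ y → y < z (i + 1) →
      Φ y = Φ x - ∫ t in x..y, jw μ υ t := by
    intro i hi x y hx hxy hy
    refine jphi_eq_sub hμ hυ _ (by linarith [(hz01 i hi.le).1]) hxy
      (by linarith [(hz01 (i + 1) hi).2]) fun σ hσ h => ?_
    obtain ⟨k, hk, rfl⟩ := (hzZ σ).1 hσ
    have : i < k := by
      by_contra! h2
      exact absurd (hzle k i h2 hi.le) (not_le.2 (hx.trans_lt h))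
    exact hy.trans_le (hzle (i + 1) k this hk)
  have hanti : ∀ i < N, AntitoneOn Φ (Ico (z i) (z (i + 1))) := by
    intro i hi x hx y hy hxy
    rw [hdec i hi x y hx.1 hxy hy.2]
    have := integral_jw_nonneg (μ := μ) (υ := υ) (a := x) (b := y)
      (by linarith [(hz01 i hi.le).1, hx.1]) hxy (by linarith [(hz01 (i + 1) hi).2, hy.2])
    linarith
  have hex : ∀ i, ∃ ξ, i < N → ξ ∈ Icc (z i) (z (i + 1)) ∧ ∀ x ∈ Ico (z i) (z (i + 1)),
      (x < ξ → 0 ≤ Φ x) ∧ (ξ < x → Φ x ≤ 0) := by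
    intro i
    by_cases hi : i < N
    · obtain ⟨ξ, h1, h2⟩ := exists_sign_change (hz i (i + 1) (Nat.lt_succ_self i) hi) (hanti i hi)
      exact ⟨ξ, fun _ => ⟨h1, h2⟩⟩
    · exact ⟨0, fun h => absurd h hi⟩
  choose ξ hξ using hex
  obtain ⟨k, hk, rfl⟩ := (hzZ τ).1 hτ
  constructor
  · by_contra! hneg
    have hkN : k < N := by
      refine lt_of_le_of_ne hk ?_
      rintro rfl
      refine absurd hneg (not_lt.2 ?_)
      rw [hΦ, jphi_of_ge hμ hυ (Nat.succ_pos _) (hz01 _ le_rfl).1.le (hz01 _ le_rfl).2.le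
        fun σ hσ => by
          obtain ⟨l, hl, rfl⟩ := (hzZ σ).1 hσ
          exact hzle l _ hl le_rfl]
      exact integral_jw_nonneg (hz01 _ le_rfl).1.le (hz01 _ le_rfl).2.le le_rfl
    -- A negative value at `z k` persists up to the next node because `Φ` decreases there, so the
    -- node itself is an admissible sign change.
    refine jphi_sign_change_ne hμ hυ hz hzZ (ξ := Function.update ξ k (z k)) ?_ hkN hk (by simp)
    intro i hi
    rcases eq_or_ne i k with rfl | hne
    · rw [Function.update_self]
      have hlt := hz i (i + 1) (Nat.lt_succ_self i) hi
      refine ⟨left_mem_Icc.2 hlt.le, fun x hx => ⟨fun h => absurd hx.1 (not_le.2 h), fun _ => ?_⟩⟩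
      exact (hanti i hi (left_mem_Ico.2 hlt) hx hx.1).trans hneg.le
    · rw [Function.update_of_ne hne]
      exact hξ i hi
  · by_contra! hpos
    obtain ⟨i, rfl⟩ : ∃ i, k = i + 1 := by
      refine Nat.exists_eq_succ_of_ne_zero ?_
      rintro rfl
      refine absurd hpos (not_lt.2 ?_)
      have h1 := jphi_sub hμ hυ (N + 1) le_rfl (hz01 0 (Nat.zero_le _)).1.le
        (hz01 0 (Nat.zero_le _)).2.le
      have h2 : (jzeros μ υ (N + 1)).filter (fun τ => 0 < τ ∧ τ ≤ z 0) = {z 0} := by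
        ext σ
        rw [Finset.mem_filter, Finset.mem_singleton]
        constructor
        · rintro ⟨hσ, -, h3⟩
          obtain ⟨l, hl, rfl⟩ := (hzZ σ).1 hσ
          exact le_antisymm h3 (hzle 0 l (Nat.zero_le _) hl)
        · rintro rfl
          exact ⟨hτ, (hz01 0 (Nat.zero_le _)).1, le_rfl⟩
      rw [h2, Finset.sum_singleton, jphi_zero hμ hυ] at h1
      have := integral_jw_nonneg (μ := μ) (υ := υ) le_rfl (hz01 0 (Nat.zero_le _)).1.le
        (hz01 0 (Nat.zero_le _)).2.le
      rw [hΦ]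
      linarith
    have hiN : i < N := hk
    have hlt := hz i (i + 1) (Nat.lt_succ_self i) hk
    -- A positive left limit at `z (i + 1)` keeps `Φ` nonnegative on the whole preceding interval,
    -- so its right end is an admissible sign change.
    refine jphi_sign_change_ne hμ hυ hz hzZ (ξ := Function.update ξ i (z (i + 1))) ?_ hiN hk
      (by simp)
    intro l hl
    rcases eq_or_ne l i with rfl | hne
    · rw [Function.update_self]
      refine ⟨right_mem_Icc.2 hlt.le, fun x hx => ⟨fun _ => ?_, fun h => absurd hx.2 (by linarith)⟩⟩
      have hx0 : 0 ≤ x := by linarith [(hz01 l hl.le).1, hx.1]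
      have h1 := jphi_sub hμ hυ (N + 1) hx0 hx.2.le (hz01 (l + 1) hl).2.le
      have h2 : (jzeros μ υ (N + 1)).filter (fun τ => x < τ ∧ τ ≤ z (l + 1)) = {z (l + 1)} := by
        ext σ
        rw [Finset.mem_filter, Finset.mem_singleton]
        constructor
        · rintro ⟨hσ, h3, h4⟩
          obtain ⟨m, hm, rfl⟩ := (hzZ σ).1 hσ
          have : l < m := by
            by_contra! h5
            exact absurd (hzle m l h5 hl.le) (not_le.2 (hx.1.trans_lt h3))
          exact le_antisymm h4 (hzle (l + 1) m this hm)
        · rintro rfl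
          exact ⟨hτ, hx.2, le_rfl⟩
      rw [h2, Finset.sum_singleton] at h1
      have := integral_jw_nonneg (μ := μ) (υ := υ) hx0 hx.2.le (hz01 (l + 1) hl).2.le
      linarith
    · rw [Function.update_of_ne hne]
      exact hξ l hl

end BackwardJacobi

/-! ### The pointwise bound for the discrepancy. -/

namespace BackwardJacobi
open Set Filter Topology Polynomial

/-- The reflection `z ↦ 1 - z` exchanges the parameters, so estimates near `0` transfer to the
endpoint `1`. -/
theorem JacobiODE.reflect {μ υ l : ℝ} {y : ℝ[X]} (h : JacobiODE μ υ l y) :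
    JacobiODE υ μ l (y.comp (1 - X)) := by
  have h1 := congrArg (fun p : ℝ[X] => p.comp (1 - X)) h
  simp only [adjDeriv, add_comp, mul_comp, sub_comp, X_comp, one_comp, C_comp, neg_comp] at h1
  rw [JacobiODE, ← h1]
  simp only [adjDeriv, derivative_comp, derivative_sub, derivative_one, derivative_X,
    zero_sub, neg_mul, one_mul, derivative_neg, neg_neg]
  simp only [map_add, map_one, map_ofNat]
  ring

theorem integral_jw_reflect (μ υ a b : ℝ) :
    ∫ z in (1 - b)..(1 - a), jw υ μ z = ∫ z in a..b, jw μ υ z := by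
  rw [← intervalIntegral.integral_comp_sub_left (fun z => jw υ μ z) 1]
  exact intervalIntegral.integral_congr fun z _ => jw_reflect μ υ z

theorem le_sqrt_jev {μ υ : ℝ} (hμ : -1 < μ) (hυ : -1 < υ) (N : ℕ) :
    (N : ℝ) ≤ √(jev μ υ (N + 1)) := by
  refine Real.le_sqrt_of_sq_le ?_
  rw [jev]
  push_cast
  have : (0 : ℝ) ≤ N := Nat.cast_nonneg N
  nlinarith [mul_nonneg this (by linarith : 0 ≤ μ + υ + 2)]

/-- The left half uses the endpoint estimate directly, the right half its reflection. An interval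
running towards the farther endpoint requires a zero on the other side of `x`; the hypotheses ask
for it in both halves for symmetry. -/
theorem exists_gap_bound {μ υ : ℝ} (hμ : -1 < μ) (hυ : -1 < υ) :
    ∃ C > 0, ∀ (N : ℕ), 1 ≤ N → ∀ x ∈ Ioo (0 : ℝ) 1,
      (∀ a, 0 ≤ a → a < x → (∀ z ∈ Ioo a x, (sjac μ υ (N + 1)).eval z ≠ 0) →
        (∃ ζ ∈ Ioo x 1, (sjac μ υ (N + 1)).eval ζ = 0) →
        N * ∫ z in a..x, jw μ υ z ≤ C * (jw μ υ x * √(x * (1 - x)))) ∧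
      (∀ b, x < b → b ≤ 1 → (∀ z ∈ Ioo x b, (sjac μ υ (N + 1)).eval z ≠ 0) →
        (∃ ζ ∈ Ioo 0 x, (sjac μ υ (N + 1)).eval ζ = 0) →
        N * ∫ z in x..b, jw μ υ z ≤ C * (jw μ υ x * √(x * (1 - x)))) := by
  obtain ⟨C₁, hC₁, H₁⟩ := exists_zero_free_bound hμ hυ
  obtain ⟨C₂, hC₂, H₂⟩ := exists_zero_free_bound hυ hμ
  refine ⟨2 * (C₁ + C₂), by positivity, fun N hN x hx => ?_⟩
  have hN' : (0 : ℝ) < N := by exact_mod_cast hN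
  have hlN := le_sqrt_jev hμ hυ N
  have hl : 0 < jev μ υ (N + 1) := Real.sqrt_pos.1 (hN'.trans_le hlN)
  have hy : sjac μ υ (N + 1) ≠ 0 := sjac_ne_zero hμ hυ _
  have hode : JacobiODE μ υ (jev μ υ (N + 1)) (sjac μ υ (N + 1)) := sjac_ode hμ _
  set y := sjac μ υ (N + 1)
  have hw := (jw_pos (μ := μ) (υ := υ) hx).le
  have key : ∀ t ∈ Ioc (0 : ℝ) (1 / 2), √t ≤ 2 * √(t * (1 - t)) := by
    intro t ht
    rw [show (2 : ℝ) = √4 by rw [show (4 : ℝ) = 2 ^ 2 by norm_num]; simp, ← Real.sqrt_mul (by norm_num)]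
    exact Real.sqrt_le_sqrt (by nlinarith [ht.1, ht.2])
  have fin : ∀ {C I t : ℝ}, 0 ≤ I → 0 < C → C ≤ C₁ + C₂ → √t ≤ 2 * √(x * (1 - x)) →
      √(jev μ υ (N + 1)) * I ≤ C * (jw μ υ x * √t) →
      N * I ≤ 2 * (C₁ + C₂) * (jw μ υ x * √(x * (1 - x))) := by
    intro C I t hI hC hCC ht h
    calc N * I ≤ √(jev μ υ (N + 1)) * I := by gcongr
      _ ≤ C * (jw μ υ x * √t) := h
      _ ≤ (C₁ + C₂) * (jw μ υ x * (2 * √(x * (1 - x)))) := by gcongr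
      _ = _ := by ring
  rcases le_or_gt x (1 / 2) with hx2 | hx2
  · obtain ⟨hA, hB⟩ := H₁ _ y hl hy hode x ⟨hx.1, hx2⟩
    have hk := key x ⟨hx.1, hx2⟩
    exact ⟨fun a ha hax hz _ => fin (integral_jw_nonneg ha hax.le hx.2.le) hC₁ (by linarith) hk
        (hA a ha hax hz),
      fun b hxb hb hz hζ => fin (integral_jw_nonneg hx.1.le hxb.le hb) hC₁ (by linarith) hk
        (hB b hxb hb hz hζ)⟩
  · have hy' : y.comp (1 - X) ≠ 0 := by
      intro h
      have h1 := congrArg (fun p : ℝ[X] => p.comp (1 - X)) h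
      simp only [comp_assoc, sub_comp, one_comp, X_comp, sub_sub_cancel, comp_X, zero_comp] at h1
      exact hy h1
    have he : ∀ z, (y.comp (1 - X)).eval z = y.eval (1 - z) := fun z => by simp
    obtain ⟨hA, hB⟩ := H₂ _ _ hl hy' hode.reflect (1 - x) ⟨by linarith [hx.2], by linarith⟩
    have hk : √(1 - x) ≤ 2 * √(x * (1 - x)) := by
      have := key (1 - x) ⟨by linarith [hx.2], by linarith⟩
      rwa [sub_sub_cancel, mul_comm (1 - x)] at this
    simp only [jw_reflect, he] at hA hB
    refine ⟨fun a ha hax hz hζ => fin (integral_jw_nonneg ha hax.le hx.2.le) hC₂ (by linarith) hk ?_,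
      fun b hxb hb hz hζ => fin (integral_jw_nonneg hx.1.le hxb.le hb) hC₂ (by linarith) hk ?_⟩
    · have h1 := hB (1 - a) (by linarith) (by linarith)
        (fun z h => hz _ ⟨by linarith [h.2], by linarith [h.1]⟩) ?_
      · rwa [integral_jw_reflect] at h1
      · obtain ⟨ζ, h2, h3⟩ := hζ
        exact ⟨1 - ζ, ⟨by linarith [h2.2], by linarith [h2.1]⟩, by rwa [sub_sub_cancel]⟩
    · have h1 := hA (1 - b) (by linarith) (by linarith)
        (fun z h => hz _ ⟨by linarith [h.2], by linarith [h.1]⟩)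
      rwa [integral_jw_reflect] at h1

/-- Between nodes `Φ` only decreases by the weight. As it is nonnegative at the preceding node, and
its left limit at the following one is nonpositive, it is controlled by the weight from `x` to those
nodes. -/
theorem exists_abs_jphi_le {μ υ : ℝ} (hμ : -1 < μ) (hυ : -1 < υ) :
    ∃ C > 0, ∀ (N : ℕ), 1 ≤ N → ∀ x ∈ Ioo (0 : ℝ) 1, x ∉ jzeros μ υ (N + 1) →
      |jphi μ υ (N + 1) x| ≤ C / N * (jw μ υ x * √(x * (1 - x))) := by
  obtain ⟨C, hC, H⟩ := exists_gap_bound hμ hυ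
  refine ⟨C, hC, fun N hN x hx hxZ => ?_⟩
  have hN' : (0 : ℝ) < N := by exact_mod_cast hN
  obtain ⟨hA, hB⟩ := H N hN x hx
  set Z := jzeros μ υ (N + 1) with hZ
  set K := jw μ υ x * √(x * (1 - x)) with hK
  have hK0 : 0 ≤ K := mul_nonneg (jw_pos hx).le (Real.sqrt_nonneg _)
  have hR0 : 0 ≤ C / N * K := by positivity
  have div : ∀ {I}, N * I ≤ C * K → I ≤ C / N * K := fun {I} h => by
    rw [div_mul_eq_mul_div, le_div_iff₀ hN']
    linarith
  have hmem : ∀ {τ}, τ ∈ Z ↔ τ ∈ Ioo (0 : ℝ) 1 ∧ (sjac μ υ (N + 1)).eval τ = 0 :=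
    mem_jzeros hμ hυ
  have hne : ∀ τ ∈ Z, τ ≠ x := fun τ hτ h => hxZ (h ▸ hτ)
  rw [abs_le]
  constructor
  -- With no node beyond `x`, `Φ x` is a tail mass and the lower bound is free; otherwise that node
  -- is the zero required by the gap bound.
  · by_cases h : ∃ ζ ∈ Z, x < ζ
    · obtain ⟨ζ, hζ, hxζ⟩ := h
      have hζ' : ∃ ζ ∈ Ioo x 1, (sjac μ υ (N + 1)).eval ζ = 0 :=
        ⟨ζ, ⟨hxζ, (hmem.1 hζ).1.2⟩, (hmem.1 hζ).2⟩
      obtain ⟨a, ha0, hax, haZ, haΦ⟩ : ∃ a, 0 ≤ a ∧ a < x ∧ (∀ τ ∈ Z, a < τ → x < τ) ∧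
          0 ≤ jphi μ υ (N + 1) a := by
        by_cases hne' : (Z.filter (· < x)).Nonempty
        · have h1 := Finset.max'_mem _ hne'
          rw [Finset.mem_filter] at h1
          refine ⟨_, (hmem.1 h1.1).1.1.le, h1.2, fun τ hτ h2 => ?_, (jphi_node hμ hυ N h1.1).1⟩
          by_contra! h3
          exact absurd (Finset.le_max' (Z.filter (· < x)) τ (Finset.mem_filter.2 ⟨hτ, lt_of_le_of_ne h3 (hne τ hτ)⟩))
            (not_le.2 h2)
        · refine ⟨0, le_rfl, hx.1, fun τ hτ h2 => ?_, (jphi_zero hμ hυ _).ge⟩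
          by_contra! h3
          exact hne' ⟨τ, Finset.mem_filter.2 ⟨hτ, lt_of_le_of_ne h3 (hne τ hτ)⟩⟩
      have h1 := jphi_eq_sub hμ hυ (N + 1) ha0 hax.le hx.2.le haZ
      have h2 := div (hA a ha0 hax (fun z hz h0 => absurd
        (haZ z (hmem.2 ⟨⟨ha0.trans_lt hz.1, hz.2.trans hx.2⟩, h0⟩) hz.1) (not_lt.2 hz.2.le)) hζ')
      linarith
    · push Not at h
      rw [jphi_of_ge hμ hυ N.succ_pos hx.1.le hx.2.le h]
      linarith [integral_jw_nonneg (μ := μ) (υ := υ) hx.1.le hx.2.le le_rfl]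
  · by_cases h : ∃ ζ ∈ Z, ζ < x
    · obtain ⟨ζ, hζ, hxζ⟩ := h
      have hζ' : ∃ ζ ∈ Ioo 0 x, (sjac μ υ (N + 1)).eval ζ = 0 :=
        ⟨ζ, ⟨(hmem.1 hζ).1.1, hxζ⟩, (hmem.1 hζ).2⟩
      -- `b` is the next node, or `1` if there is none.
      obtain ⟨b, hxb, hb1, hbZ, hbΦ⟩ : ∃ b, x < b ∧ b ≤ 1 ∧ (∀ τ ∈ Z, x < τ → b ≤ τ) ∧
          jphi μ υ (N + 1) x ≤ ∫ z in x..b, jw μ υ z := by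
        by_cases hne' : (Z.filter (x < ·)).Nonempty
        · have h1 := Finset.min'_mem _ hne'
          have hle : ∀ τ ∈ Z, x < τ → (Z.filter (x < ·)).min' hne' ≤ τ := fun τ hτ h2 =>
            Finset.min'_le _ τ (Finset.mem_filter.2 ⟨hτ, h2⟩)
          rw [Finset.mem_filter] at h1
          refine ⟨_, h1.2, (hmem.1 h1.1).1.2.le, hle, ?_⟩
          set b := (Z.filter (x < ·)).min' hne'
          have h2 := jphi_sub hμ hυ (N + 1) hx.1.le h1.2.le (hmem.1 h1.1).1.2.le
          have h3 : Z.filter (fun τ => x < τ ∧ τ ≤ b) = {b} := by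
            ext τ
            rw [Finset.mem_filter, Finset.mem_singleton]
            exact ⟨fun h => le_antisymm h.2.2 (hle τ h.1 h.2.1), fun h => h.symm ▸ ⟨h1.1, h1.2, le_rfl⟩⟩
          rw [← hZ, h3, Finset.sum_singleton] at h2
          linarith [(jphi_node hμ hυ N h1.1).2]
        · have h1 : ∀ τ ∈ Z, ¬ x < τ := fun τ hτ h2 => hne' ⟨τ, Finset.mem_filter.2 ⟨hτ, h2⟩⟩
          exact ⟨1, hx.2, le_rfl, fun τ hτ h2 => absurd h2 (h1 τ hτ),
            (jphi_of_ge hμ hυ N.succ_pos hx.1.le hx.2.le fun τ hτ => not_lt.1 (h1 τ hτ)).le⟩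
      exact hbΦ.trans (div (hB b hxb hb1 (fun z hz h0 => absurd
        (hbZ z (hmem.2 ⟨⟨hx.1.trans hz.1, hz.2.trans_le hb1⟩, h0⟩) hz.1) (not_le.2 hz.2)) hζ'))
    · push Not at h
      rw [jphi_of_lt hμ hυ _ hx.1.le hx.2.le fun τ hτ => lt_of_le_of_ne (h τ hτ) (hne τ hτ).symm]
      linarith [integral_jw_nonneg (μ := μ) (υ := υ) le_rfl hx.1.le hx.2.le]

end BackwardJacobi

/-! ### Stability of Gauss quadrature. -/

namespace BackwardJacobi
open Set Filter Topology Polynomial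

/-- Near the endpoint the mass is of the order of the raised weight, so boundary terms are dominated
by a quantity already known to vanish in the limit. -/
theorem exists_integral_jw_le_jw_succ {μ υ : ℝ} (hμ : -1 < μ) (hυ : -1 < υ) :
    ∃ K > 0, ∀ a ∈ Ioc (0 : ℝ) (1 / 2), ∫ z in 0..a, jw μ υ z ≤ K * jw (μ + 1) (υ + 1) a := by
  obtain ⟨A, hA, H⟩ := exists_integral_jw_le hμ hυ
  refine ⟨A * 2 ^ (μ + 1), by positivity, fun a ha => (H a ⟨ha.1, by linarith [ha.2]⟩).trans ?_⟩
  have h1 : (1 : ℝ) ≤ 2 ^ (μ + 1) * (1 - a) ^ (μ + 1) := by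
    rw [← Real.mul_rpow (by norm_num) (by linarith [ha.2])]
    exact Real.one_le_rpow (by linarith [ha.2]) (by linarith)
  have h2 : 0 ≤ a ^ (υ + 1) := Real.rpow_nonneg ha.1.le _
  calc A * a ^ (υ + 1) ≤ A * ((2 ^ (μ + 1) * (1 - a) ^ (μ + 1)) * a ^ (υ + 1)) := by
        gcongr
        exact le_mul_of_one_le_left h2 h1
    _ = _ := by rw [jw]; ring

/-- The factor `√(z (1 - z))` in the bound for `Φ` turns the raised weight of `v'` into the weight
of `v`, so Cauchy–Schwarz works in a single measure. -/
theorem memLp_sqrt_mul {μ υ : ℝ} {w : ℝ → ℝ} (hw : MemLp w 2 (jm (μ + 1) (υ + 1)))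
    (hm : Measurable w) :
    MemLp (fun z => √(z * (1 - z)) * w z) 2 (jm μ υ) ∧
      ∫ z, (√(z * (1 - z)) * w z) ^ 2 ∂jm μ υ = ∫ z, w z ^ 2 ∂jm (μ + 1) (υ + 1) := by
  have e : EqOn (fun z => jw (μ + 1) (υ + 1) z * w z ^ 2)
      (fun z => jw μ υ z * (√(z * (1 - z)) * w z) ^ 2) (Ioo 0 1) := fun z hz => by
    simp only
    rw [mul_pow, Real.sq_sqrt (mul_nonneg hz.1.le (by linarith [hz.2])), jw_succ hz]
    ring
  have hm' : Measurable fun z => √(z * (1 - z)) * w z := by fun_prop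
  refine ⟨?_, ?_⟩
  · rw [memLp_two_iff_integrable_sq hm'.aestronglyMeasurable, integrable_jm]
    exact (integrable_jm.1 hw.integrable_sq).congr_fun e measurableSet_Ioo
  · rw [integral_jm, integral_jm]
    exact (setIntegral_congr_fun measurableSet_Ioo e).symm

/-- Stability of Gauss–Jacobi quadrature applied to squares of functions in the weighted Sobolev
space of order one. -/
theorem exists_sum_jomega_mul_sq_le {μ υ : ℝ} (hμ : -1 < μ) (hυ : -1 < υ) :
    ∃ C > 0, ∀ N : ℕ, 1 ≤ N → ∀ v : ℝ → ℝ, LocAC v → MemLp v 2 (jm μ υ) →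
      MemLp (deriv v) 2 (jm (μ + 1) (υ + 1)) →
      ∑ τ ∈ jzeros μ υ (N + 1), jomega μ υ (N + 1) τ * v τ ^ 2 ≤
        ∫ z, v z ^ 2 ∂jm μ υ + C / N * (√(∫ z, v z ^ 2 ∂jm μ υ) *
          √(∫ z, deriv v z ^ 2 ∂jm (μ + 1) (υ + 1))) := by
  obtain ⟨C, hC, HΦ⟩ := exists_abs_jphi_le hμ hυ
  obtain ⟨K₁, hK₁, HK₁⟩ := exists_integral_jw_le_jw_succ hμ hυ
  obtain ⟨K₂, hK₂, HK₂⟩ := exists_integral_jw_le_jw_succ hυ hμ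
  refine ⟨2 * C, by positivity, fun N hN v hv hv0 hv1 => ?_⟩
  have hN' : (0 : ℝ) < N := by exact_mod_cast hN
  set Z := jzeros μ υ (N + 1) with hZ
  set Φ := jphi μ υ (N + 1) with hΦ
  have hsq : LocAC fun z => v z ^ 2 := by simpa only [sq] using hv.mul hv
  have hder : ∀ᵐ z, z ∈ Ioo (0 : ℝ) 1 → deriv (fun z => v z ^ 2) z = 2 * (v z * deriv v z) := by
    filter_upwards [hv.ae_differentiableAt] with z hz hz1
    rw [deriv_fun_pow (hz hz1)]
    simp
    ring
  obtain ⟨hg, hgi⟩ := memLp_sqrt_mul hv1 (measurable_deriv v)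
  set g : ℝ → ℝ := fun z => √(z * (1 - z)) * deriv v z with hgdef
  have hI1 : Integrable (fun z => |v z| * |g z|) (jm μ υ) := by
    simpa [abs_mul] using (hv0.integrable_mul hg).abs
  have hI1' : IntegrableOn (fun z => jw μ υ z * (|v z| * |g z|)) (Ioo 0 1) := integrable_jm.1 hI1
  have hv2 : IntegrableOn (fun z => jw μ υ z * v z ^ 2) (Ioo 0 1) :=
    integrable_jm.1 hv0.integrable_sq
  have hd2 : Integrable (deriv fun z => v z ^ 2) (jm (μ + 1) (υ + 1)) := by
    have h1 := ((memLp_jm_succ hv0).integrable_mul hv1).const_mul 2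
    refine h1.congr (ae_jm.2 ?_)
    filter_upwards [hder] with z hz hz1
    rw [hz hz1]
    rfl
  obtain ⟨⟨H, hHc, hHe, hH0, hH1⟩, -⟩ := hsq.jw_succ_mul hv0.integrable_sq hd2
  have hCS : ∫ z in Ioo 0 1, jw μ υ z * (|v z| * |g z|) ≤
      √(∫ z, v z ^ 2 ∂jm μ υ) * √(∫ z, deriv v z ^ 2 ∂jm (μ + 1) (υ + 1)) := by
    rw [← integral_jm μ υ fun z => |v z| * |g z|, ← hgi]
    exact integral_mul_le_sqrt hv0 hg
  have hZ01 : ∀ τ ∈ Z, τ ∈ Ioo (0 : ℝ) 1 := fun τ hτ => ((mem_jzeros hμ hυ).1 hτ).1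
  -- The function `v` is absolutely continuous only inside the interval, so the estimate is made on
  -- `[t, 1 - t]`, containing all nodes, with boundary terms that tend to zero with `t`.
  have main : ∀ t ∈ Ioo (0 : ℝ) (1 / 2), (∀ τ ∈ Z, t ≤ τ ∧ τ ≤ 1 - t) →
      ∑ τ ∈ Z, jomega μ υ (N + 1) τ * v τ ^ 2 ≤ (∫ z, v z ^ 2 ∂jm μ υ + 2 * C / N *
        (√(∫ z, v z ^ 2 ∂jm μ υ) * √(∫ z, deriv v z ^ 2 ∂jm (μ + 1) (υ + 1)))) +
        (K₂ * H (1 - t) + K₁ * H t) := by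
    intro t ht htZ
    have hsub : Ioc t (1 - t) ⊆ Ioo 0 1 := fun z hz =>
      ⟨ht.1.trans hz.1, by linarith [hz.2, ht.1]⟩
    have htt : t ≤ 1 - t := by linarith [ht.2]
    obtain ⟨h1, h2⟩ := integral_jphi_mul_deriv hμ hυ N.succ_pos ht.1.le htt
      (by linarith [ht.1]) htZ (hsq t (1 - t) ht.1 (by linarith [ht.2]) (by linarith [ht.1]))
    have hB1 : (∫ z in 0..t, jw μ υ z) * v t ^ 2 ≤ K₁ * H t := by
      rw [hHe ⟨ht.1, by linarith [ht.2]⟩]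
      calc _ ≤ (K₁ * jw (μ + 1) (υ + 1) t) * v t ^ 2 := by
            gcongr
            exact HK₁ t ⟨ht.1, ht.2.le⟩
        _ = _ := by ring
    have hB2 : (∫ z in (1 - t)..1, jw μ υ z) * v (1 - t) ^ 2 ≤ K₂ * H (1 - t) := by
      rw [hHe ⟨by linarith [ht.2], by linarith [ht.1]⟩]
      have e := integral_jw_reflect υ μ 0 t
      rw [sub_zero] at e
      rw [e]
      have e2 : jw (μ + 1) (υ + 1) (1 - t) = jw (υ + 1) (μ + 1) t := jw_reflect _ _ _
      simp only [e2]
      calc _ ≤ (K₂ * jw (υ + 1) (μ + 1) t) * v (1 - t) ^ 2 := by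
            gcongr
            exact HK₂ t ⟨ht.1, ht.2.le⟩
        _ = _ := by ring
    have hI : ∫ z in t..(1 - t), jw μ υ z * v z ^ 2 ≤ ∫ z, v z ^ 2 ∂jm μ υ := by
      rw [integral_jm, intervalIntegral.integral_of_le htt]
      refine setIntegral_mono_set hv2 ?_ (Eventually.of_forall hsub)
      filter_upwards [ae_restrict_mem measurableSet_Ioo] with z hz
      exact mul_nonneg (jw_nonneg hz) (sq_nonneg _)
    have hD : -∫ z in t..(1 - t), Φ z * deriv (fun z => v z ^ 2) z ≤
        2 * C / N * ∫ z in Ioo 0 1, jw μ υ z * (|v z| * |g z|) := by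
      rw [← intervalIntegral.integral_neg, intervalIntegral.integral_of_le htt, ← integral_const_mul]
      have hI2 := hI1'.const_mul (2 * C / N)
      refine (setIntegral_mono_on_ae (g := fun z => 2 * C / N * (jw μ υ z * (|v z| * |g z|)))
        h1.1.neg (IntegrableOn.mono_set hI2 hsub) measurableSet_Ioc ?_).trans ?_
      · have hZae : ∀ᵐ z, z ∉ Z := by
          rw [ae_iff]
          simpa using Z.finite_toSet.measure_zero volume
        filter_upwards [hder, hZae] with z hz hzZ hz1
        have hz2 := hsub hz1
        have hΦz := HΦ N hN z hz2 hzZ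
        have h3 : (0 : ℝ) ≤ √(z * (1 - z)) := Real.sqrt_nonneg _
        calc -(Φ z * deriv (fun z => v z ^ 2) z) ≤ |Φ z * deriv (fun z => v z ^ 2) z| := neg_le_abs _
          _ = |Φ z| * (2 * (|v z| * |deriv v z|)) := by rw [hz hz2, abs_mul, abs_mul, abs_mul]; simp
          _ ≤ (C / N * (jw μ υ z * √(z * (1 - z)))) * (2 * (|v z| * |deriv v z|)) := by gcongr
          _ = _ := by
            simp only [hgdef, abs_mul, abs_of_nonneg h3]
            ring
      · refine setIntegral_mono_set hI2 ?_ (Eventually.of_forall hsub)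
        filter_upwards [ae_restrict_mem measurableSet_Ioo] with z hz
        have := jw_nonneg (μ := μ) (υ := υ) hz
        simp only [Pi.zero_apply]
        positivity
    have hD2 : 2 * C / N * ∫ z in Ioo 0 1, jw μ υ z * (|v z| * |g z|) ≤ 2 * C / N *
        (√(∫ z, v z ^ 2 ∂jm μ υ) * √(∫ z, deriv v z ^ 2 ∂jm (μ + 1) (υ + 1))) := by gcongr
    linarith
  have hlim : Tendsto (fun t => (∫ z, v z ^ 2 ∂jm μ υ + 2 * C / N *
        (√(∫ z, v z ^ 2 ∂jm μ υ) * √(∫ z, deriv v z ^ 2 ∂jm (μ + 1) (υ + 1)))) +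
        (K₂ * H (1 - t) + K₁ * H t)) (𝓝[>] 0)
      (𝓝 ((∫ z, v z ^ 2 ∂jm μ υ + 2 * C / N *
        (√(∫ z, v z ^ 2 ∂jm μ υ) * √(∫ z, deriv v z ^ 2 ∂jm (μ + 1) (υ + 1)))) +
        (K₂ * 0 + K₁ * 0))) := by
    have hmem : ∀ᶠ t : ℝ in 𝓝[>] 0, t ∈ Icc (0 : ℝ) 1 := by
      filter_upwards [Ioo_mem_nhdsGT (zero_lt_one (α := ℝ))] with t ht using ⟨ht.1.le, ht.2.le⟩
    have hT1 : Tendsto H (𝓝[>] 0) (𝓝 0) := by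
      have := hHc 0 (left_mem_Icc.2 zero_le_one)
      rw [ContinuousWithinAt, hH0] at this
      exact this.comp (tendsto_nhdsWithin_iff.2 ⟨tendsto_nhdsWithin_of_tendsto_nhds tendsto_id, hmem⟩)
    have hT2 : Tendsto (fun t => H (1 - t)) (𝓝[>] 0) (𝓝 0) := by
      have := hHc 1 (right_mem_Icc.2 zero_le_one)
      rw [ContinuousWithinAt, hH1] at this
      refine this.comp (tendsto_nhdsWithin_iff.2 ⟨tendsto_nhdsWithin_of_tendsto_nhds ?_, ?_⟩)
      · exact Continuous.tendsto' (by fun_prop) _ _ (by simp)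
      · filter_upwards [hmem] with t ht using ⟨by linarith [ht.2], by linarith [ht.1]⟩
    exact tendsto_const_nhds.add ((hT2.const_mul K₂).add (hT1.const_mul K₁))
  rw [mul_zero, mul_zero, add_zero, add_zero] at hlim
  refine ge_of_tendsto hlim ?_
  have hev : ∀ᶠ t : ℝ in 𝓝[>] 0, ∀ τ ∈ Z, t ≤ τ ∧ τ ≤ 1 - t := by
    rw [Filter.eventually_all_finset]
    intro τ hτ
    have h1 := hZ01 τ hτ
    filter_upwards [Ioo_mem_nhdsGT h1.1, Ioo_mem_nhdsGT (sub_pos.2 h1.2)] with t h2 h3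
    exact ⟨h2.2.le, by linarith [h3.2]⟩
  filter_upwards [hev, Ioo_mem_nhdsGT (by norm_num : (0 : ℝ) < 1 / 2)] with t h1 h2
  exact main t h2 h1

end BackwardJacobi

/-! ### The interpolation error in the transformed variable. -/

namespace BackwardJacobi
open Set Filter Topology Polynomial

theorem factorial_mul_le {N : ℕ} :
    ∀ j ≤ N + 1, N.factorial * N ≤ N ^ j * (N + 1 - j).factorial := by
  intro j
  induction j with
  | zero =>
    intro _
    rw [pow_zero, one_mul, Nat.sub_zero, Nat.factorial_succ, mul_comm]
    gcongr
    omega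
  | succ k ih =>
    intro hk
    rcases Nat.eq_zero_or_pos k with rfl | hk0
    · simp [mul_comm]
    · refine (ih (by omega)).trans ?_
      have e : N + 1 - k = (N + 1 - (k + 1)) + 1 := by omega
      rw [e, Nat.factorial_succ, pow_succ, mul_assoc, ← e]
      gcongr
      omega

/-- `deriv` has default value `0` where the derivative does not exist. When it is continuous, the
function is an integral of it and is differentiable everywhere. -/
theorem LocAC.differentiableAt {G : ℝ → ℝ} (hG : LocAC G) (hc : ContinuousOn (deriv G) (Ioo 0 1))
    {z : ℝ} (hz : z ∈ Ioo (0 : ℝ) 1) : DifferentiableAt ℝ G z := by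
  have h12 : (1 / 2 : ℝ) ∈ Ioo (0 : ℝ) 1 := by constructor <;> norm_num
  have h1 : HasDerivAt (fun u => ∫ x in (1 / 2)..u, deriv G x) (deriv G z) z :=
    intervalIntegral.integral_hasDerivAt_right (hG.ac h12 hz).intervalIntegrable_deriv
      (hc.stronglyMeasurableAtFilter isOpen_Ioo z hz) (hc.continuousAt (isOpen_Ioo.mem_nhds hz))
  have h2 : (fun u => G (1 / 2) + ∫ x in (1 / 2)..u, deriv G x) =ᶠ[𝓝 z] G := by
    filter_upwards [isOpen_Ioo.mem_nhds hz] with u hu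
    rw [(hG.ac h12 hu).integral_deriv_eq_sub]
    ring
  exact ((h1.const_add _).congr_of_eventuallyEq h2.symm).differentiableAt

namespace WSob

variable {μ υ : ℝ} {s : ℕ} {F : ℝ → ℝ}

/-- Below order `s` the derivatives exist everywhere, so subtraction commutes with `deriv` at every
point. At order `s` this holds only almost everywhere. -/
theorem iterate_deriv_sub (hF : WSob μ υ s F) (L : ℝ[X]) :
    ∀ j < s, EqOn (deriv^[j] fun z => F z - L.eval z) (dsub F L j) (Ioo 0 1) := by
  intro j
  induction j with
  | zero => intro _ z _; rfl
  | succ k ih =>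
    intro hk z hz
    have hc : ContinuousOn (deriv (deriv^[k] F)) (Ioo 0 1) := by
      have := (hF.locAC (k + 1) hk).continuousOn
      rwa [Function.iterate_succ_apply'] at this
    have hd := (hF.locAC k (by omega)).differentiableAt hc hz
    rw [Function.iterate_succ_apply',
      ((ih (by omega)).eventuallyEq_of_mem (isOpen_Ioo.mem_nhds hz)).deriv_eq, dsub,
      Function.iterate_succ_apply', Function.iterate_succ_apply']
    exact (hd.hasDerivAt.fun_sub ((derivative^[k] L).hasDerivAt z)).deriv

theorem iterate_deriv_sub_ae (hF : WSob μ υ s F) (L : ℝ[X]) {j : ℕ} (hj : j ≤ s) (α β : ℝ) :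
    (deriv^[j] fun z => F z - L.eval z) =ᵐ[jm α β] dsub F L j := by
  cases j with
  | zero => exact EventuallyEq.rfl
  | succ k =>
    refine EventuallyEq.trans (ae_jm_of_forall fun z hz => ?_) (hF.deriv_dsub L hj α β)
    rw [Function.iterate_succ_apply']
    exact ((hF.iterate_deriv_sub L k hj).eventuallyEq_of_mem (isOpen_Ioo.mem_nhds hz)).deriv_eq

theorem integral_dsub_jproj_le (hμ : -1 < μ) (hυ : -1 < υ) (hF : WSob μ υ s F) {N : ℕ}
    (hN : 1 ≤ N) (hs : s ≤ N + 1) {l : ℕ} (hl : l ≤ s) :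
    ∫ z, dsub F (jproj μ υ F (N + 1)) l z ^ 2 ∂jm (μ + l) (υ + l) ≤
      (N : ℝ) ^ (2 * l) * (((N + 1 - s).factorial : ℝ) / N.factorial / (N : ℝ) ^ (s + 1) *
        ∫ z, deriv^[s] F z ^ 2 ∂jm (μ + s) (υ + s)) := by
  have h := hF.integral_dsub_le hμ hυ hs hl
  have hN0 : (0 : ℝ) < N := by exact_mod_cast hN
  set E := ∫ z, dsub F (jproj μ υ F (N + 1)) l z ^ 2 ∂jm (μ + l) (υ + l)
  set X := ∫ z, deriv^[s] F z ^ 2 ∂jm (μ + s) (υ + s)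
  have hE : 0 ≤ E := integral_nonneg fun z => sq_nonneg _
  have hf : (N.factorial : ℝ) * N ≤ (N : ℝ) ^ l * ((N + 1 - l).factorial : ℝ) := by
    exact_mod_cast factorial_mul_le l (by omega)
  have key : E * (N.factorial * (N : ℝ) ^ (s + 1)) ≤
      (N : ℝ) ^ (2 * l) * (((N + 1 - s).factorial : ℝ) * X) := by
    have e : s + 1 = (s - l) + l + 1 := by omega
    calc E * (N.factorial * (N : ℝ) ^ (s + 1))
        = (N.factorial * N) * ((N : ℝ) ^ (s - l) * (N : ℝ) ^ l * E) := by rw [e, pow_succ, pow_add]; ring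
      _ ≤ ((N : ℝ) ^ l * ((N + 1 - l).factorial : ℝ)) * ((N : ℝ) ^ (s - l) * (N : ℝ) ^ l * E) := by
        gcongr
      _ = (N : ℝ) ^ (2 * l) * (((N + 1 - l).factorial : ℝ) * (N : ℝ) ^ (s - l) * E) := by ring
      _ ≤ _ := by gcongr
  have hD : (0 : ℝ) < N.factorial * (N : ℝ) ^ (s + 1) := by positivity
  rw [← le_div_iff₀ hD] at key
  refine key.trans_eq ?_
  field_simp

end WSob

/-- The error of Gauss–Jacobi interpolation in the weighted Sobolev norms. -/
theorem exists_integral_dsub_interpolate_le {μ υ : ℝ} (hμ : -1 < μ) (hυ : -1 < υ) :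
    ∃ c > 0, ∀ (N s j : ℕ) (F : ℝ → ℝ), 1 ≤ N → 1 ≤ s → j ≤ s → s ≤ N + 1 → WSob μ υ s F →
      ∫ z, dsub F (Lagrange.interpolate (jzeros μ υ (N + 1)) id F) j z ^ 2 ∂jm (μ + j) (υ + j) ≤
        c * ((N : ℝ) ^ (2 * j) * (((N + 1 - s).factorial : ℝ) / N.factorial / (N : ℝ) ^ (s + 1) *
          ∫ z, deriv^[s] F z ^ 2 ∂jm (μ + s) (υ + s))) := by
  obtain ⟨C, hC, HC⟩ := exists_sum_jomega_mul_sq_le hμ hυ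
  set B := max (μ + υ + 1) 0 with hB
  have hB0 : 0 ≤ B := le_max_right _ _
  refine ⟨2 * (1 + Real.exp (2 * B) * (1 + C)), by positivity, fun N s j F hN hs1 hj hs hF => ?_⟩
  have hN0 : (0 : ℝ) < N := by exact_mod_cast hN
  set p := jproj μ υ F (N + 1) with hp
  set Z := jzeros μ υ (N + 1) with hZ
  set W := ((N + 1 - s).factorial : ℝ) / N.factorial / (N : ℝ) ^ (s + 1) *
    ∫ z, deriv^[s] F z ^ 2 ∂jm (μ + s) (υ + s) with hW
  have hW0 : 0 ≤ W := mul_nonneg (by positivity) (integral_nonneg fun z => sq_nonneg _)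
  have hE : ∀ l ≤ s, ∫ z, dsub F p l z ^ 2 ∂jm (μ + l) (υ + l) ≤ (N : ℝ) ^ (2 * l) * W :=
    fun l hl => hF.integral_dsub_jproj_le hμ hυ hN hs hl
  have hinj : Set.InjOn (id : ℝ → ℝ) (Z : Set ℝ) := Function.injective_id.injOn
  have hcard : Z.card = N + 1 := card_jzeros hμ hυ _
  set q := Lagrange.interpolate Z id (dsub F p 0) with hq
  have hqdeg : q.degree < (N + 1 : ℕ) := by
    rw [← hcard]
    exact Lagrange.degree_interpolate_lt _ hinj
  -- Interpolation reproduces `p`, so only the interpolant `q` of `F - p` has to be estimated.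
  have hL : Lagrange.interpolate Z id F = p + q := by
    have h1 : p = Lagrange.interpolate Z id fun z => p.eval (id z) :=
      Lagrange.eq_interpolate hinj (by rw [hcard]; exact degree_jproj_lt hμ hυ F _)
    have h2 : F = (fun z => p.eval (id z)) + dsub F p 0 := by
      funext z
      simp [dsub]
    conv_lhs => rw [h2, map_add, ← h1]
  have hS : ∫ z, q.eval z ^ 2 ∂jm μ υ ≤ (1 + C) * W := by
    rw [hq, integral_interpolate_sq hμ hυ N.succ_pos]
    have m0 := hF.memLp_dsub hμ hυ p (Nat.zero_le s)
    have m1 := hF.memLp_deriv_dsub hμ hυ p hs1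
    have e1 := hF.integral_deriv_dsub_sq p hs1
    simp only [Nat.cast_zero, add_zero] at m0 m1 e1
    refine (HC N hN _ (hF.locAC_dsub p hs1) m0 m1).trans ?_
    rw [e1]
    have hE0 := hE 0 (Nat.zero_le _)
    have hE1 := hE 1 hs1
    simp only [Nat.cast_zero, add_zero, mul_zero, pow_zero, one_mul] at hE0
    -- One derivative of the projection error costs a factor `N`, which the `1 / N` of the stability
    -- estimate cancels.
    have h1 : √(∫ z, dsub F p 0 z ^ 2 ∂jm μ υ) *
        √(∫ z, dsub F p 1 z ^ 2 ∂jm (μ + (1 : ℕ)) (υ + (1 : ℕ))) ≤ N * W := by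
      calc _ ≤ √W * √((N : ℝ) ^ (2 * 1) * W) :=
            mul_le_mul (Real.sqrt_le_sqrt hE0) (Real.sqrt_le_sqrt hE1) (Real.sqrt_nonneg _)
              (Real.sqrt_nonneg _)
        _ = N * W := by
          rw [mul_one, Real.sqrt_mul (sq_nonneg (N : ℝ)) W, Real.sqrt_sq hN0.le, mul_left_comm,
            Real.mul_self_sqrt hW0]
    calc _ ≤ W + C / N * (N * W) := by gcongr
      _ = _ := by field_simp
  have hj0 : (0 : ℝ) ≤ j := j.cast_nonneg
  have hqj : ∫ z, (derivative^[j] q).eval z ^ 2 ∂jm (μ + j) (υ + j) ≤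
      Real.exp (2 * B) * (N : ℝ) ^ (2 * j) * ((1 + C) * W) := by
    refine (integral_iterate_derivative_sq_le hμ hυ hB0 (le_max_left _ _) hqdeg j
      (by omega)).trans ?_
    have h1 := pow_add_mul_le hB0 hN (hj.trans hs)
    have h2 : 0 ≤ ∫ z, q.eval z ^ 2 ∂jm μ υ := integral_nonneg fun z => sq_nonneg _
    exact mul_le_mul h1 hS h2 (by positivity)
  have m1 := (hF.memLp_dsub hμ hυ p hj).integrable_sq
  have m2 := (memLp_polynomial (by linarith) (by linarith) (derivative^[j] q) 2 :
    MemLp _ 2 (jm (μ + j) (υ + j))).integrable_sq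
  rw [hL]
  calc _ ≤ ∫ z, 2 * dsub F p j z ^ 2 + 2 * (derivative^[j] q).eval z ^ 2 ∂jm (μ + j) (υ + j) := by
        refine integral_mono_of_nonneg (Eventually.of_forall fun z => sq_nonneg _)
          ((m1.const_mul 2).add (m2.const_mul 2)) (Eventually.of_forall fun z => ?_)
        have e : dsub F (p + q) j z = dsub F p j z - (derivative^[j] q).eval z := by
          simp only [dsub, iterate_map_add, eval_add]
          ring
        simp only [e]
        nlinarith [sq_nonneg (dsub F p j z + (derivative^[j] q).eval z)]
    _ = 2 * ∫ z, dsub F p j z ^ 2 ∂jm (μ + j) (υ + j) +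
        2 * ∫ z, (derivative^[j] q).eval z ^ 2 ∂jm (μ + j) (υ + j) := by
        rw [integral_add (m1.const_mul 2) (m2.const_mul 2), integral_const_mul, integral_const_mul]
    _ ≤ 2 * ((N : ℝ) ^ (2 * j) * W) + 2 * (Real.exp (2 * B) * (N : ℝ) ^ (2 * j) * ((1 + C) * W)) := by
        gcongr
        exact hE j hj
    _ = _ := by ring

end BackwardJacobi

/-! ### Change of variables and the final estimates. -/

namespace BackwardJacobi
open Set Filter Topology Polynomial

theorem measurable_weight (μ υ ρ : ℝ) : Measurable (weight μ υ ρ) := by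
  unfold weight
  fun_prop

theorem measurable_weightTilde (μ υ ρ : ℝ) : Measurable (weightTilde μ υ ρ) := by
  unfold weightTilde
  fun_prop

theorem wNorm_eq_lintegral {w : ℝ → ℝ} (hw : Measurable w) (g : ℝ → ℝ) :
    wNorm w g = (∫⁻ t in Ioo 0 1, ENNReal.ofReal (w t) * ‖g t‖ₑ ^ (2 : ℝ)) ^ (1 / 2 : ℝ) := by
  rw [wNorm, eLpNorm_eq_lintegral_rpow_enorm_toReal two_ne_zero ENNReal.ofNat_ne_top, wMeasure,
    lintegral_withDensity_eq_lintegral_mul_non_measurable _ hw.ennreal_ofReal (by simp)]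
  simp

theorem wNorm_congr {w w' g g' : ℝ → ℝ} (hw : Measurable w) (hw' : Measurable w')
    (h : ∀ t ∈ Ioo (0 : ℝ) 1, ENNReal.ofReal (w t) * ‖g t‖ₑ ^ (2 : ℝ) =
      ENNReal.ofReal (w' t) * ‖g' t‖ₑ ^ (2 : ℝ)) : wNorm w g = wNorm w' g' := by
  rw [wNorm_eq_lintegral hw, wNorm_eq_lintegral hw', setLIntegral_congr_fun measurableSet_Ioo h]

section ChangeOfVariables

variable {ρ : ℝ}

theorem zmap_mem (hρ : 0 < ρ) {t : ℝ} (ht : t ∈ Ioo (0 : ℝ) 1) : zmap ρ t ∈ Ioo (0 : ℝ) 1 := by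
  have h0 : 0 < 1 - t := by linarith [ht.2]
  have h1 : 0 < (1 - t) ^ ρ := Real.rpow_pos_of_pos h0 _
  have h2 : (1 - t) ^ ρ < 1 := Real.rpow_lt_one h0.le (by linarith [ht.1]) hρ
  constructor <;> rw [zmap] <;> linarith

theorem zmap_zmap {σ : ℝ} (h : ρ * σ = 1) {t : ℝ} (ht : t ∈ Ioo (0 : ℝ) 1) :
    zmap σ (zmap ρ t) = t := by
  have h0 : 0 ≤ 1 - t := by linarith [ht.2]
  rw [zmap, zmap, sub_sub_cancel, ← Real.rpow_mul h0, h, Real.rpow_one, sub_sub_cancel]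

theorem hasDerivAt_zmap (ρ : ℝ) {t : ℝ} (ht : t ∈ Ioo (0 : ℝ) 1) :
    HasDerivAt (zmap ρ) (ρ * (1 - t) ^ (ρ - 1)) t := by
  have h0 : 0 < 1 - t := by linarith [ht.2]
  have h2 := (((hasDerivAt_id t).const_sub 1).rpow_const (p := ρ) (Or.inl h0.ne')).const_sub 1
  refine h2.congr_deriv ?_
  simp

theorem image_zmap (hρ : 0 < ρ) : zmap ρ '' Ioo 0 1 = Ioo 0 1 := by
  ext z
  constructor
  · rintro ⟨t, ht, rfl⟩
    exact zmap_mem hρ ht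
  · intro hz
    exact ⟨zmap ρ⁻¹ z, zmap_mem (inv_pos.2 hρ) hz, zmap_zmap (inv_mul_cancel₀ hρ.ne') hz⟩

theorem injOn_zmap (hρ : 0 < ρ) : InjOn (zmap ρ) (Ioo 0 1) := fun t ht u hu h => by
  rw [← zmap_zmap (mul_inv_cancel₀ hρ.ne') ht, h, zmap_zmap (mul_inv_cancel₀ hρ.ne') hu]

theorem transform_eq (ρ : ℝ) (f : ℝ → ℝ) (z : ℝ) : transform ρ f z = f (zmap ρ⁻¹ z) := by
  rw [transform, zmap, one_div]

theorem transform_zmap (hρ : 0 < ρ) (f : ℝ → ℝ) {t : ℝ} (ht : t ∈ Ioo (0 : ℝ) 1) :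
    transform ρ f (zmap ρ t) = f t := by
  rw [transform_eq, zmap_zmap (mul_inv_cancel₀ hρ.ne') ht]

theorem weight_eq (μ υ ρ : ℝ) {t : ℝ} (ht : t ∈ Ioo (0 : ℝ) 1) :
    weight μ υ ρ t = ρ * (1 - t) ^ (ρ - 1) * jw μ υ (zmap ρ t) := by
  have h0 : 0 < 1 - t := by linarith [ht.2]
  rw [weight, jw, zmap, sub_sub_cancel, ← Real.rpow_mul h0.le,
    show ρ * (μ + 1) - 1 = (ρ - 1) + ρ * μ by ring, Real.rpow_add h0]
  ring

/-- The weight is the Jacobian of `zmap` times the Jacobi weight. Working with lower integrals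
requires neither measurability nor finiteness of the norm of `G`. -/
theorem wNorm_comp_zmap (hρ : 0 < ρ) (μ υ : ℝ) (G : ℝ → ℝ) :
    wNorm (weight μ υ ρ) (fun t => G (zmap ρ t)) = wNorm (jw μ υ) G := by
  rw [wNorm_eq_lintegral (measurable_weight μ υ ρ), wNorm_eq_lintegral (measurable_jw μ υ)]
  conv_rhs => rw [← image_zmap hρ]
  rw [lintegral_image_eq_lintegral_abs_deriv_mul measurableSet_Ioo
    (fun t ht => (hasDerivAt_zmap ρ ht).hasDerivWithinAt) (injOn_zmap hρ)]
  congr 1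
  refine setLIntegral_congr_fun measurableSet_Ioo fun t ht => ?_
  have h1 : 0 ≤ ρ * (1 - t) ^ (ρ - 1) :=
    mul_nonneg hρ.le (Real.rpow_nonneg (by linarith [ht.2]) _)
  simp only [weight_eq μ υ ρ ht]
  rw [ENNReal.ofReal_mul h1, abs_of_nonneg h1, mul_assoc]

theorem backDeriv_comp_zmap (hρ : 0 < ρ) (H : ℝ → ℝ) {t : ℝ} (ht : t ∈ Ioo (0 : ℝ) 1) :
    backDeriv ρ (fun t => H (zmap ρ t)) t = deriv H (zmap ρ t) := by
  have h0 : 0 < 1 - t := by linarith [ht.2]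
  have hz := zmap_mem hρ ht
  rw [backDeriv]
  by_cases hH : DifferentiableAt ℝ H (zmap ρ t)
  · have h1 : HasDerivAt (fun t => H (zmap ρ t)) (deriv H (zmap ρ t) * (ρ * (1 - t) ^ (ρ - 1))) t :=
      hH.hasDerivAt.comp t (hasDerivAt_zmap ρ ht)
    have h2 : (1 - t) ^ (1 - ρ) * (1 - t) ^ (ρ - 1) = 1 := by
      rw [← Real.rpow_add h0, sub_add_sub_cancel', sub_self, Real.rpow_zero]
    rw [h1.deriv]
    calc _ = ((1 - t) ^ (1 - ρ) * (1 - t) ^ (ρ - 1)) * (ρ / ρ) * deriv H (zmap ρ t) := by ring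
      _ = _ := by rw [h2, div_self hρ.ne', one_mul, one_mul]
  -- The inverse map is smooth inside the interval, so differentiability fails on both sides
  -- together and both derivatives take the default value `0`. Hence the identity holds pointwise
  -- and can be iterated.
  · rw [deriv_zero_of_not_differentiableAt hH, deriv_zero_of_not_differentiableAt, mul_zero]
    intro h
    refine hH ?_
    have hinv : ρ * ρ⁻¹ = 1 := mul_inv_cancel₀ hρ.ne'
    rw [← zmap_zmap hinv ht] at h
    have h1 := h.comp (zmap ρ t) (hasDerivAt_zmap ρ⁻¹ hz).differentiableAt
    refine h1.congr_of_eventuallyEq ?_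
    filter_upwards [isOpen_Ioo.mem_nhds hz] with z hz1
    simp only [Function.comp]
    rw [zmap_zmap (by rw [mul_comm, hinv]) hz1]

theorem iterate_backDeriv_eqOn (hρ : 0 < ρ) {h G : ℝ → ℝ}
    (hG : EqOn h (fun t => G (zmap ρ t)) (Ioo 0 1)) (j : ℕ) :
    EqOn ((backDeriv ρ)^[j] h) (fun t => deriv^[j] G (zmap ρ t)) (Ioo 0 1) := by
  induction j with
  | zero => exact hG
  | succ k ih =>
    intro t ht
    simp only [Function.iterate_succ_apply']
    rw [← backDeriv_comp_zmap hρ _ ht, backDeriv, backDeriv,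
      (ih.eventuallyEq_of_mem (isOpen_Ioo.mem_nhds ht)).deriv_eq]

end ChangeOfVariables

theorem mem_nodes_iff {N : ℕ} {μ υ ρ : ℝ} (hμ : -1 < μ) (hυ : -1 < υ) (hρ : 0 < ρ) {t : ℝ} :
    t ∈ nodes N μ υ ρ ↔ t ∈ Ioo (0 : ℝ) 1 ∧ zmap ρ t ∈ jzeros μ υ (N + 1) := by
  rw [mem_nodes hμ hρ, mem_jzeros hμ hυ]
  have h : (sjac μ υ (N + 1)).eval (zmap ρ t) = backJacobi (N + 1) μ υ ρ t := by
    rw [sjac, backJacobi, eval_comp]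
    congr 1
    simp [zmap]
    ring
  rw [h]
  exact ⟨fun h1 => ⟨h1.1, zmap_mem hρ h1.1, h1.2⟩, fun h1 => ⟨h1.1, h1.2.2⟩⟩

theorem exists_node {N : ℕ} {μ υ ρ : ℝ} (hμ : -1 < μ) (hυ : -1 < υ) (hρ : 0 < ρ) {z : ℝ}
    (hz : z ∈ jzeros μ υ (N + 1)) : ∃ t ∈ nodes N μ υ ρ, zmap ρ t = z := by
  have h1 := ((mem_jzeros hμ hυ).1 hz).1
  have h2 : zmap ρ (zmap ρ⁻¹ z) = z := zmap_zmap (inv_mul_cancel₀ hρ.ne') h1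
  exact ⟨zmap ρ⁻¹ z, (mem_nodes_iff hμ hυ hρ).2 ⟨zmap_mem (inv_pos.2 hρ) h1, by rwa [h2]⟩, h2⟩

theorem interp_eq {N : ℕ} {μ υ ρ : ℝ} (hμ : -1 < μ) (hυ : -1 < υ) (hρ : 0 < ρ) (f : ℝ → ℝ) (t : ℝ) :
    interp N μ υ ρ f t =
      (Lagrange.interpolate (jzeros μ υ (N + 1)) id (transform ρ f)).eval (zmap ρ t) := by
  classical
  have hmem : ∀ τ ∈ nodes N μ υ ρ, τ ∈ Ioo (0 : ℝ) 1 ∧ zmap ρ τ ∈ jzeros μ υ (N + 1) :=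
    fun τ hτ => (mem_nodes_iff hμ hυ hρ).1 hτ
  have hinj : InjOn (zmap ρ) (nodes N μ υ ρ) := fun a ha b hb h =>
    injOn_zmap hρ (hmem a ha).1 (hmem b hb).1 h
  rw [interp, Lagrange.interpolate_apply, eval_finsetSum]
  refine Finset.sum_nbij (zmap ρ) (fun τ hτ => (hmem τ hτ).2) hinj
    (fun z hz => exists_node hμ hυ hρ hz) fun τ hτ => ?_
  rw [eval_mul, eval_C, transform_zmap hρ f (hmem τ hτ).1, lagrangeFun, Lagrange.basis, eval_prod]
  congr 1
  refine Finset.prod_nbij (zmap ρ) (fun σ hσ => ?_) (hinj.mono (Finset.erase_subset _ _))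
    (fun z hz => ?_) fun σ hσ => ?_
  · rw [Finset.mem_erase] at hσ ⊢
    exact ⟨fun h => hσ.1 (hinj hσ.2 hτ h), (hmem σ hσ.2).2⟩
  · rw [Finset.mem_coe, Finset.mem_erase] at hz
    obtain ⟨σ, hσ, rfl⟩ := exists_node hμ hυ hρ hz.2
    exact ⟨σ, Finset.mem_coe.2 (Finset.mem_erase.2 ⟨fun h => hz.1 (by rw [h]), hσ⟩), rfl⟩
  · simp [Lagrange.basisDivisor, div_eq_inv_mul]

theorem backDeriv_one : backDeriv 1 = deriv := by
  funext f t
  simp [backDeriv]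

theorem MemB.wSob {μ υ : ℝ} {s : ℕ} {F : ℝ → ℝ} (h : MemB μ υ 1 s F) : WSob μ υ s F where
  locAC k hk := by
    have := h.locallyAC k hk
    rwa [backDeriv_one] at this
  memLp k hk := by
    have := h.memLp k hk
    rwa [backDeriv_one, weight_one] at this

theorem wNorm_error_eq {N s j : ℕ} {μ υ ρ : ℝ} (hμ : -1 < μ) (hυ : -1 < υ) (hρ : 0 < ρ)
    {f : ℝ → ℝ} (hF : WSob μ υ s (transform ρ f)) (hj : j ≤ s) :
    wNorm (weight (μ + j) (υ + j) ρ) ((backDeriv ρ)^[j] (f - interp N μ υ ρ f)) =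
      ENNReal.ofReal √(∫ z, dsub (transform ρ f)
        (Lagrange.interpolate (jzeros μ υ (N + 1)) id (transform ρ f)) j z ^ 2
          ∂jm (μ + j) (υ + j)) := by
  set F := transform ρ f with hFdef
  set L := Lagrange.interpolate (jzeros μ υ (N + 1)) id F with hL
  have h1 : EqOn (f - interp N μ υ ρ f) (fun t => (fun z => F z - L.eval z) (zmap ρ t))
      (Ioo 0 1) := fun t ht => by
    simp only [Pi.sub_apply, interp_eq hμ hυ hρ, hFdef, transform_zmap hρ f ht, hL]
  have h2 := iterate_backDeriv_eqOn hρ (G := fun z => F z - L.eval z) h1 j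
  have hw := measurable_weight (μ + j) (υ + j) ρ
  rw [wNorm_congr hw hw (fun t ht => by rw [h2 ht]), wNorm_comp_zmap hρ, wNorm,
    ← eLpNorm_two_eq (hF.memLp_dsub hμ hυ L hj)]
  exact eLpNorm_congr_ae (hF.iterate_deriv_sub_ae L hj _ _)

theorem exists_wNorm_error_le {μ υ ρ : ℝ} (hμ : -1 < μ) (hυ : -1 < υ) (hρ : 0 < ρ) :
    ∃ c : ℝ, 0 < c ∧ ∀ (N s j : ℕ) (f : ℝ → ℝ), 1 ≤ N → 1 ≤ s → j ≤ s → s ≤ N + 1 →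
      MemB μ υ 1 s (transform ρ f) →
      wNorm (weight (μ + j) (υ + j) ρ) ((backDeriv ρ)^[j] (f - interp N μ υ ρ f)) ≤
        ENNReal.ofReal (c * Real.sqrt (((N + 1 - s).factorial : ℝ) / (N.factorial : ℝ)) *
            (N : ℝ) ^ ((j : ℝ) - ((s : ℝ) + 1) / 2)) *
          wNorm (weight (μ + s) (υ + s) 1) (iteratedDeriv s (transform ρ f)) := by
  obtain ⟨c, hc, H⟩ := exists_integral_dsub_interpolate_le hμ hυ
  refine ⟨√c, Real.sqrt_pos.2 hc, fun N s j f hN hs1 hj hs hB => ?_⟩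
  have hF := hB.wSob
  have hN0 : (0 : ℝ) < N := by exact_mod_cast hN
  have h1 := Real.sqrt_le_sqrt (H N s j _ hN hs1 hj hs hF)
  have h2 : wNorm (weight (μ + s) (υ + s) 1) (iteratedDeriv s (transform ρ f)) =
      ENNReal.ofReal √(∫ z, deriv^[s] (transform ρ f) z ^ 2 ∂jm (μ + s) (υ + s)) := by
    rw [weight_one, iteratedDeriv_eq_iterate, ← eLpNorm_two_eq (hF.memLp s le_rfl)]
    rfl
  rw [wNorm_error_eq hμ hυ hρ hF hj, h2, ← ENNReal.ofReal_mul (by positivity)]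
  refine ENNReal.ofReal_le_ofReal (h1.trans_eq ?_)
  set X := ∫ z, deriv^[s] (transform ρ f) z ^ 2 ∂jm (μ + s) (υ + s)
  set R := ((N + 1 - s).factorial : ℝ) / (N.factorial : ℝ) with hR
  have hR0 : 0 ≤ R := by positivity
  have e : (N : ℝ) ^ (2 * j) / (N : ℝ) ^ (s + 1) = ((N : ℝ) ^ ((j : ℝ) - ((s : ℝ) + 1) / 2)) ^ 2 := by
    rw [← Real.rpow_natCast, ← Real.rpow_natCast, ← Real.rpow_sub hN0, ← Real.rpow_natCast,
      ← Real.rpow_mul hN0.le]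
    congr 1
    push_cast
    ring
  rw [show c * ((N : ℝ) ^ (2 * j) * (R / (N : ℝ) ^ (s + 1) * X)) =
    c * R * ((N : ℝ) ^ (2 * j) / (N : ℝ) ^ (s + 1)) * X by ring, e,
    Real.sqrt_mul (by positivity), Real.sqrt_mul (by positivity), Real.sqrt_mul hc.le,
    Real.sqrt_sq (by positivity)]

/-- `N! / (N + 1 - s)!` has `s - 1` factors, each at least `N + 2 - s`, and `N ≤ s (N + 2 - s)`. -/
theorem factorial_mul_pow_le {N s : ℕ} (hs1 : 1 ≤ s) (hs : s ≤ N + 1) :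
    (N + 1 - s).factorial * N ^ (s - 1) ≤ s ^ (s - 1) * N.factorial := by
  have h1 : N.factorial = (N + 1 - s).factorial * N.descFactorial (s - 1) := by
    rw [← Nat.factorial_mul_descFactorial (show s - 1 ≤ N by omega),
      show N - (s - 1) = N + 1 - s by omega]
  have h2 : (N + 1 - (s - 1)) ^ (s - 1) ≤ N.descFactorial (s - 1) := Nat.pow_sub_le_descFactorial _ _
  have h3 : N ≤ s * (N + 1 - (s - 1)) := by
    obtain ⟨r, rfl⟩ := Nat.exists_eq_add_of_le' hs1
    obtain ⟨m, rfl⟩ := Nat.exists_eq_add_of_le (show r ≤ N by omega)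
    rw [show r + m + 1 - (r + 1 - 1) = m + 1 by omega]
    nlinarith [Nat.zero_le (r * m)]
  calc (N + 1 - s).factorial * N ^ (s - 1)
      ≤ (N + 1 - s).factorial * (s * (N + 1 - (s - 1))) ^ (s - 1) := by gcongr
    _ = s ^ (s - 1) * ((N + 1 - s).factorial * (N + 1 - (s - 1)) ^ (s - 1)) := by
      rw [mul_pow]; ring
    _ ≤ s ^ (s - 1) * N.factorial := by rw [h1]; gcongr

theorem sqrt_factorial_mul_rpow_le {N s : ℕ} (hN : 1 ≤ N) (hs1 : 1 ≤ s) (hs : s ≤ N + 1) (j : ℝ) :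
    √(((N + 1 - s).factorial : ℝ) / (N.factorial : ℝ)) * (N : ℝ) ^ (j - ((s : ℝ) + 1) / 2) ≤
      √((s : ℝ) ^ (s - 1)) * (N : ℝ) ^ (j - s) := by
  have hN0 : (0 : ℝ) < N := by exact_mod_cast hN
  have h1 : ((N + 1 - s).factorial : ℝ) * (N : ℝ) ^ (s - 1) ≤ (s : ℝ) ^ (s - 1) * N.factorial := by
    exact_mod_cast factorial_mul_pow_le hs1 hs
  have h2 : ((N + 1 - s).factorial : ℝ) / (N.factorial : ℝ) ≤
      (s : ℝ) ^ (s - 1) * ((N : ℝ) ^ (-(((s : ℝ) - 1) / 2))) ^ 2 := by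
    have e : ((N : ℝ) ^ (-(((s : ℝ) - 1) / 2))) ^ 2 = ((N : ℝ) ^ (s - 1))⁻¹ := by
      rw [← Real.rpow_natCast, ← Real.rpow_natCast, ← Real.rpow_mul hN0.le, ← Real.rpow_neg hN0.le]
      congr 1
      push_cast [hs1]
      ring
    rw [e, ← div_eq_mul_inv, div_le_div_iff₀ (by positivity) (by positivity)]
    exact h1
  have h3 := Real.sqrt_le_sqrt h2
  rw [Real.sqrt_mul (by positivity), Real.sqrt_sq (by positivity)] at h3
  calc _ ≤ √((s : ℝ) ^ (s - 1)) * (N : ℝ) ^ (-(((s : ℝ) - 1) / 2)) *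
        (N : ℝ) ^ (j - ((s : ℝ) + 1) / 2) := by gcongr
    _ = _ := by
      rw [mul_assoc, ← Real.rpow_add hN0]
      congr 2
      ring

/-- The second weight of the statement is the raised weight times the square of the factor in
`backDeriv`; the `∂_t` estimate is thus the case of order one. -/
theorem wNorm_weightTilde_deriv {μ υ ρ : ℝ} (hρ : 0 < ρ) (g : ℝ → ℝ) :
    wNorm (weightTilde μ υ ρ) (deriv g) = wNorm (weight (μ + 1) (υ + 1) ρ) (backDeriv ρ g) := by
  refine wNorm_congr (measurable_weightTilde μ υ ρ) (measurable_weight _ _ _) fun t ht => ?_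
  have h0 : 0 < 1 - t := by linarith [ht.2]
  have hz := zmap_mem hρ ht
  rw [zmap] at hz
  have e : weightTilde μ υ ρ t = weight (μ + 1) (υ + 1) ρ t * ((1 - t) ^ (1 - ρ) / ρ) ^ 2 := by
    have e1 : (1 - t) ^ (ρ * μ + 1) =
        (1 - t) ^ (ρ * (μ + 1 + 1) - 1) * ((1 - t) ^ (1 - ρ)) ^ 2 := by
      rw [← Real.rpow_natCast, ← Real.rpow_mul h0.le, ← Real.rpow_add h0]
      congr 1
      push_cast
      ring
    rw [weightTilde, weight, e1]
    field_simp
  have hw : 0 ≤ weight (μ + 1) (υ + 1) ρ t :=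
    mul_nonneg (mul_nonneg hρ.le (Real.rpow_nonneg h0.le _)) (Real.rpow_nonneg hz.1.le _)
  have h2 : 0 ≤ (1 - t) ^ (1 - ρ) / ρ := by positivity
  rw [e, backDeriv, ENNReal.ofReal_mul hw, enorm_mul, Real.enorm_of_nonneg h2, mul_assoc,
    ENNReal.ofReal_pow h2, ENNReal.rpow_two, ENNReal.rpow_two, mul_pow]

end BackwardJacobi

open BackwardJacobi in
theorem proposition2 (μ υ ρ : ℝ) (hμ : -1 < μ) (hυ : -1 < υ) (hρ0 : 0 < ρ) (hρ1 : ρ ≤ 1) :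
    (∃ c : ℝ, 0 < c ∧ ∀ (N s j : ℕ) (f : ℝ → ℝ), 1 ≤ N → 1 ≤ s → j ≤ s → s ≤ N + 1 →
      MemB μ υ 1 s (transform ρ f) →
      wNorm (weight (μ + j) (υ + j) ρ) ((backDeriv ρ)^[j] (f - interp N μ υ ρ f)) ≤
        ENNReal.ofReal (c * Real.sqrt (((N + 1 - s).factorial : ℝ) / (N.factorial : ℝ)) *
            (N : ℝ) ^ ((j : ℝ) - ((s : ℝ) + 1) / 2)) *
          wNorm (weight (μ + s) (υ + s) 1) (iteratedDeriv s (transform ρ f))) ∧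
    (∀ s : ℕ, 1 ≤ s → ∃ c : ℝ, 0 < c ∧ ∀ (N : ℕ) (f : ℝ → ℝ), 1 ≤ N → s ≤ N + 1 →
      MemB μ υ 1 s (transform ρ f) →
      (∀ j : ℕ, j ≤ s →
        wNorm (weight (μ + j) (υ + j) ρ) ((backDeriv ρ)^[j] (f - interp N μ υ ρ f)) ≤
          ENNReal.ofReal (c * (N : ℝ) ^ ((j : ℝ) - (s : ℝ))) *
            wNorm (weight (μ + s) (υ + s) 1) (iteratedDeriv s (transform ρ f))) ∧
      wNorm (weight μ υ ρ) (f - interp N μ υ ρ f) ≤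
        ENNReal.ofReal (c * (N : ℝ) ^ (-(s : ℝ))) *
          wNorm (weight (μ + s) (υ + s) 1) (iteratedDeriv s (transform ρ f)) ∧
      wNorm (weightTilde μ υ ρ) (deriv (f - interp N μ υ ρ f)) ≤
        ENNReal.ofReal (c * (N : ℝ) ^ (1 - (s : ℝ))) *
          wNorm (weight (μ + s) (υ + s) 1) (iteratedDeriv s (transform ρ f))) := by
  refine ⟨exists_wNorm_error_le hμ hυ hρ0, fun s hs1 => ?_⟩
  obtain ⟨c, hc, H⟩ := exists_wNorm_error_le hμ hυ hρ0
  have hs0 : (0 : ℝ) < s := by exact_mod_cast hs1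
  -- The dependence of the constant on `s` comes only from comparing the factorials with powers of
  -- `N`.
  refine ⟨c * √((s : ℝ) ^ (s - 1)), by positivity, fun N f hN hs hB => ?_⟩
  have main : ∀ j : ℕ, j ≤ s →
      wNorm (weight (μ + j) (υ + j) ρ) ((backDeriv ρ)^[j] (f - interp N μ υ ρ f)) ≤
        ENNReal.ofReal (c * √((s : ℝ) ^ (s - 1)) * (N : ℝ) ^ ((j : ℝ) - (s : ℝ))) *
          wNorm (weight (μ + s) (υ + s) 1) (iteratedDeriv s (transform ρ f)) := by
    intro j hj
    refine (H N s j f hN hs1 hj hs hB).trans ?_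
    gcongr ?_ * _
    refine ENNReal.ofReal_le_ofReal ?_
    rw [mul_assoc, mul_assoc]
    exact mul_le_mul_of_nonneg_left (sqrt_factorial_mul_rpow_le hN hs1 hs j) hc.le
  refine ⟨main, ?_, ?_⟩
  · simpa using main 0 (Nat.zero_le _)
  · rw [wNorm_weightTilde_deriv hρ0]
    simpa using main 1 hs1
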